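/- Let $\mathbf h$ be a formal deformation parameter; all algebras are over $\mathbb C[[\mathbf h]]$, separated and complete in the $\mathbf h$-adic topology, and tensor products are completed and $\mathbb Z/2$-graded: $(a\otimes b)(c\otimes d)=(-1)^{\deg b\deg c}ac\otimes bd$. Let $U=U(osp(1|2))[[\mathbf h]]$, where $U(osp(1|2))$ has even generators $h,b_\pm$ and odd generators $e,f$ with $$[h,e]=e,\ [h,f]=-f,\ \{e,f\}=-h,\ [h,b_\pm]=\pm2b_\pm,\ [b_+,b_-]=h,\ [b_+,f]=e,\ [b_-,e]=f,\ b_+=e^2,\ b_-=-f^2 .$$ Let $U_{\mathbf h}$ be the superalgebra topologically generated by even $\mathbf{H,X,Y}$ and odd $\mathbf{E,F}$ with, for $\mathbf T^{r}=\exp(r\mathbf{hX})$ and with $\frac{1}{2\mathbf h}(\mathbf T-\mathbf T^{-1})$ read as the series $\sinh(\mathbf{hX})/\mathbf h$, the relations $$[\mathbf H,\mathbf E]=\tfrac12(\mathbf T+\mathbf T^{-1})\mathbf E,\quad \{\mathbf E,\mathbf F\}=-\tfrac14(\mathbf T+\mathbf T^{-1})\mathbf H-\tfrac14\mathbf H(\mathbf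 T+\mathbf T^{-1}),\quad [\mathbf H,\mathbf T^{\pm1}]=\mathbf T^{\pm2}-1,$$ $$[\mathbf H,\mathbf F]=-\tfrac14(\mathbf T+\mathbf T^{-1})\mathbf F-\tfrac14\mathbf F(\mathbf T+\mathbf T^{-1})-\tfrac{\mathbf h}8\big((\mathbf T-\mathbf T^{-1})\mathbf H+\mathbf H(\mathbf T-\mathbf T^{-1})\big)\mathbf E-\tfrac{\mathbf h}8\mathbf E\big((\mathbf T-\mathbf T^{-1})\mathbf H+\mathbf H(\mathbf T-\mathbf T^{-1})\big),$$ $$[\mathbf H,\mathbf Y]=-\tfrac12(\mathbf T+\mathbf T^{-1})\mathbf Y-\tfrac12\mathbf Y(\mathbf T+\mathbf T^{-1}),\quad [\mathbf T^{\pm1},\mathbf Y]=\pm\tfrac{\mathbf h}2(\mathbf T^{\pm1}\mathbf H+\mathbf H\mathbf T^{\pm1}),$$ $$\mathbf E^2=\tfrac1{2\mathbf h}(\mathbf T-\mathbf T^{-1}),\quad [\mathbf Y,\mathbf E]=\mathbf F,\quad [\mathbf T^{\pm1},\mathbf F]=\pm\tfrac{\mathbf h}2(\mathbf T^{\pm2}+1)\mathbf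 E,$$ $$\mathbf F^2=-\mathbf Y+\tfrac{\mathbf h}8(\mathbf T-\mathbf T^{-1})\mathbf H^2+\tfrac{\mathbf h}4(\mathbf T-\mathbf T^{-1})\mathbf{EF}+\tfrac{3\mathbf h}{16}(\mathbf T^2-\mathbf T^{-2})\mathbf H+\tfrac{\mathbf h}4(\mathbf T-\mathbf T^{-1})+\tfrac{9\mathbf h}{128}(\mathbf T-\mathbf T^{-1})^3,$$ $$[\mathbf F,\mathbf Y]=\tfrac{\mathbf h}4(\mathbf T-\mathbf T^{-1})\mathbf F+\tfrac{\mathbf h}2(\mathbf T-\mathbf T^{-1})\mathbf{EY}-\tfrac{\mathbf h^2}4\mathbf{EH}^2-\tfrac{3\mathbf h^2}8(\mathbf T+\mathbf T^{-1})\mathbf{EH}-\tfrac{\mathbf h^2}2\mathbf E-\tfrac{15\mathbf h^2}{64}(\mathbf T-\mathbf T^{-1})^2\mathbf E .$$ A mapping function is an element of $\mathbb C[x][[\mathbf h]]$, evaluated at $x=b_+$ in $U$ and at $x=\mathbf X=\mathbf h^{-1}\ln\mathbf T$ in $U_{\mathbf h}$ (where it is written as a function of $\mathbf T$); it is admissible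 if it is $1$ modulo $\mathbf h$. **(1) Direct maps.** Let $\varphi_1$ be admissible. For mapping functions $\varphi_2,\varphi_3,u_1,u_2$, there is a $\mathbb C[[\mathbf h]]$-algebra homomorphism $m:U_{\mathbf h}\to U$ with $$m(\mathbf E)=\varphi_1(b_+)e,\quad m(\mathbf H)=\varphi_2(b_+)h,\quad m(\mathbf F)=\varphi_3(b_+)f+u_1(b_+)e+u_2(b_+)eh$$ if and only if $$\varphi_2=\frac{\sqrt{1+\mathbf h^2x^2\varphi_1^4}\,\varphi_1}{\varphi_1+2x\varphi_1'},\quad \varphi_3=\frac1{\varphi_1},\quad u_1=-\frac{\mathbf h^2}4x\varphi_1^3,\quad u_2=\frac{1-\sqrt{1+\mathbf h^2x^2\varphi_1^4}\,\varphi_2}{2x\varphi_1}.$$ Such mapping functions exist and tend to $1,1,0,0$ as $\mathbf h\to0$; moreover $m(\mathbf T^{\pm1})=\pm\mathbf hb_+\varphi_1(b_+)^2+\sqrt{1+\mathbf h^2b_+^2\varphi_1(b_+)^4}$. **(2) Inverse maps.** Let $\psi_1$ be admissible. For mapping functions $\psi_2,\psi_3,w_1,w_2$, there is a $\mathbb C[[\mathbf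 h]]$-algebra homomorphism $n:U\to U_{\mathbf h}$ with $$n(e)=\psi_1(\mathbf T)\mathbf E,\quad n(h)=\psi_2(\mathbf T)\mathbf H,\quad n(f)=\psi_3(\mathbf T)\mathbf F+w_1(\mathbf T)\mathbf E+w_2(\mathbf T)\mathbf{EH}$$ if and only if $$\psi_2=\frac{2\psi_1}{(\mathbf T+\mathbf T^{-1})\psi_1+2(\mathbf T^2-1)\,d\psi_1/d\mathbf T},\quad \psi_3=\frac1{\psi_1},\quad w_1=\frac{\mathbf h(\mathbf T-\mathbf T^{-1})}{8\psi_1},\quad w_2=\mathbf h\frac{\mathbf T+\mathbf T^{-1}-2\psi_2}{2(\mathbf T-\mathbf T^{-1})\psi_1}.$$ Such mapping functions exist and tend to $1,1,0,0$ as $\mathbf h\to0$. **(3) Invertibility.** Every map $m$ of (1) has a two-sided inverse of the form (2), and every map $n$ of (2) has a two-sided inverse of the form (1). Maps $m$ and $n$ belonging to $\varphi_1$ and $\psi_1$ are inverse to each other if and only if $m(\psi_1(\mathbf T))\,\varphi_1(b_+)=1$. **(4) Minimal twist map.** For $\varphi_1=(1-2\mathbf hx)^{-1/4}$ and $\psi_1=\mathbf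 T^{-1/2}$ the maps are inverse to each other and read $$m(\mathbf E)=(1-2\mathbf hb_+)^{-1/4}e,\quad m(\mathbf H)=(1-2\mathbf hb_+)^{1/2}h,\quad m(\mathbf T^{\pm1})=(1-2\mathbf hb_+)^{\mp1/2},$$ $$m(\mathbf F)=(1-2\mathbf hb_+)^{1/4}f-\tfrac{\mathbf h^2}4b_+(1-2\mathbf hb_+)^{-3/4}e+\tfrac{\mathbf h}2(1-2\mathbf hb_+)^{1/4}eh,$$ $$n(e)=\mathbf T^{-1/2}\mathbf E,\quad n(h)=\mathbf{TH},\quad n(f)=\mathbf T^{1/2}\mathbf F+\tfrac{\mathbf h}8\mathbf T^{1/2}(\mathbf T-\mathbf T^{-1})\mathbf E-\tfrac{\mathbf h}2\mathbf T^{1/2}\mathbf{EH}.$$ Let $\Delta_0,S_0$ be the cocommutative coproduct and the antipode of $U$ (generators primitive). There are an algebra homomorphism $\Delta:U_{\mathbf h}\to U_{\mathbf h}\otimes U_{\mathbf h}$ and a graded antihomomorphism $S$ of $U_{\mathbf h}$ with $\mathbf X$ primitive, $\Delta(\mathbf T^{\pm1})=\mathbf T^{\pm1}\otimes\mathbf T^{\pm1}$,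 $$\Delta(\mathbf H)=\mathbf H\otimes\mathbf T+\mathbf T^{-1}\otimes\mathbf H,\quad \Delta(\mathbf E)=\mathbf E\otimes\mathbf T^{-1/2}+\mathbf T^{1/2}\otimes\mathbf E,\quad \Delta(\mathbf Y)=\mathbf Y\otimes\mathbf T+\mathbf T^{-1}\otimes\mathbf Y,$$ $$\Delta(\mathbf F)=\mathbf F\otimes\mathbf T^{1/2}+\mathbf T^{-1/2}\otimes\mathbf F+\tfrac{\mathbf h}4\mathbf T^{-1}\mathbf E\otimes(\mathbf T^{-1/2}\mathbf H+\mathbf H\mathbf T^{-1/2})-\tfrac{\mathbf h}4(\mathbf T^{1/2}\mathbf H+\mathbf H\mathbf T^{1/2})\otimes\mathbf{TE},$$ $$S(\mathbf H)=-\mathbf H+2\mathbf h\mathbf E^2,\ S(\mathbf E)=-\mathbf E,\ S(\mathbf F)=-\mathbf F-\tfrac{\mathbf h}2(\mathbf T+\mathbf T^{-1})\mathbf E,\ S(\mathbf T^{\pm1})=\mathbf T^{\mp1},\ S(\mathbf Y)=-\mathbf Y-\mathbf{hH}+\mathbf h^2\mathbf E^2,$$ and the invertible elements $G=\exp(\mathbf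 h\,\mathbf{TH}\otimes\mathbf X)$ and $\mathbf g=\exp\big(-\tfrac12\mathbf{TH}(1-\mathbf T^{-2})\big)$ satisfy, for all $a\in U$ and with $\mu$ the multiplication map, $$G\,\Delta(n(a))\,G^{-1}=(n\otimes n)(\Delta_0(a)),\qquad (G\otimes1)(\Delta\otimes\mathrm{id})(G)=(1\otimes G)(\mathrm{id}\otimes\Delta)(G),$$ $$\mathbf g\,S(n(a))\,\mathbf g^{-1}=n(S_0(a)),\qquad \mathbf g=\mu\circ(\mathrm{id}\otimes S)(G).$$ **(5) Disentanglement.** In $U$, with $\mu$ the multiplication map, $$\mu\Big[\exp\big(\tfrac12\,h\otimes\ln(1-2\mathbf hb_+)\big)\Big]=\exp(-\mathbf h\,h\,b_+).$$ -/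

import Mathlib

noncomputable section

namespace Jordanian

/-! Formal power series in the deformation parameter, over a possibly noncommutative
coefficient algebra, and topologically presented superalgebras over `ℂ⟦𝐡⟧`. -/

/-- The ring `ℂ⟦𝐡⟧` of formal power series in the deformation parameter. -/
abbrev Scalars : Type := PowerSeries ℂ

/-- The deformation parameter `𝐡`. -/
abbrev hbar : Scalars := PowerSeries.X

/-- A complex number as an element of `ℂ⟦𝐡⟧`. -/
abbrev cst (c : ℂ) : Scalars := PowerSeries.C c

/-- A presentation of a superalgebra over `ℂ⟦𝐡⟧` by even and odd topological generators and by
relations `r = 0`, where `r` runs through formal power series in `𝐡` whose coefficients are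
noncommutative polynomials in the generators. -/
structure SuperPres where
  Gen : Type
  odd : Gen → Bool
  rel : Set (PowerSeries (FreeAlgebra ℂ Gen))

/-- The closure in the `𝐡`-adic topology of the two-sided ideal generated by a set `s`:
the intersection over `n` of the ideals `(s) + (𝐡 ^ n)`. -/
def closedIdeal {A : Type} [Ring A] (s : Set (PowerSeries A)) : TwoSidedIdeal (PowerSeries A) :=
  ⨅ n : ℕ, TwoSidedIdeal.span (s ∪ {(PowerSeries.X : PowerSeries A) ^ n})

/-- The superalgebra over `ℂ⟦𝐡⟧` topologically generated by the given generators with the given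
relations: the free algebra `ℂ⟨Gen⟩⟦𝐡⟧` modulo the closed two-sided ideal generated by the
relations. It is separated and complete in the `𝐡`-adic topology. -/
def SuperPres.Alg (P : SuperPres) : Type := (closedIdeal P.rel).ringCon.Quotient

namespace SuperPres

instance (P : SuperPres) : Ring P.Alg :=
  inferInstanceAs (Ring (closedIdeal P.rel).ringCon.Quotient)

/-- The quotient map. -/
def proj (P : SuperPres) : PowerSeries (FreeAlgebra ℂ P.Gen) →+* P.Alg :=
  (closedIdeal P.rel).ringCon.mk'

theorem proj_surjective (P : SuperPres) : Function.Surjective P.proj :=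
  RingCon.mk'_surjective _

theorem proj_eq_zero_iff (P : SuperPres) (a : PowerSeries (FreeAlgebra ℂ P.Gen)) :
    P.proj a = 0 ↔ a ∈ closedIdeal P.rel := by
  rw [TwoSidedIdeal.mem_iff, ← map_zero P.proj]
  exact RingCon.eq _

theorem map_algebraMap_comm {A : Type} [Ring A] [Algebra ℂ A] (c : PowerSeries ℂ)
    (a : PowerSeries A) :
    PowerSeries.map (algebraMap ℂ A) c * a = a * PowerSeries.map (algebraMap ℂ A) c := by
  ext n
  rw [PowerSeries.coeff_mul, PowerSeries.coeff_mul, ← Finset.Nat.sum_antidiagonal_swap]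
  refine Finset.sum_congr rfl fun p _ => ?_
  simp [Algebra.commutes]

instance (P : SuperPres) : Algebra Scalars P.Alg :=
  RingHom.toAlgebra' (P.proj.comp (PowerSeries.map (algebraMap ℂ (FreeAlgebra ℂ P.Gen)))) (by
    intro c x
    obtain ⟨a, rfl⟩ := P.proj_surjective x
    simp only [RingHom.comp_apply, ← map_mul, map_algebraMap_comm])

/-- A generator, as an element of the algebra. -/
def gen (P : SuperPres) (x : P.Gen) : P.Alg :=
  P.proj (PowerSeries.C (FreeAlgebra.ι ℂ x))

/-- `P.fn x φ` is `φ(x)`, for a generator `x` and a formal power series `φ` in `𝐡` whose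
coefficients are polynomials in one variable. -/
def fn (P : SuperPres) (x : P.Gen) : PowerSeries (Polynomial ℂ) →+* P.Alg :=
  P.proj.comp (PowerSeries.map
    (Polynomial.aeval (R := ℂ) (FreeAlgebra.ι ℂ x)).toRingHom)

/-- The parity automorphism of the free algebra. -/
def freeParity (P : SuperPres) : FreeAlgebra ℂ P.Gen →ₐ[ℂ] FreeAlgebra ℂ P.Gen :=
  FreeAlgebra.lift ℂ fun x => if P.odd x then -FreeAlgebra.ι ℂ x else FreeAlgebra.ι ℂ x

/-- `P.IsHomogeneous p x`: the element `x` is homogeneous, odd if `p = true` and even if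
`p = false`, in the `ℤ/2`-grading determined by the parities of the generators. -/
def IsHomogeneous (P : SuperPres) (p : Bool) (x : P.Alg) : Prop :=
  ∃ a : PowerSeries (FreeAlgebra ℂ P.Gen),
    PowerSeries.map P.freeParity.toRingHom a = (if p then -a else a) ∧ P.proj a = x

/-- The homomorphism of free algebras given by a map of generators. -/
def freeMap {α β : Type} (f : α → β) :
    PowerSeries (FreeAlgebra ℂ α) →+* PowerSeries (FreeAlgebra ℂ β) :=
  PowerSeries.map (FreeAlgebra.lift ℂ (FreeAlgebra.ι ℂ ∘ f)).toRingHom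

theorem freeMap_mem {α β : Type} (f : α → β) {s : Set (PowerSeries (FreeAlgebra ℂ α))}
    {t : Set (PowerSeries (FreeAlgebra ℂ β))} (hf : ∀ r ∈ s, freeMap f r ∈ t)
    {a : PowerSeries (FreeAlgebra ℂ α)} (ha : a ∈ closedIdeal s) :
    freeMap f a ∈ closedIdeal t := by
  unfold closedIdeal at ha ⊢
  rw [TwoSidedIdeal.mem_iInf] at ha ⊢
  intro n
  have key : TwoSidedIdeal.span (s ∪ {(PowerSeries.X : PowerSeries (FreeAlgebra ℂ α)) ^ n}) ≤
      (TwoSidedIdeal.span (t ∪ {(PowerSeries.X : PowerSeries (FreeAlgebra ℂ β)) ^ n})).comap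
        (freeMap f) := by
    rw [TwoSidedIdeal.span_le]
    rintro r (hr | hr)
    · exact (TwoSidedIdeal.mem_comap _).2 (TwoSidedIdeal.subset_span (Or.inl (hf r hr)))
    · refine (TwoSidedIdeal.mem_comap _).2 (TwoSidedIdeal.subset_span (Or.inr ?_))
      rw [Set.mem_singleton_iff] at hr ⊢
      simp [hr, freeMap]
  exact (TwoSidedIdeal.mem_comap _).1 (key (ha n))

/-- The homomorphism of presented algebras induced by a map of generators that carries relations
to relations. -/
def map {P Q : SuperPres} (f : P.Gen → Q.Gen) (hf : ∀ r ∈ P.rel, freeMap f r ∈ Q.rel) :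
    P.Alg →ₐ[Scalars] Q.Alg where
  toRingHom := RingCon.lift (closedIdeal P.rel).ringCon (Q.proj.comp (freeMap f)) (by
    intro a b hab
    have h1 : a - b ∈ closedIdeal P.rel := (TwoSidedIdeal.rel_iff _ a b).1 hab
    have h2 := (Q.proj_eq_zero_iff _).2 (freeMap_mem f hf h1)
    rw [map_sub, map_sub] at h2
    exact sub_eq_zero.1 h2)
  commutes' := by
    intro c
    change Q.proj (freeMap f (PowerSeries.map (algebraMap ℂ (FreeAlgebra ℂ P.Gen)) c)) =
      Q.proj (PowerSeries.map (algebraMap ℂ (FreeAlgebra ℂ Q.Gen)) c)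
    congr 1
    ext n
    simp [freeMap]

/-- The completed `ℤ/2`-graded tensor product over `ℂ⟦𝐡⟧` of copies of the algebra presented by
`P`, one for each element of `ι`. It is topologically generated by copies `(i, x)` of the
generators, subject to the relations of `P` in each copy, and to the rule that generators in
different copies supercommute, so that
`(a ⊗ b) (c ⊗ d) = (-1) ^ (deg b * deg c) (a c ⊗ b d)`. -/
def tensor (P : SuperPres) (ι : Type) : SuperPres where
  Gen := ι × P.Gen
  odd := fun x => P.odd x.2
  rel := {r | ∃ i : ι, ∃ s ∈ P.rel, r = freeMap (fun x => (i, x)) s} ∪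
    {r | ∃ i j : ι, ∃ x y : P.Gen, i ≠ j ∧ r = PowerSeries.C
      (FreeAlgebra.ι ℂ (i, x) * FreeAlgebra.ι ℂ (j, y) -
        (if P.odd x && P.odd y then (-1 : ℂ) else 1) •
          (FreeAlgebra.ι ℂ (j, y) * FreeAlgebra.ι ℂ (i, x)))}

/-- The embedding of the `i`-th tensor factor, `a ↦ 1 ⊗ ⋯ ⊗ a ⊗ ⋯ ⊗ 1`. -/
def slot (P : SuperPres) {ι : Type} (i : ι) : P.Alg →ₐ[Scalars] (P.tensor ι).Alg :=
  map (Q := P.tensor ι) (fun x => (i, x)) fun r hr => Or.inl ⟨i, r, hr, rfl⟩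

theorem freeMap_freeMap {α β γ : Type} (f : α → β) (g : β → γ)
    (r : PowerSeries (FreeAlgebra ℂ α)) : freeMap g (freeMap f r) = freeMap (g ∘ f) r := by
  have h : (FreeAlgebra.lift ℂ (FreeAlgebra.ι ℂ ∘ g)).comp
      (FreeAlgebra.lift ℂ (FreeAlgebra.ι ℂ ∘ f)) =
      FreeAlgebra.lift ℂ (FreeAlgebra.ι ℂ ∘ (g ∘ f)) := by
    ext x
    simp
  ext n
  simpa [freeMap] using DFunLike.congr_fun h (PowerSeries.coeff n r)

theorem freeMap_cross {α β : Type} (g : α → β) (a b : α) (r : ℂ) :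
    freeMap g (PowerSeries.C (FreeAlgebra.ι ℂ a * FreeAlgebra.ι ℂ b -
      r • (FreeAlgebra.ι ℂ b * FreeAlgebra.ι ℂ a))) =
    PowerSeries.C (FreeAlgebra.ι ℂ (g a) * FreeAlgebra.ι ℂ (g b) -
      r • (FreeAlgebra.ι ℂ (g b) * FreeAlgebra.ι ℂ (g a))) := by
  rw [freeMap, PowerSeries.map_C]
  simp only [AlgHom.toRingHom_eq_coe, RingHom.coe_coe, map_sub, map_smul, map_mul,
    FreeAlgebra.lift_ι_apply, Function.comp_apply]

/-- The embedding of tensor powers that puts the `i`-th factor in position `f i`. -/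
def reindex (P : SuperPres) {ι κ : Type} (f : ι ↪ κ) :
    (P.tensor ι).Alg →ₐ[Scalars] (P.tensor κ).Alg :=
  map (P := P.tensor ι) (Q := P.tensor κ) (fun x => (f x.1, x.2)) (by
    rintro r (⟨i, s, hs, rfl⟩ | ⟨i, j, x, y, hij, rfl⟩)
    · exact Or.inl ⟨f i, s, hs, (freeMap_freeMap (fun y => (i, y)) (fun y : ι × P.Gen => (f y.1, y.2)) s)⟩
    · refine Or.inr ⟨f i, f j, x, y, fun h => hij (f.injective h), ?_⟩
      have key := freeMap_cross (fun y : ι × P.Gen => (f y.1, y.2)) (i, x) (j, y)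
        (if P.odd x && P.odd y then (-1 : ℂ) else 1)
      exact key)

/-- `a ⊗ b` in the completed tensor square. -/
def tmul (P : SuperPres) (a b : P.Alg) : (P.tensor (Fin 2)).Alg :=
  P.slot (0 : Fin 2) a * P.slot (1 : Fin 2) b

/-- `F = f ⊗ f`. -/
def IsTensorSquare {P Q : SuperPres} (f : P.Alg →ₐ[Scalars] Q.Alg)
    (F : (P.tensor (Fin 2)).Alg →ₐ[Scalars] (Q.tensor (Fin 2)).Alg) : Prop :=
  ∀ a b : P.Alg, F (P.tmul a b) = Q.tmul (f a) (f b)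

/-- `D = Δ ⊗ id`. -/
def IsTensorId {P : SuperPres} (Δ : P.Alg →ₐ[Scalars] (P.tensor (Fin 2)).Alg)
    (D : (P.tensor (Fin 2)).Alg →ₐ[Scalars] (P.tensor (Fin 3)).Alg) : Prop :=
  ∀ a b : P.Alg, D (P.tmul a b) =
    P.reindex (Fin.castSuccEmb (n := 2)) (Δ a) * P.slot (2 : Fin 3) b

/-- `D = id ⊗ Δ`. -/
def IsIdTensor {P : SuperPres} (Δ : P.Alg →ₐ[Scalars] (P.tensor (Fin 2)).Alg)
    (D : (P.tensor (Fin 2)).Alg →ₐ[Scalars] (P.tensor (Fin 3)).Alg) : Prop :=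
  ∀ a b : P.Alg, D (P.tmul a b) =
    P.slot (0 : Fin 3) a * P.reindex (Fin.succEmb 2) (Δ b)

/-- `ν = μ ∘ (id ⊗ f)`, where `μ` is the multiplication map `a ⊗ b ↦ a b`. -/
def IsMulIdTensor {P : SuperPres} (f : P.Alg →ₗ[Scalars] P.Alg)
    (ν : (P.tensor (Fin 2)).Alg →ₗ[Scalars] P.Alg) : Prop :=
  ∀ a b : P.Alg, ν (P.tmul a b) = a * f b

/-- `S` is a `ℤ/2`-graded antihomomorphism: `S(xy) = (-1) ^ (deg x * deg y) S(y) S(x)`. -/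
def IsSuperAntihom {P : SuperPres} (S : P.Alg →ₗ[Scalars] P.Alg) : Prop :=
  S 1 = 1 ∧ ∀ (p q : Bool) (x y : P.Alg), P.IsHomogeneous p x → P.IsHomogeneous q y →
    S (x * y) = if p && q then -(S y * S x) else S y * S x

end SuperPres

/-- `y = exp a`, as an `𝐡`-adically convergent sum, for an element `a` divisible by `𝐡`. -/
def IsExp {A : Type} [Ring A] [Algebra Scalars A] (a y : A) : Prop :=
  ∀ N : ℕ, ∃ z : A,
    y = ∑ n ∈ Finset.range N, cst (1 / (n.factorial : ℂ)) • a ^ n + hbar ^ N • z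

/-! Functions of one variable `x` and of `𝐡`: formal power series in `𝐡` with coefficients in
`ℂ[x]`. -/

/-- The ring `ℂ[x]⟦𝐡⟧` of mapping functions. -/
abbrev MapFun : Type := PowerSeries (Polynomial ℂ)

namespace MapFun

/-- The variable `x`. -/
def x : MapFun := PowerSeries.C Polynomial.X

/-- The parameter `𝐡`. -/
def hb : MapFun := PowerSeries.X

/-- A complex constant. -/
def c (r : ℂ) : MapFun := PowerSeries.C (Polynomial.C r)

/-- The classical limit `𝐡 → 0`. -/
def limit (φ : MapFun) : Polynomial ℂ := PowerSeries.constantCoeff φ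

/-- The derivative with respect to `x`. -/
def dx (φ : MapFun) : MapFun :=
  PowerSeries.mk fun n => Polynomial.derivative (PowerSeries.coeff n φ)

/-- The generalized binomial coefficient `r (r - 1) ⋯ (r - n + 1) / n!`. -/
def binom (r : ℂ) (n : ℕ) : ℂ := (∏ i ∈ Finset.range n, (r - i)) / (n.factorial : ℂ)

/-- The binomial series `(1 + y) ^ r = ∑ n, binom r n * y ^ n`, for `y` divisible by `𝐡`. -/
def onePlusPow (r : ℂ) (y : MapFun) : MapFun :=
  PowerSeries.mk fun N =>
    ∑ n ∈ Finset.range (N + 1), binom r n • PowerSeries.coeff N (y ^ n)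

/-- The logarithm `ln (1 + y) = ∑ n ≥ 1, (-1) ^ (n + 1) y ^ n / n`, for `y` divisible
by `𝐡`. -/
def logOnePlus (y : MapFun) : MapFun :=
  PowerSeries.mk fun N =>
    ∑ n ∈ Finset.Icc 1 N, ((-1 : ℂ) ^ (n + 1) / (n : ℂ)) • PowerSeries.coeff N (y ^ n)

/-- `exp (r 𝐡 x)`, that is, `T ^ r` as a function of `x = X = 𝐡⁻¹ ln T`. -/
def expPow (r : ℂ) : MapFun :=
  PowerSeries.mk fun n => Polynomial.C (r ^ n / (n.factorial : ℂ)) * Polynomial.X ^ n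

/-- `sinh (𝐡 x) / 𝐡`, that is, `(T - T⁻¹) / (2 𝐡)` as a function of `x = X = 𝐡⁻¹ ln T`. -/
def sinhDiv : MapFun :=
  PowerSeries.mk fun n =>
    if Even n then Polynomial.C (1 / ((n + 1).factorial : ℂ)) * Polynomial.X ^ (n + 1) else 0

/-- The derivative `dψ/dT = (𝐡 T)⁻¹ dψ/dX` with respect to `T = exp (𝐡 X)` of a function `ψ`
of `X = x`, for `ψ` whose classical limit is constant (`dψ/dX` is then divisible by `𝐡`, and the
quotient is obtained by a shift of the coefficients). -/
def dT (ψ : MapFun) : MapFun :=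
  expPow (-1) * PowerSeries.mk fun n => PowerSeries.coeff (n + 1) (dx ψ)

/-- `√(1 + 𝐡² x² φ⁴)`. -/
def root (φ : MapFun) : MapFun := onePlusPow (1 / 2) (hb ^ 2 * x ^ 2 * φ ^ 4)

/-- `(1 - 2 𝐡 x) ^ r`. -/
def mtm (r : ℂ) : MapFun := onePlusPow r (-(c 2 * hb * x))

/-- The function `φ` tends to `1` in the classical limit. -/
def Admissible (φ : MapFun) : Prop := limit φ = 1

end MapFun

/-! The classical superalgebra. -/

/-- Generators `h, e, f, b₊, b₋` of `osp(1|2)`. -/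
inductive OspGen : Type
  | h | e | f | bp | bm

/-- The odd generators are `e` and `f`. -/
def OspGen.odd : OspGen → Bool
  | .e => true
  | .f => true
  | _ => false

/-- The defining relations of `U(osp(1|2))`. -/
def ospRel : Set (FreeAlgebra ℂ OspGen) :=
  let h := FreeAlgebra.ι ℂ OspGen.h
  let e := FreeAlgebra.ι ℂ OspGen.e
  let f := FreeAlgebra.ι ℂ OspGen.f
  let bp := FreeAlgebra.ι ℂ OspGen.bp
  let bm := FreeAlgebra.ι ℂ OspGen.bm
  { ⁅h, e⁆ - e,
    ⁅h, f⁆ + f,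
    e * f + f * e + h,
    ⁅h, bp⁆ - (2 : ℂ) • bp,
    ⁅h, bm⁆ + (2 : ℂ) • bm,
    ⁅bp, bm⁆ - h,
    ⁅bp, f⁆ - e,
    ⁅bm, e⁆ - f,
    bp - e ^ 2,
    bm + f ^ 2 }

/-- Presentation of `U(osp(1|2))⟦𝐡⟧`. Its relations do not involve `𝐡`, so the closed ideal that
they generate consists of the series all of whose coefficients lie in the ideal of relations of
`U(osp(1|2))`. -/
def osp : SuperPres where
  Gen := OspGen
  odd := OspGen.odd
  rel := PowerSeries.C '' ospRel

/-- `U(osp(1|2))⟦𝐡⟧`. -/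
abbrev U : Type := osp.Alg

/-- The classical generators as elements of `U(osp(1|2))⟦𝐡⟧`. -/
def h : U := osp.gen OspGen.h

def e : U := osp.gen OspGen.e

def f : U := osp.gen OspGen.f

def bp : U := osp.gen OspGen.bp

def bm : U := osp.gen OspGen.bm

/-- `φ(b₊)`. -/
def ofBp (φ : MapFun) : U := osp.fn OspGen.bp φ

/-- The cocommutative coproduct of `U(osp(1|2))`. -/
def IsClassicalCoproduct (Δ₀ : U →ₐ[Scalars] (osp.tensor (Fin 2)).Alg) : Prop :=
  ∀ g : OspGen, Δ₀ (osp.gen g) = osp.tmul (osp.gen g) 1 + osp.tmul 1 (osp.gen g)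

/-- The antipode of `U(osp(1|2))`. -/
def IsClassicalAntipode (S₀ : U →ₗ[Scalars] U) : Prop :=
  SuperPres.IsSuperAntihom S₀ ∧ ∀ g : OspGen, S₀ (osp.gen g) = -osp.gen g

/-! The Jordanian superalgebra. -/

/-- Generators `𝐇, 𝐄, 𝐅, 𝐗, 𝐘` of the Jordanian superalgebra. -/
inductive JGen : Type
  | H | E | F | X | Y

/-- The odd generators are `𝐄` and `𝐅`. -/
def JGen.odd : JGen → Bool
  | .E => true
  | .F => true
  | _ => false

/-- The defining relations of the Jordanian superalgebra, where `𝐓^{±1} = exp(± 𝐡 𝐗)` and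
`(𝐓 - 𝐓⁻¹) / (2 𝐡)` is read as the series `sinh(𝐡 𝐗) / 𝐡`. -/
def jordRel : Set (PowerSeries (FreeAlgebra ℂ JGen)) :=
  let hb : PowerSeries (FreeAlgebra ℂ JGen) := PowerSeries.X
  let H : PowerSeries (FreeAlgebra ℂ JGen) := PowerSeries.C (FreeAlgebra.ι ℂ JGen.H)
  let E : PowerSeries (FreeAlgebra ℂ JGen) := PowerSeries.C (FreeAlgebra.ι ℂ JGen.E)
  let F : PowerSeries (FreeAlgebra ℂ JGen) := PowerSeries.C (FreeAlgebra.ι ℂ JGen.F)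
  let Y : PowerSeries (FreeAlgebra ℂ JGen) := PowerSeries.C (FreeAlgebra.ι ℂ JGen.Y)
  let fnX : MapFun →+* PowerSeries (FreeAlgebra ℂ JGen) := PowerSeries.map
    (Polynomial.aeval (R := ℂ) (FreeAlgebra.ι ℂ JGen.X)).toRingHom
  let T := fnX (MapFun.expPow 1)
  let T' := fnX (MapFun.expPow (-1))
  { ⁅H, E⁆ - (1 / 2 : ℂ) • ((T + T') * E),
    ⁅H, F⁆ - (-((1 / 4 : ℂ) • ((T + T') * F)) - (1 / 4 : ℂ) • (F * (T + T'))
      - (1 / 8 : ℂ) • (hb * (((T - T') * H + H * (T - T')) * E))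
      - (1 / 8 : ℂ) • (hb * (E * ((T - T') * H + H * (T - T'))))),
    (E * F + F * E) - (-((1 / 4 : ℂ) • ((T + T') * H)) - (1 / 4 : ℂ) • (H * (T + T'))),
    ⁅H, T⁆ - (T ^ 2 - 1),
    ⁅H, T'⁆ - (T' ^ 2 - 1),
    ⁅H, Y⁆ - (-((1 / 2 : ℂ) • ((T + T') * Y)) - (1 / 2 : ℂ) • (Y * (T + T'))),
    ⁅T, Y⁆ - (1 / 2 : ℂ) • (hb * (T * H + H * T)),
    ⁅T', Y⁆ + (1 / 2 : ℂ) • (hb * (T' * H + H * T')),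
    E ^ 2 - fnX MapFun.sinhDiv,
    ⁅Y, E⁆ - F,
    ⁅T, F⁆ - (1 / 2 : ℂ) • (hb * ((T ^ 2 + 1) * E)),
    ⁅T', F⁆ + (1 / 2 : ℂ) • (hb * ((T' ^ 2 + 1) * E)),
    F ^ 2 - (-Y + (1 / 8 : ℂ) • (hb * ((T - T') * H ^ 2))
      + (1 / 4 : ℂ) • (hb * ((T - T') * E * F))
      + (3 / 16 : ℂ) • (hb * ((T ^ 2 - T' ^ 2) * H))
      + (1 / 4 : ℂ) • (hb * (T - T'))
      + (9 / 128 : ℂ) • (hb * (T - T') ^ 3)),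
    ⁅F, Y⁆ - ((1 / 4 : ℂ) • (hb * ((T - T') * F))
      + (1 / 2 : ℂ) • (hb * ((T - T') * E * Y))
      - (1 / 4 : ℂ) • (hb ^ 2 * (E * H ^ 2))
      - (3 / 8 : ℂ) • (hb ^ 2 * ((T + T') * E * H))
      - (1 / 2 : ℂ) • (hb ^ 2 * E)
      - (15 / 64 : ℂ) • (hb ^ 2 * ((T - T') ^ 2 * E))) }

/-- Presentation of the Jordanian superalgebra. -/
def jord : SuperPres where
  Gen := JGen
  odd := JGen.odd
  rel := jordRel

/-- The Jordanian superalgebra `U_𝐡(osp(1|2))`. -/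
abbrev Uh : Type := jord.Alg

/-- The Jordanian generators. -/
def H : Uh := jord.gen JGen.H

def E : Uh := jord.gen JGen.E

def F : Uh := jord.gen JGen.F

def X : Uh := jord.gen JGen.X

def Y : Uh := jord.gen JGen.Y

/-- `ψ(𝐓)`, where `ψ` is written as a function of `𝐗 = 𝐡⁻¹ ln 𝐓`. -/
def ofT (ψ : MapFun) : Uh := jord.fn JGen.X ψ

/-- `𝐓 ^ r = exp (r 𝐡 𝐗)`. -/
def T (r : ℂ) : Uh := ofT (MapFun.expPow r)

/-- The coproduct of the Jordanian superalgebra, given on generators. -/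
structure IsCoproduct (Δ : Uh →ₐ[Scalars] (jord.tensor (Fin 2)).Alg) : Prop where
  on_H : Δ H = jord.tmul H (T 1) + jord.tmul (T (-1)) H
  on_E : Δ E = jord.tmul E (T (-1 / 2)) + jord.tmul (T (1 / 2)) E
  on_F : Δ F = jord.tmul F (T (1 / 2)) + jord.tmul (T (-1 / 2)) F
    + (hbar * cst (1 / 4)) • jord.tmul (T (-1) * E)
        (T (-1 / 2) * H + H * T (-1 / 2))
    - (hbar * cst (1 / 4)) • jord.tmul
        (T (1 / 2) * H + H * T (1 / 2)) (T 1 * E)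
  on_T : Δ (T 1) = jord.tmul (T 1) (T 1)
  on_T_inv : Δ (T (-1)) = jord.tmul (T (-1)) (T (-1))
  on_X : Δ X = jord.tmul X 1 + jord.tmul 1 X
  on_Y : Δ Y = jord.tmul Y (T 1) + jord.tmul (T (-1)) Y

/-- The antipode of the Jordanian superalgebra, given on generators. -/
structure IsAntipode (S : Uh →ₗ[Scalars] Uh) : Prop where
  anti : SuperPres.IsSuperAntihom S
  on_H : S H = -H + (cst 2 * hbar) • E ^ 2
  on_E : S E = -E
  on_F : S F = -F - (hbar * cst (1 / 2)) • ((T 1 + T (-1)) * E)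
  on_T : S (T 1) = T (-1)
  on_T_inv : S (T (-1)) = T 1
  on_Y : S Y = -Y - hbar • H + hbar ^ 2 • E ^ 2

/-! The class of maps. -/

/-- The homomorphism `m` realizes the Jordanian generators by the ansatz
`𝐄 = φ₁(b₊) e`, `𝐇 = φ₂(b₊) h`, `𝐅 = φ₃(b₊) f + u₁(b₊) e + u₂(b₊) e h`. -/
structure IsDirect (φ₁ φ₂ φ₃ u₁ u₂ : MapFun) (m : Uh →ₐ[Scalars] U) : Prop where
  on_E : m E = ofBp φ₁ * e
  on_H : m H = ofBp φ₂ * h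
  on_F : m F = ofBp φ₃ * f + ofBp u₁ * e + ofBp u₂ * e * h

/-- The homomorphism `n` realizes the classical generators by the ansatz
`e = ψ₁(𝐓) 𝐄`, `h = ψ₂(𝐓) 𝐇`, `f = ψ₃(𝐓) 𝐅 + w₁(𝐓) 𝐄 + w₂(𝐓) 𝐄 𝐇`. -/
structure IsInverse (ψ₁ ψ₂ ψ₃ w₁ w₂ : MapFun) (n : U →ₐ[Scalars] Uh) : Prop where
  on_e : n e = ofT ψ₁ * E
  on_h : n h = ofT ψ₂ * H
  on_f : n f = ofT ψ₃ * F + ofT w₁ * E + ofT w₂ * E * H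

open MapFun in
/-- The functions of the direct map in terms of `φ₁`:
`φ₂ = √(1 + 𝐡²x²φ₁⁴) φ₁ / (φ₁ + 2xφ₁')`, `φ₃ = 1 / φ₁`, `u₁ = -(𝐡²/4) x φ₁³`,
`u₂ = (1 - √(1 + 𝐡²x²φ₁⁴) φ₂) / (2xφ₁)`, with denominators cleared; the ring `ℂ[x]⟦𝐡⟧` is a
domain and, for `φ₁` tending to `1`, no denominator is zero. -/
structure DirectSolution (φ₁ φ₂ φ₃ u₁ u₂ : MapFun) : Prop where
  eq_φ₂ : φ₂ * (φ₁ + c 2 * x * dx φ₁) = root φ₁ * φ₁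
  eq_φ₃ : φ₃ * φ₁ = 1
  eq_u₁ : u₁ = -(c (1 / 4) * hb ^ 2 * x * φ₁ ^ 3)
  eq_u₂ : u₂ * (c 2 * x * φ₁) = 1 - root φ₁ * φ₂

open MapFun in
/-- The functions of the inverse map in terms of `ψ₁`:
`ψ₂ = 2ψ₁ / ((T + T⁻¹)ψ₁ + 2(T² - 1) dψ₁/dT)`, `ψ₃ = 1 / ψ₁`, `w₁ = 𝐡(T - T⁻¹) / (8ψ₁)`,
`w₂ = 𝐡(T + T⁻¹ - 2ψ₂) / (2(T - T⁻¹)ψ₁)`, with denominators cleared. -/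
structure InverseSolution (ψ₁ ψ₂ ψ₃ w₁ w₂ : MapFun) : Prop where
  eq_ψ₂ : ψ₂ * ((expPow 1 + expPow (-1)) * ψ₁ + c 2 * (expPow 1 ^ 2 - 1) * dT ψ₁) = c 2 * ψ₁
  eq_ψ₃ : ψ₃ * ψ₁ = 1
  eq_w₁ : w₁ * (c 8 * ψ₁) = hb * (expPow 1 - expPow (-1))
  eq_w₂ : w₂ * (c 2 * (expPow 1 - expPow (-1)) * ψ₁) =
    hb * (expPow 1 + expPow (-1) - c 2 * ψ₂)

/-- The homomorphisms `m` and `n` are inverse to each other. -/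
def AreInverse (m : Uh →ₐ[Scalars] U) (n : U →ₐ[Scalars] Uh) : Prop :=
  (∀ a : U, m (n a) = a) ∧ ∀ a : Uh, n (m a) = a

end Jordanian

end

/-! The two families of maps are classified together, by reducing both to endomorphisms of U. The
minimal twist map `twist` and its inverse `untwist` are constructed explicitly. Every direct map is
then m = (m ∘ untwist) ∘ twist, and every inverse map is n = untwist ∘ (twist ∘ n). Here m ∘ untwist
and twist ∘ n are endomorphisms of U of the shape e ↦ αe, h ↦ βh, f ↦ γf + pe + qeh with
coefficients that are functions of b₊ (`IsK`). Such an endomorphism exists exactly when β(α + 2xα')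
= α, αγ = 1, p = 0 and 2xαq = 1 − β (`KSol.exists_isK`, `IsK.kSol`). Necessity rests on the
independence of 1, e, f, h, eh over functions of b₊ (`linearIndependent_U`), seen in two modules of
lowest weight type. The function α determines everything else. The endomorphism substitutes xα² for
x, and this substitution is invertible in ℂ[x]⟦ħ⟧, so each of these endomorphisms has an inverse of
the same shape (`IsK.exists_inverse`). Parts (1), (2) and (3) are this statement written in the
variable X instead of b₊ (`directSolution_iff`, `inverseSolution_iff`). The square root in (1) is
cosh(ħX), given that sinh(ħX)/ħ = b₊φ₁².

Homomorphisms out of the two algebras are obtained from short lists of relations. On the classical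
side three brackets of h, e, f suffice (`OspTriple`). On the Jordanian side X is arsinh(ħE²)/ħ and Y
is expressed through F², so the normal ordering rules `JRules` for H, E, F suffice. The calculus of
functions of one element rests on a single intertwining rule, `evalAt_intertwine`, and special
functions are identified by their differential equations (`eq_of_dx_eq`).

The Hopf structure is transported. On U the coproduct is conjugated by the inverse of exp(ħ h ⊗
L(b₊)), where L(x) = −ln(1 − 2ħx)/(2ħ), and the antipode is conjugated by the inverse of exp(−ħ h
b₊). Both are then carried to the Jordanian side by `twist` and `untwist`. The two intertwining
relations hold by construction, and the labour lies in the formulas on generators. The cocycle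
identity follows because G conjugates Δ(TH) to a primitive element and X is primitive.

Disentanglement is the identity ∑ (−ħ)^n h^n L(b₊)^n / n! = exp(−ħ h b₊) (`ordExp_eq`). The left
side is the binomial series of (1 − 2ħx)^{y/2} with h written to the left, and h(h − 2)⋯(h − 2n + 2)
b₊^n = (h b₊)^n. Since S(X) = −X, the same identity computes μ(id ⊗ S)(G). -/

noncomputable section

set_option linter.unusedSectionVars false
set_option linter.unusedSimpArgs false

namespace Jordanian

open Finset

/-! ### Separated and complete modules -/

/-- A module over `ℂ⟦𝐡⟧` that is separated and complete in the `𝐡`-adic topology. -/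
class HComplete (A : Type) [AddCommGroup A] [Module Scalars A] : Prop where
  separated : ∀ a : A, (∀ n : ℕ, ∃ z, a = hbar ^ n • z) → a = 0
  complete : ∀ u : ℕ → A, ∃ s, ∀ N, ∃ z, s = ∑ n ∈ range N, hbar ^ n • u n + hbar ^ N • z

section HasHSum

variable {A B : Type} [AddCommGroup A] [Module Scalars A] [AddCommGroup B] [Module Scalars B]

/-- The series `∑ 𝐡 ^ n • u n` converges to `s`. -/
def HasHSum (u : ℕ → A) (s : A) : Prop :=
  ∀ N, ∃ z, s = ∑ n ∈ range N, hbar ^ n • u n + hbar ^ N • z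

theorem eq_of_forall_hbar [HComplete A] {a b : A} (h : ∀ n : ℕ, ∃ z, a = b + hbar ^ n • z) :
    a = b := by
  refine sub_eq_zero.1 (HComplete.separated _ fun n => ?_)
  obtain ⟨z, hz⟩ := h n
  exact ⟨z, by rw [hz]; abel⟩

theorem HasHSum.unique [HComplete A] {u : ℕ → A} {s t : A} (hs : HasHSum u s)
    (ht : HasHSum u t) : s = t := by
  refine eq_of_forall_hbar fun n => ?_
  obtain ⟨z, hz⟩ := hs n
  obtain ⟨w, hw⟩ := ht n
  exact ⟨z - w, by rw [hz, hw, smul_sub]; abel⟩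

theorem HasHSum.add {u v : ℕ → A} {s t : A} (hs : HasHSum u s) (ht : HasHSum v t) :
    HasHSum (fun n => u n + v n) (s + t) := by
  intro N
  obtain ⟨z, hz⟩ := hs N
  obtain ⟨w, hw⟩ := ht N
  exact ⟨z + w, by simp only [hz, hw, smul_add, sum_add_distrib]; abel⟩

theorem HasHSum.map {u : ℕ → A} {s : A} (hs : HasHSum u s) (g : A →ₗ[Scalars] B) :
    HasHSum (fun n => g (u n)) (g s) := by
  intro N
  obtain ⟨z, hz⟩ := hs N
  exact ⟨g z, by rw [hz]; simp⟩

theorem HasHSum.cons {u : ℕ → A} {s : A} (hs : HasHSum (fun n => u (n + 1)) s) :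
    HasHSum u (u 0 + hbar • s) := by
  intro N
  cases N with
  | zero => exact ⟨u 0 + hbar • s, by simp⟩
  | succ N =>
    obtain ⟨z, hz⟩ := hs N
    refine ⟨z, ?_⟩
    rw [sum_range_succ', hz, smul_add, smul_sum]
    simp only [smul_smul, ← pow_succ', pow_zero, one_smul]
    abel

/-- Unrolling the recursion N times leaves ħ^N times `S` of the shifted sequence as remainder.
Completeness of a concrete module thus follows from any operation `S` that satisfies the recursion.
-/
theorem hasHSum_of_cons (S : (ℕ → A) → A)
    (hS : ∀ u, S u = u 0 + hbar • S fun n => u (n + 1)) (u : ℕ → A) : HasHSum u (S u) := by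
  refine fun N => ⟨S fun n => u (N + n), ?_⟩
  induction N with
  | zero => simp
  | succ N ih =>
    rw [ih, sum_range_succ, hS (fun n => u (N + n)), smul_add, smul_smul, pow_succ]
    simp only [add_zero, add_assoc, add_comm 1]

theorem hasHSum_zero : HasHSum (fun _ => (0 : A)) 0 := fun N => ⟨0, by simp⟩

/-- The sum of `∑ 𝐡 ^ n • u n`. -/
def hsum [HComplete A] (u : ℕ → A) : A := (HComplete.complete u).choose

theorem hasHSum_hsum [HComplete A] (u : ℕ → A) : HasHSum u (hsum u) :=
  (HComplete.complete u).choose_spec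

theorem HasHSum.hsum_eq [HComplete A] {u : ℕ → A} {s : A} (hs : HasHSum u s) : hsum u = s :=
  (hasHSum_hsum u).unique hs

theorem hsum_add [HComplete A] (u v : ℕ → A) :
    hsum (fun n => u n + v n) = hsum u + hsum v :=
  ((hasHSum_hsum u).add (hasHSum_hsum v)).hsum_eq

theorem map_hsum [HComplete A] [HComplete B] (g : A →ₗ[Scalars] B) (u : ℕ → A) :
    g (hsum u) = hsum fun n => g (u n) :=
  ((hasHSum_hsum u).map g).hsum_eq.symm

theorem hsum_cons [HComplete A] (u : ℕ → A) :
    hsum u = u 0 + hbar • hsum fun n => u (n + 1) :=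
  (hasHSum_hsum _).cons.hsum_eq

theorem hsum_zero [HComplete A] : hsum (fun _ => (0 : A)) = 0 := hasHSum_zero.hsum_eq

instance [HComplete A] [HComplete B] : HComplete (A × B) where
  separated a h := by
    refine Prod.ext (HComplete.separated _ fun n => ?_) (HComplete.separated _ fun n => ?_) <;>
    obtain ⟨z, hz⟩ := h n
    exacts [⟨z.1, by rw [hz]; rfl⟩, ⟨z.2, by rw [hz]; rfl⟩]
  complete u := by
    refine ⟨(hsum fun n => (u n).1, hsum fun n => (u n).2), fun N => ?_⟩
    obtain ⟨z, hz⟩ := hasHSum_hsum (fun n => (u n).1) N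
    obtain ⟨w, hw⟩ := hasHSum_hsum (fun n => (u n).2) N
    exact ⟨(z, w), by ext <;> simp [hz, hw, Prod.fst_sum, Prod.snd_sum]⟩

instance [HComplete A] : HComplete Aᵐᵒᵖ where
  separated a h := MulOpposite.unop_injective (HComplete.separated _ fun n => by
    obtain ⟨z, rfl⟩ := h n
    exact ⟨z.unop, rfl⟩)
  complete u := by
    refine ⟨.op (hsum fun n => (u n).unop), fun N => ?_⟩
    obtain ⟨z, hz⟩ := hasHSum_hsum (fun n => (u n).unop) N
    exact ⟨.op z, by rw [hz]; simp⟩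

/-- Sums are taken pointwise. This makes power series in operators of left and right multiplication
available, which is how ordered exponentials are handled. -/
instance [HComplete B] : HComplete (A →ₗ[Scalars] B) where
  separated a h := LinearMap.ext fun x => HComplete.separated _ fun n => by
    obtain ⟨z, hz⟩ := h n
    exact ⟨z x, by rw [hz]; rfl⟩
  complete u := by
    have lin (v : ℕ → A →ₗ[Scalars] B) : ∃ g : A →ₗ[Scalars] B, ∀ x, g x = hsum fun n => v n x :=
      ⟨{ toFun := fun x => hsum fun n => v n x
         map_add' := fun x y => by simp only [map_add, hsum_add]
         map_smul' := fun c x => by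
          simp only [map_smul, RingHom.id_apply]
          exact (((hasHSum_hsum fun n => v n x).map
            (LinearMap.lsmul Scalars B c))).hsum_eq }, fun _ => rfl⟩
    choose S hS using lin
    exact ⟨S u, hasHSum_of_cons S (fun v => LinearMap.ext fun x => by
      rw [LinearMap.add_apply, LinearMap.smul_apply, hS, hS, hsum_cons]) u⟩

end HasHSum

instance {R : Type} [CommRing R] [Algebra ℂ R] : HComplete (PowerSeries R) where
  separated a h := by
    ext n
    obtain ⟨z, rfl⟩ := h (n + 1)
    rw [Algebra.smul_def, map_pow]
    have : algebraMap Scalars (PowerSeries R) hbar = PowerSeries.X := PowerSeries.map_X _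
    rw [this, PowerSeries.coeff_X_pow_mul', if_neg (by omega), map_zero]
  complete u := by
    have hX : algebraMap Scalars (PowerSeries R) hbar = PowerSeries.X := PowerSeries.map_X _
    refine ⟨_, hasHSum_of_cons (fun u => PowerSeries.mk fun N =>
      ∑ n ∈ range (N + 1), PowerSeries.coeff (N - n) (u n)) (fun u => ?_) u⟩
    ext N
    rw [Algebra.smul_def, hX, map_add, PowerSeries.coeff_mk, sum_range_succ']
    cases N with
    | zero => simp
    | succ N => simp [add_comm]

instance {R : Type} [CommRing R] [Algebra ℂ R] : IsScalarTower ℂ Scalars (PowerSeries R) :=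
  IsScalarTower.of_algebraMap_eq fun r =>
    (PowerSeries.algebraMap_apply ..).trans (PowerSeries.map_C _ r).symm

/-! ### Evaluation of power series -/

section Ev

variable {A : Type} [Ring A] [Algebra Scalars A] [HComplete A]

theorem hsum_mul_left (a : A) (u : ℕ → A) : hsum (fun n => a * u n) = a * hsum u :=
  (map_hsum (LinearMap.mulLeft Scalars a) u).symm

theorem hsum_mul_right (a : A) (u : ℕ → A) : hsum (fun n => u n * a) = hsum u * a :=
  (map_hsum (LinearMap.mulRight Scalars a) u).symm

variable (A) in
/-- The evaluation of formal power series with coefficients in `A` at `𝐡`. -/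
def ev : PowerSeries A →+* A where
  toFun φ := hsum fun n => PowerSeries.coeff n φ
  map_zero' := hsum_zero
  map_one' := by
    rw [hsum_cons]
    simp [PowerSeries.coeff_one, hsum_zero]
  map_add' φ ψ := by simp only [map_add, hsum_add]
  map_mul' φ ψ := by
    refine eq_of_forall_hbar fun N => ?_
    -- Writing φ = φ₀ + ħφ' with the shifted series φ' reduces the claim for φ modulo ħ^(N+1) to the
    -- claim for φ' modulo ħ^N.
    induction N generalizing φ with
    | zero => exact ⟨_, by rw [pow_zero, one_smul, add_sub_cancel]⟩
    | succ N ih =>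
      obtain ⟨z, hz⟩ := ih (PowerSeries.mk fun n => PowerSeries.coeff (n + 1) φ)
      refine ⟨z, ?_⟩
      have h1 : hsum (fun n => PowerSeries.coeff n φ) = PowerSeries.coeff 0 φ +
        hbar • hsum fun n => PowerSeries.coeff (n + 1) φ := hsum_cons _
      have h2 : hsum (fun n => PowerSeries.coeff n (φ * ψ)) =
          PowerSeries.coeff 0 φ * hsum (fun n => PowerSeries.coeff n ψ) +
          hbar • hsum fun n => PowerSeries.coeff n
            ((PowerSeries.mk fun n => PowerSeries.coeff (n + 1) φ) * ψ) := by
        rw [← hsum_mul_left, hsum_cons, hsum_cons fun n => _ * PowerSeries.coeff n ψ,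
          add_assoc, ← smul_add, ← hsum_add]
        congr 3
        · simp [PowerSeries.coeff_mul]
        · funext n
          rw [PowerSeries.coeff_mul, Finset.Nat.antidiagonal_succ, sum_cons, sum_map,
            PowerSeries.coeff_mul]
          simp
      simp only [PowerSeries.coeff_mk] at hz
      rw [h2, hz, h1, add_mul, smul_add, smul_mul_assoc, smul_smul, ← pow_succ', add_assoc]

theorem ev_apply (φ : PowerSeries A) : ev A φ = hsum fun n => PowerSeries.coeff n φ := rfl

theorem ev_C (a : A) : ev A (PowerSeries.C a) = a := by
  rw [ev_apply, hsum_cons]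
  simp [PowerSeries.coeff_C, hsum_zero]

theorem ev_X : ev A PowerSeries.X = algebraMap Scalars A hbar := by
  rw [ev_apply, hsum_cons, hsum_cons]
  simp [PowerSeries.coeff_X, hsum_zero, Algebra.smul_def]

theorem ev_algebraMap [Algebra ℂ A] [IsScalarTower ℂ Scalars A] (c : Scalars) :
    ev A (PowerSeries.map (algebraMap ℂ A) c) = algebraMap Scalars A c := by
  refine HasHSum.hsum_eq fun N => ?_
  refine ⟨algebraMap _ _ (PowerSeries.mk fun n => PowerSeries.coeff (n + N) c), ?_⟩
  simp only [PowerSeries.coeff_map, Algebra.smul_def]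
  rw [← map_mul]
  simp only [IsScalarTower.algebraMap_apply ℂ Scalars A, ← map_mul, ← map_sum, ← map_add]
  congr 1
  ext n
  simp only [map_add, map_sum, PowerSeries.coeff_X_pow_mul', PowerSeries.coeff_mk]
  rcases lt_or_ge n N with h | h
  · rw [if_neg (by omega), add_zero, sum_eq_single n]
    · simp
    · intro b _ hb
      split_ifs with h'
      · simp only [PowerSeries.algebraMap_apply, Algebra.algebraMap_self, RingHom.id_apply,
          PowerSeries.coeff_C]
        rw [if_neg (by omega)]
      · rfl
    · simp [h]
  · rw [if_pos h, Nat.sub_add_cancel h, sum_eq_zero, zero_add]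
    intro b hb
    rw [mem_range] at hb
    split_ifs with h'
    · simp only [PowerSeries.algebraMap_apply, Algebra.algebraMap_self, RingHom.id_apply,
          PowerSeries.coeff_C]
      rw [if_neg (by omega)]
    · rfl

variable [Algebra ℂ A] [IsScalarTower ℂ Scalars A] {R : Type} [Ring R] [Algebra ℂ R]

/-- The extension of an algebra homomorphism to formal power series in `𝐡`. -/
def ext (σ : R →ₐ[ℂ] A) : PowerSeries R →+* A := (ev A).comp (PowerSeries.map σ.toRingHom)

theorem ext_apply (σ : R →ₐ[ℂ] A) (φ : PowerSeries R) :
    ext σ φ = hsum fun n => σ (PowerSeries.coeff n φ) := rfl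

@[simp] theorem ext_C (σ : R →ₐ[ℂ] A) (r : R) : ext σ (PowerSeries.C r) = σ r := by
  simp [ext, ev_C]

@[simp] theorem ext_X (σ : R →ₐ[ℂ] A) : ext σ PowerSeries.X = algebraMap Scalars A hbar := by
  simp [ext, ev_X]

theorem ext_smul (σ : R →ₐ[ℂ] A) (c : ℂ) (φ : PowerSeries R) : ext σ (c • φ) = c • ext σ φ := by
  have : c • φ = PowerSeries.C (algebraMap ℂ R c) * φ := by
    ext n
    rw [PowerSeries.coeff_C_mul, ← Algebra.smul_def]
    rfl
  rw [this, map_mul, ext_C, AlgHom.commutes, Algebra.smul_def]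

theorem ext_map_algebraMap (σ : R →ₐ[ℂ] A) (c : Scalars) :
    ext σ (PowerSeries.map (algebraMap ℂ R) c) = algebraMap Scalars A c := by
  rw [← ev_algebraMap, ext, RingHom.comp_apply]
  congr 1
  ext n
  simp

theorem map_ext {B : Type} [Ring B] [Algebra Scalars B] [HComplete B] [Algebra ℂ B]
    [IsScalarTower ℂ Scalars B] (g : A →ₐ[Scalars] B) (σ : R →ₐ[ℂ] A) (φ : PowerSeries R) :
    g (ext σ φ) = ext ((g.restrictScalars ℂ).comp σ) φ :=
  map_hsum g.toLinearMap _

theorem ext_map {R' : Type} [Ring R'] [Algebra ℂ R'] (σ : R →ₐ[ℂ] A) (τ : R' →ₐ[ℂ] R)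
    (φ : PowerSeries R') : ext σ (PowerSeries.map τ.toRingHom φ) = ext (σ.comp τ) φ := by
  simp [ext_apply]

/-- No continuity is assumed: φ = r + ħφ' gives agreement modulo ħ^N by induction, and the target is
separated. -/
theorem eq_ext (f : PowerSeries R →+* A) (σ : R →ₐ[ℂ] A)
    (hX : f PowerSeries.X = algebraMap Scalars A hbar)
    (hC : ∀ r, f (PowerSeries.C r) = σ r) (φ : PowerSeries R) : f φ = ext σ φ := by
  refine eq_of_forall_hbar fun N => ?_
  induction N generalizing φ with
  | zero => exact ⟨_, by rw [pow_zero, one_smul, add_sub_cancel]⟩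
  | succ N ih =>
    obtain ⟨z, hz⟩ := ih (PowerSeries.mk fun n => PowerSeries.coeff (n + 1) φ)
    refine ⟨z, ?_⟩
    have hφ : φ = PowerSeries.X * (PowerSeries.mk fun n => PowerSeries.coeff (n + 1) φ) +
        PowerSeries.C (PowerSeries.coeff 0 φ) := by
      ext n
      cases n <;> simp
    rw [hφ]
    simp only [map_add, map_mul, hX, hC, ext_X, ext_C, hz, mul_add, ← Algebra.smul_def, smul_smul,
      ← pow_succ']
    abel

/-- Functions of `x` and `𝐡` evaluated at `x = a`. -/
def evalAt (a : A) : MapFun →ₐ[Scalars] A where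
  toRingHom := ext (Polynomial.aeval a)
  commutes' := ext_map_algebraMap (Polynomial.aeval a)

theorem evalAt_apply (a : A) (φ : MapFun) : evalAt a φ = ext (Polynomial.aeval a) φ := rfl

@[simp] theorem evalAt_x (a : A) : evalAt a MapFun.x = a := by simp [evalAt_apply, MapFun.x]

@[simp] theorem evalAt_hb (a : A) : evalAt a MapFun.hb = algebraMap Scalars A hbar := by
  simp [evalAt_apply, MapFun.hb]

@[simp] theorem evalAt_c (a : A) (r : ℂ) : evalAt a (MapFun.c r) = algebraMap ℂ A r := by
  simp [evalAt_apply, MapFun.c]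

theorem map_evalAt {B : Type} [Ring B] [Algebra Scalars B] [HComplete B] [Algebra ℂ B]
    [IsScalarTower ℂ Scalars B] (g : A →ₐ[Scalars] B) (a : A) (φ : MapFun) :
    g (evalAt a φ) = evalAt (g a) φ := by
  rw [evalAt_apply, map_ext, evalAt_apply]
  congr 1
  congr 1
  ext
  simp

theorem evalAt_self (φ : MapFun) : evalAt MapFun.x φ = φ := by
  let g : Polynomial ℂ →ₐ[ℂ] MapFun :=
    { (PowerSeries.C : Polynomial ℂ →+* MapFun) with commutes' := fun r => (PowerSeries.algebraMap_apply ..).symm }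
  have : g = Polynomial.aeval MapFun.x := by
    ext
    simp [g, MapFun.x]
  exact (eq_ext (RingHom.id MapFun) _ (PowerSeries.map_X _).symm
    (fun r => DFunLike.congr_fun this r) φ).symm

theorem evalAt_evalAt (a : A) (φ ψ : MapFun) : evalAt a (evalAt ψ φ) = evalAt (evalAt a ψ) φ :=
  map_evalAt _ _ _

/-- On the pair (z, w), multiplication by `a` is multiplication by `c` plus the nilpotent step z ↦
w, so p(a) is given by a first-order Taylor formula. The rules for moving functions of b₊ or X past
the other generators are special cases. -/
theorem aeval_intertwine {a c z w : A} (hz : a * z = z * c + w) (hw : a * w = w * c)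
    (p : Polynomial ℂ) : Polynomial.aeval a p * z =
      z * Polynomial.aeval c p + w * Polynomial.aeval c (Polynomial.derivative p) := by
  have hw' (n : ℕ) : a ^ n * w = w * c ^ n := by
    induction n with
    | zero => simp
    | succ n ih => rw [pow_succ, mul_assoc, hw, ← mul_assoc, ih, mul_assoc, pow_succ]
  have hz' (n : ℕ) : a ^ n * z = z * c ^ n + n • (w * c ^ (n - 1)) := by
    induction n with
    | zero => simp
    | succ n ih =>
      rw [pow_succ', mul_assoc, ih, mul_add, ← mul_assoc, hz, mul_smul_comm, ← mul_assoc, hw]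
      cases n with
      | zero => simp
      | succ n =>
        simp only [Nat.add_sub_cancel, pow_succ', add_mul, mul_assoc, add_smul, one_smul]
        abel
  induction p using Polynomial.induction_on' with
  | add p q hp hq => simp only [map_add, add_mul, mul_add, hp, hq]; abel
  | monomial n r =>
    simp only [Polynomial.aeval_monomial, Polynomial.derivative_monomial, mul_assoc, hz', mul_add]
    simp only [map_mul, map_natCast, ← Algebra.smul_def, mul_smul_comm, smul_mul_assoc,
      ← nsmul_eq_mul, smul_comm n r]

theorem evalAt_intertwine {a c z w : A} (hz : a * z = z * c + w) (hw : a * w = w * c)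
    (φ : MapFun) : evalAt a φ * z = z * evalAt c φ + w * evalAt c (MapFun.dx φ) := by
  simp only [evalAt_apply, ext_apply, ← hsum_mul_left, ← hsum_mul_right, ← hsum_add]
  congr 1
  funext n
  rw [MapFun.dx, PowerSeries.coeff_mk]
  exact aeval_intertwine hz hw _

theorem evalAt_mul_eq {a c z : A} (hz : a * z = z * c) (φ : MapFun) :
    evalAt a φ * z = z * evalAt c φ := by
  have := evalAt_intertwine (a := a) (c := c) (w := 0) (by simpa using hz) (by simp) φ
  simpa using this

theorem evalAt_commute {a z : A} (h : Commute a z) (φ : MapFun) : Commute (evalAt a φ) z :=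
  evalAt_mul_eq h φ

theorem evalAt_commute_evalAt {a b : A} (h : Commute a b) (φ ψ : MapFun) :
    Commute (evalAt a φ) (evalAt b ψ) :=
  evalAt_commute (evalAt_commute h.symm ψ).symm φ

/-- The case c = a, w = [a, z] of the intertwining rule: as [a, z] commutes with a, the commutator
with z acts on functions of a as a derivation. -/
theorem evalAt_lie {a z : A} (h : Commute a ⁅a, z⁆) (φ : MapFun) :
    ⁅evalAt a φ, z⁆ = evalAt a (MapFun.dx φ) * ⁅a, z⁆ := by
  have := evalAt_intertwine (a := a) (c := a) (z := z) (w := ⁅a, z⁆)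
    (by rw [Ring.lie_def]; abel) h.eq φ
  rw [Ring.lie_def (evalAt a φ), this, (evalAt_commute h _).eq]
  abel

end Ev

/-! ### Presented superalgebras -/

namespace SuperPres

instance (P : SuperPres) : Algebra ℂ P.Alg :=
  Algebra.compHom P.Alg (PowerSeries.C : ℂ →+* Scalars)

instance (P : SuperPres) : IsScalarTower ℂ Scalars P.Alg :=
  IsScalarTower.of_algebraMap_eq fun _ => rfl

theorem proj_X (P : SuperPres) : P.proj PowerSeries.X = algebraMap Scalars P.Alg hbar :=
  congrArg P.proj (PowerSeries.map_X _).symm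

/-- Separated because the ideal of relations is closed by definition. A series is summed by lifting
its terms to ℂ⟨Gen⟩⟦ħ⟧ and adding coefficientwise there. -/
instance (P : SuperPres) : HComplete P.Alg where
  separated a ha := by
    obtain ⟨α, rfl⟩ := P.proj_surjective a
    rw [proj_eq_zero_iff, closedIdeal, TwoSidedIdeal.mem_iInf]
    intro n
    obtain ⟨z, hz⟩ := ha n
    obtain ⟨ζ, rfl⟩ := P.proj_surjective z
    rw [Algebra.smul_def, map_pow, ← proj_X, ← map_pow, ← map_mul, ← sub_eq_zero, ← map_sub,
      proj_eq_zero_iff, closedIdeal, TwoSidedIdeal.mem_iInf] at hz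
    have h2 := TwoSidedIdeal.mul_mem_right
      (TwoSidedIdeal.span (P.rel ∪ {(PowerSeries.X : PowerSeries (FreeAlgebra ℂ P.Gen)) ^ n})) _ ζ
      (TwoSidedIdeal.subset_span (Or.inr rfl))
    simpa using TwoSidedIdeal.add_mem _ (hz n) h2
  complete u := by
    refine ⟨_, hasHSum_of_cons (fun u => P.proj (PowerSeries.mk fun N => ∑ n ∈ range (N + 1),
      PowerSeries.coeff (N - n) (Function.surjInv P.proj_surjective (u n)))) (fun u => ?_) u⟩
    rw [Algebra.smul_def, ← proj_X, ← map_mul]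
    refine Eq.trans ?_ (congrArg (· + _) (Function.surjInv_eq P.proj_surjective (u 0)))
    rw [← map_add]
    congr 1
    ext N
    rw [map_add, PowerSeries.coeff_mk, sum_range_succ']
    cases N with
    | zero => simp
    | succ N => simp [add_comm]

/-- The map from the free algebra to the presented algebra. -/
def freeProj (P : SuperPres) : FreeAlgebra ℂ P.Gen →ₐ[ℂ] P.Alg := FreeAlgebra.lift ℂ P.gen

theorem proj_C (P : SuperPres) (a : FreeAlgebra ℂ P.Gen) :
    P.proj (PowerSeries.C a) = P.freeProj a := by
  let g : FreeAlgebra ℂ P.Gen →ₐ[ℂ] P.Alg :=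
    { P.proj.comp PowerSeries.C with
      commutes' := fun r => congrArg P.proj (PowerSeries.map_C _ r).symm }
  have : g = P.freeProj := by
    ext x
    simp [freeProj, g, gen]
  exact DFunLike.congr_fun this a

theorem proj_eq_ext (P : SuperPres) (φ : PowerSeries (FreeAlgebra ℂ P.Gen)) :
    P.proj φ = ext P.freeProj φ :=
  eq_ext _ _ P.proj_X P.proj_C φ

theorem fn_eq_evalAt (P : SuperPres) (x : P.Gen) (φ : MapFun) :
    P.fn x φ = evalAt (P.gen x) φ := by
  rw [fn, RingHom.comp_apply, proj_eq_ext, ext_map, evalAt_apply]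
  congr 2
  ext
  simp [freeProj]

/-! ### Universal property of a presentation -/

section lift

variable {P : SuperPres} {A : Type} [Ring A] [Algebra Scalars A] [HComplete A] [Algebra ℂ A]
  [IsScalarTower ℂ Scalars A]

/-- Since the relations go to zero and X^n goes to ħ^n, the ideal (s) + (X^n) is mapped into the
two-sided ideal ħ^n A. The intersection of these ideals is zero because A is separated. -/
theorem ext_eq_zero_of_mem_closedIdeal {R : Type} [Ring R] [Algebra ℂ R] {σ : R →ₐ[ℂ] A}
    {s : Set (PowerSeries R)} (hs : ∀ r ∈ s, ext σ r = 0) {a : PowerSeries R}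
    (ha : a ∈ closedIdeal s) : ext σ a = 0 := by
  refine HComplete.separated _ fun n => ?_
  let I : TwoSidedIdeal A := TwoSidedIdeal.mk' {a | ∃ z : A, a = hbar ^ n • z}
    ⟨0, by simp⟩ (by rintro _ _ ⟨z, rfl⟩ ⟨w, rfl⟩; exact ⟨z + w, by simp⟩)
    (by rintro _ ⟨z, rfl⟩; exact ⟨-z, by simp⟩) (by rintro x _ ⟨z, rfl⟩; exact ⟨x * z, by simp⟩)
    (by rintro _ y ⟨z, rfl⟩; exact ⟨z * y, by simp⟩)
  have hI (b : A) : b ∈ I ↔ ∃ z : A, b = hbar ^ n • z := TwoSidedIdeal.mem_mk' ..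
  have key : TwoSidedIdeal.span (s ∪ {(PowerSeries.X : PowerSeries R) ^ n}) ≤ I.comap (ext σ) := by
    rw [TwoSidedIdeal.span_le]
    rintro r (hr | hr)
    · refine (TwoSidedIdeal.mem_comap _).2 ?_
      rw [hs r hr]
      exact I.zero_mem
    · refine (TwoSidedIdeal.mem_comap _).2 ((hI _).2 ⟨1, ?_⟩)
      rw [Set.mem_singleton_iff.1 hr, map_pow, ext_X, Algebra.smul_def, map_pow, mul_one]
  rw [closedIdeal, TwoSidedIdeal.mem_iInf] at ha
  exact (hI _).1 ((TwoSidedIdeal.mem_comap _).1 (key (ha n)))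

/-- The homomorphism from a presented algebra given by the images of the generators. -/
def lift (g : P.Gen → A) (hg : ∀ r ∈ P.rel, ext (FreeAlgebra.lift ℂ g) r = 0) :
    P.Alg →ₐ[Scalars] A where
  toRingHom := RingCon.lift (closedIdeal P.rel).ringCon (ext (FreeAlgebra.lift ℂ g)) (by
    intro a b hab
    have h1 : a - b ∈ closedIdeal P.rel := (TwoSidedIdeal.rel_iff _ a b).1 hab
    have h2 := ext_eq_zero_of_mem_closedIdeal hg h1
    rw [map_sub] at h2
    exact sub_eq_zero.1 h2)
  commutes' := ext_map_algebraMap _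

theorem lift_proj (g : P.Gen → A) (hg : ∀ r ∈ P.rel, ext (FreeAlgebra.lift ℂ g) r = 0)
    (a : PowerSeries (FreeAlgebra ℂ P.Gen)) :
    lift g hg (P.proj a) = ext (FreeAlgebra.lift ℂ g) a := rfl

@[simp] theorem lift_gen (g : P.Gen → A)
    (hg : ∀ r ∈ P.rel, ext (FreeAlgebra.lift ℂ g) r = 0) (x : P.Gen) :
    lift g hg (P.gen x) = g x := by
  rw [gen, lift_proj, ext_C, FreeAlgebra.lift_ι_apply]

theorem map_cSmul {B C : Type} [Ring B] [Algebra Scalars B] [Algebra ℂ B]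
    [IsScalarTower ℂ Scalars B] [Ring C] [Algebra Scalars C] [Algebra ℂ C]
    [IsScalarTower ℂ Scalars C] (g : B →ₐ[Scalars] C) (c : ℂ) (b : B) : g (c • b) = c • g b := by
  rw [← algebraMap_smul Scalars, map_smul, algebraMap_smul]

theorem map_proj (F : P.Alg →ₐ[Scalars] A) (a : PowerSeries (FreeAlgebra ℂ P.Gen)) :
    F (P.proj a) = ext (FreeAlgebra.lift ℂ fun x => F (P.gen x)) a := by
  rw [proj_eq_ext, map_ext]
  congr 2
  ext x
  simp [freeProj]

/-- A relation between the values of two homomorphisms holds if it holds for generators. -/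
theorem intertwine {F G : P.Alg →ₐ[Scalars] A} {c : A}
    (h : ∀ x, F (P.gen x) * c = c * G (P.gen x)) (a : P.Alg) : F a * c = c * G a := by
  obtain ⟨α, rfl⟩ := P.proj_surjective a
  -- Both sides are ħ-adic sums over the coefficients of a lift, which reduces the claim to one
  -- noncommutative polynomial.
  rw [map_proj, map_proj, ext_apply, ext_apply, ← hsum_mul_left, ← hsum_mul_right]
  congr 1
  funext n
  induction PowerSeries.coeff n α using FreeAlgebra.induction with
  | grade0 r => simp only [AlgHom.commutes]; exact Algebra.commutes r c
  | grade1 x => simpa using h x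
  | mul a b ha hb => rw [map_mul, map_mul, mul_assoc, hb, ← mul_assoc, ha, mul_assoc]
  | add a b ha hb => rw [map_add, map_add, add_mul, ha, hb, mul_add]

theorem hom_ext {F G : P.Alg →ₐ[Scalars] A} (h : ∀ x, F (P.gen x) = G (P.gen x)) : F = G :=
  AlgHom.ext fun a => by
    simpa using intertwine (F := F) (G := G) (c := 1) (by simpa using h) a

end lift

/-! Parity -/

/-- The sign `(-1) ^ (p * q)`. -/
def sgn (p q : Bool) : ℂ := if p && q then -1 else 1

/-- `π` is the parity automorphism. -/
def IsParity (P : SuperPres) (π : P.Alg →ₐ[Scalars] P.Alg) : Prop :=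
  ∀ x, π (P.gen x) = sgn true (P.odd x) • P.gen x

/-! ### Graded tensor products -/

section tensor

variable {P : SuperPres} {ι : Type} {A : Type} [Ring A] [Algebra Scalars A] [HComplete A]
  [Algebra ℂ A] [IsScalarTower ℂ Scalars A]

theorem map_gen {P Q : SuperPres} (f : P.Gen → Q.Gen) (hf : ∀ r ∈ P.rel, freeMap f r ∈ Q.rel)
    (x : P.Gen) : map f hf (P.gen x) = Q.gen (f x) := by
  change Q.proj (freeMap f _) = _
  simp [freeMap, gen]

@[simp] theorem slot_gen (i : ι) (x : P.Gen) : P.slot i (P.gen x) = (P.tensor ι).gen (i, x) :=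
  map_gen _ _ _

@[simp] theorem reindex_gen {κ : Type} (f : ι ↪ κ) (x : ι × P.Gen) :
    P.reindex f ((P.tensor ι).gen x) = (P.tensor κ).gen (f x.1, x.2) :=
  map_gen (P := P.tensor ι) (Q := P.tensor κ) _ _ _

theorem reindex_slot {κ : Type} (f : ι ↪ κ) (i : ι) (a : P.Alg) :
    P.reindex f (P.slot i a) = P.slot (f i) a := by
  have : (P.reindex f).comp (P.slot i) = P.slot (f i) := hom_ext fun x => by
    rw [AlgHom.comp_apply, slot_gen, reindex_gen, slot_gen]
  exact DFunLike.congr_fun this a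

theorem ext_freeMap {α β : Type} (σ : FreeAlgebra ℂ β →ₐ[ℂ] A) (f : α → β)
    (r : PowerSeries (FreeAlgebra ℂ α)) :
    ext σ (freeMap f r) = ext (FreeAlgebra.lift ℂ fun x => σ (FreeAlgebra.ι ℂ (f x))) r := by
  rw [freeMap, ext_map]
  congr 2
  ext x
  simp

/-- Supercommuting homomorphisms define a homomorphism from the tensor product. -/
theorem exists_tensor_lift (α : ι → P.Alg →ₐ[Scalars] A)
    (h : ∀ i j x y, i ≠ j → α i (P.gen x) * α j (P.gen y) =
      sgn (P.odd x) (P.odd y) • (α j (P.gen y) * α i (P.gen x))) :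
    ∃ F : (P.tensor ι).Alg →ₐ[Scalars] A, ∀ i a, F (P.slot i a) = α i a := by
  have hg : ∀ r ∈ (P.tensor ι).rel,
      ext (FreeAlgebra.lift ℂ fun x : ι × P.Gen => α x.1 (P.gen x.2)) r = 0 := by
    rintro r (⟨i, s, hs, rfl⟩ | ⟨i, j, x, y, hij, rfl⟩)
    · refine (ext_freeMap (FreeAlgebra.lift ℂ fun x : ι × P.Gen => α x.1 (P.gen x.2))
        (fun x => (i, x)) s).trans ?_
      simp only [FreeAlgebra.lift_ι_apply]
      rw [← map_proj, (P.proj_eq_zero_iff s).2, map_zero]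
      rw [closedIdeal, TwoSidedIdeal.mem_iInf]
      exact fun n => TwoSidedIdeal.subset_span (Or.inl hs)
    · refine (ext_C (FreeAlgebra.lift ℂ fun x : ι × P.Gen => α x.1 (P.gen x.2)) _).trans ?_
      rw [map_sub, map_smul, map_mul, map_mul]
      simp only [FreeAlgebra.lift_ι_apply]
      exact sub_eq_zero.2 (h i j x y hij)
  refine ⟨lift (P := P.tensor ι) (fun x => α x.1 (P.gen x.2)) hg, fun i a => ?_⟩
  have : (lift (P := P.tensor ι) (fun x => α x.1 (P.gen x.2)) hg).comp (P.slot i) = α i :=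
    hom_ext fun x => (congrArg _ (slot_gen i x)).trans (lift_gen _ hg _)
  exact DFunLike.congr_fun this a

theorem exists_tensor_lift_two (α β : P.Alg →ₐ[Scalars] A)
    (h : ∀ x y, α (P.gen x) * β (P.gen y) =
      sgn (P.odd x) (P.odd y) • (β (P.gen y) * α (P.gen x))) :
    ∃ F : (P.tensor (Fin 2)).Alg →ₐ[Scalars] A,
      (∀ a, F (P.slot 0 a) = α a) ∧ ∀ b, F (P.slot 1 b) = β b := by
  obtain ⟨F, hF⟩ := exists_tensor_lift (P := P) (ι := Fin 2)
    (fun i => if i = 0 then α else β) (by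
    intro i j x y hij
    fin_cases i <;> fin_cases j
    · exact absurd rfl hij
    · exact h x y
    · change β (P.gen x) * α (P.gen y) = _ • (α (P.gen y) * β (P.gen x))
      rw [h, smul_smul]
      cases P.odd x <;> cases P.odd y <;> simp [sgn]
    · exact absurd rfl hij)
  exact ⟨F, hF 0, hF 1⟩

theorem slot_gen_mul {i j : ι} (hij : i ≠ j) (x y : P.Gen) :
    P.slot i (P.gen x) * P.slot j (P.gen y) =
      sgn (P.odd x) (P.odd y) • (P.slot j (P.gen y) * P.slot i (P.gen x)) := by
  have h : (P.tensor ι).proj (PowerSeries.C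
      (FreeAlgebra.ι ℂ (i, x) * FreeAlgebra.ι ℂ (j, y) -
        sgn (P.odd x) (P.odd y) •
          (FreeAlgebra.ι ℂ (j, y) * FreeAlgebra.ι ℂ (i, x)))) = 0 := by
    rw [proj_eq_zero_iff, closedIdeal, TwoSidedIdeal.mem_iInf]
    exact fun n => TwoSidedIdeal.subset_span (Or.inl (Or.inr ⟨i, j, x, y, hij, rfl⟩))
  have h2 := ((P.tensor ι).proj_C (FreeAlgebra.ι ℂ ((i, x) : ι × P.Gen) *
    FreeAlgebra.ι ℂ ((j, y) : ι × P.Gen) - sgn (P.odd x) (P.odd y) •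
      (FreeAlgebra.ι ℂ ((j, y) : ι × P.Gen) * FreeAlgebra.ι ℂ ((i, x) : ι × P.Gen)))).symm.trans h
  refine sub_eq_zero.1 (Eq.trans ?_ h2)
  refine Eq.trans ?_ (map_sub (P.tensor ι).freeProj _ _).symm
  refine congrArg₂ _ ?_ (Eq.trans ?_ (map_smul (P.tensor ι).freeProj _ _).symm)
  · refine Eq.trans ?_ (map_mul (P.tensor ι).freeProj _ _).symm
    rw [slot_gen, slot_gen]
    exact congrArg₂ _ (FreeAlgebra.lift_ι_apply ..).symm (FreeAlgebra.lift_ι_apply ..).symm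
  · refine congrArg _ (Eq.trans ?_ (map_mul (P.tensor ι).freeProj _ _).symm)
    rw [slot_gen, slot_gen]
    exact congrArg₂ _ (FreeAlgebra.lift_ι_apply ..).symm (FreeAlgebra.lift_ι_apply ..).symm

theorem IsParity.comp_self {π : P.Alg →ₐ[Scalars] P.Alg} (hπ : P.IsParity π) (a : P.Alg) :
    π (π a) = a := by
  have : π.comp π = AlgHom.id _ _ := hom_ext fun x => by
    have h := hπ x
    rw [AlgHom.comp_apply, h, map_cSmul, h, smul_smul]
    cases P.odd x <;> simp [sgn]
  exact DFunLike.congr_fun this a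

theorem exists_parity_tensor {π : P.Alg →ₐ[Scalars] P.Alg} (hπ : P.IsParity π) :
    ∃ Q : (P.tensor ι).Alg →ₐ[Scalars] (P.tensor ι).Alg, (P.tensor ι).IsParity Q ∧
      ∀ i a, Q (P.slot i a) = P.slot i (π a) := by
  have hs (i : ι) (x : P.Gen) : P.slot i (π (P.gen x)) =
      sgn true (P.odd x) • P.slot i (P.gen x) := by
    rw [hπ x, map_cSmul]
  obtain ⟨F, hF⟩ := exists_tensor_lift (P := P) (ι := ι) (fun i => (P.slot i).comp π) (by
    intro i j x y hij
    simp only [AlgHom.comp_apply, hs, smul_mul_smul_comm]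
    rw [slot_gen_mul hij, smul_smul, smul_smul]
    congr 1
    ring)
  refine ⟨F, fun x => ?_, hF⟩
  refine ((congrArg F (slot_gen x.1 x.2)).symm.trans (hF x.1 (P.gen x.2))).trans ?_
  exact (hs x.1 x.2).trans (congrArg _ (slot_gen x.1 x.2))

/-- Elements of different tensor factors supercommute. -/
theorem slot_mul_slot {π : P.Alg →ₐ[Scalars] P.Alg} (hπ : P.IsParity π) {i j : ι} (hij : i ≠ j)
    {p q : Bool} {a b : P.Alg} (ha : π a = sgn true p • a) (hb : π b = sgn true q • b) :
    P.slot i a * P.slot j b = sgn p q • (P.slot j b * P.slot i a) := by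
  have h1 (y : P.Gen) : P.slot i a * P.slot j (P.gen y) =
      sgn p (P.odd y) • (P.slot j (P.gen y) * P.slot i a) := by
    cases hy : P.odd y with
    | false =>
      have := intertwine (F := P.slot (ι := ι) i) (G := P.slot i) (c := P.slot j (P.gen y))
        (fun x => by rw [slot_gen_mul hij, hy]; simp [sgn]) a
      simpa [sgn] using this
    | true =>
      -- An odd generator in factor j anticommutes with the odd part of factor i. The sign is
      -- absorbed by composing the embedding with the parity automorphism.
      have := intertwine (F := P.slot (ι := ι) i) (G := (P.slot i).comp π)
        (c := P.slot j (P.gen y)) (fun x => by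
          rw [slot_gen_mul hij, hy, AlgHom.comp_apply, hπ x, map_cSmul, mul_smul_comm]
          cases P.odd x <;> rfl) a
      rw [this, AlgHom.comp_apply, ha, map_cSmul, mul_smul_comm]
      cases p <;> rfl
  cases p with
  | false =>
    have := intertwine (F := P.slot (ι := ι) j) (G := P.slot j) (c := P.slot i a)
        (fun y => by rw [h1 y]; simp [sgn]) b
    simpa [sgn] using this.symm
  | true =>
    have := intertwine (F := P.slot (ι := ι) j) (G := (P.slot j).comp π) (c := P.slot i a)
        (fun y => by
          rw [AlgHom.comp_apply, hπ y, map_cSmul, mul_smul_comm, h1 y, smul_smul]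
          cases P.odd y <;> simp [sgn]) b
    rw [this, AlgHom.comp_apply, hb, map_cSmul, mul_smul_comm, smul_smul]
    cases q <;> simp [sgn]

/-- The element `b` need not be homogeneous: an even element commutes with every generator of the
other factor. -/
theorem slot_commute {π : P.Alg →ₐ[Scalars] P.Alg} (hπ : P.IsParity π) {i j : ι} (hij : i ≠ j)
    {a : P.Alg} (ha : π a = a) (b : P.Alg) : Commute (P.slot i a) (P.slot j b) := by
  have h1 (y : P.Gen) : P.slot j (P.gen y) * P.slot i a = P.slot i a * P.slot j (P.gen y) := by
    have := slot_mul_slot hπ hij (p := false) (q := P.odd y) (by simpa [sgn] using ha) (hπ y)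
    simpa [sgn] using this.symm
  exact (intertwine h1 b).symm

theorem parity_proj {π : P.Alg →ₐ[Scalars] P.Alg} (hπ : P.IsParity π)
    (a : PowerSeries (FreeAlgebra ℂ P.Gen)) :
    π (P.proj a) = P.proj (PowerSeries.map P.freeParity.toRingHom a) := by
  rw [map_proj, proj_eq_ext, ext_map]
  congr 2
  ext x
  simp only [Function.comp_apply, FreeAlgebra.lift_ι_apply, hπ x, freeProj, AlgHom.comp_apply,
    freeParity]
  cases P.odd x <;> simp [sgn]

theorem IsHomogeneous.parity_eq {π : P.Alg →ₐ[Scalars] P.Alg} (hπ : P.IsParity π) {p : Bool}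
    {a : P.Alg} (ha : P.IsHomogeneous p a) : π a = sgn true p • a := by
  obtain ⟨α, h, rfl⟩ := ha
  rw [parity_proj hπ, h]
  cases p <;> simp [sgn]

/-- Left multiplication on linear maps `f`, which may be applied to the left factor of `1 ⊗ f`. -/
def superLeft {π : P.Alg →ₐ[Scalars] P.Alg} (hπ : P.IsParity π) :
    P.Alg →ₐ[Scalars] Module.End Scalars (P.Alg →ₗ[Scalars] P.Alg) :=
  AlgHom.ofLinearMap
    { toFun := fun a =>
        { toFun := fun f => LinearMap.mulLeft Scalars ((1 / 2 : ℂ) • (a + π a)) ∘ₗ f +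
            LinearMap.mulLeft Scalars ((1 / 2 : ℂ) • (a - π a)) ∘ₗ f ∘ₗ π.toLinearMap
          map_add' := fun f g => by
            ext v
            simp [mul_add]
            abel
          map_smul' := fun c f => by
            ext v
            simp }
      map_add' := fun a b => by
        ext f v
        simp [add_mul, sub_mul]
        module
      map_smul' := fun c a => by
        ext f v
        simp only [map_smul, LinearMap.coe_mk, AddHom.coe_mk, LinearMap.add_apply,
          LinearMap.comp_apply, LinearMap.mulLeft_apply, RingHom.id_apply, LinearMap.smul_apply,
          smul_mul_assoc, ← smul_add, ← smul_sub]
        rw [smul_comm c] }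
    (by
      ext f v
      simp only [← smul_add, map_one, LinearMap.coe_mk, AddHom.coe_mk, LinearMap.add_apply,
        LinearMap.comp_apply, LinearMap.mulLeft_apply, sub_self, smul_zero, zero_mul, add_zero,
        Module.End.one_apply, ← two_smul ℂ (1 : P.Alg), smul_smul, smul_mul_assoc, one_mul]
      norm_num)
    (fun a b => by
      ext f v
      simp only [LinearMap.coe_mk, AddHom.coe_mk, LinearMap.add_apply, map_mul, LinearMap.comp_add,
        LinearMap.comp_apply, LinearMap.mulLeft_apply, Module.End.mul_apply,
        AlgHom.toLinearMap_apply, hπ.comp_self]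
      simp only [mul_add, mul_sub, add_mul, sub_mul, smul_mul_assoc, mul_smul_comm, smul_add,
        smul_sub, mul_assoc]
      module)

theorem superLeft_apply {π : P.Alg →ₐ[Scalars] P.Alg} (hπ : P.IsParity π) (a : P.Alg)
    (f : P.Alg →ₗ[Scalars] P.Alg) (v : P.Alg) :
    superLeft hπ a f v = (1 / 2 : ℂ) • (a + π a) * f v + (1 / 2 : ℂ) • (a - π a) * f (π v) := rfl

/-- The action on linear maps induced by right multiplication on their source. -/
def sourceRight (P : SuperPres) :
    P.Alg →ₐ[Scalars] Module.End Scalars (P.Alg →ₗ[Scalars] P.Alg) :=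
  AlgHom.ofLinearMap
    { toFun := fun b =>
        { toFun := fun f => f ∘ₗ LinearMap.mulRight Scalars b
          map_add' := fun _ _ => rfl
          map_smul' := fun _ _ => rfl }
      map_add' := fun a b => by
        ext f v
        simp [mul_add]
      map_smul' := fun c a => by
        ext f v
        simp }
    (by
      ext f v
      simp)
    (fun a b => by
      ext f v
      simp [mul_assoc])

theorem sourceRight_apply (b : P.Alg) (f : P.Alg →ₗ[Scalars] P.Alg) (v : P.Alg) :
    P.sourceRight b f v = f (v * b) := rfl

/-- The linear map `a ⊗ b ↦ a f(b)`. -/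
theorem exists_isMulIdTensor {π : P.Alg →ₐ[Scalars] P.Alg} (hπ : P.IsParity π)
    (f : P.Alg →ₗ[Scalars] P.Alg) :
    ∃ ν : (P.tensor (Fin 2)).Alg →ₗ[Scalars] P.Alg, IsMulIdTensor f ν := by
  -- The graded left multiplication of values and the right multiplication of arguments
  -- supercommute. So the linear maps A → A form a module over the tensor square in which a ⊗ b
  -- sends f to a map with value a f(b) at 1. The required ν is evaluation at f and then at 1.
  have key (x y : P.Gen) : superLeft hπ (P.gen x) * P.sourceRight (P.gen y) =
      sgn (P.odd x) (P.odd y) • (P.sourceRight (P.gen y) * superLeft hπ (P.gen x)) := by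
    ext f v
    simp only [Module.End.mul_apply, LinearMap.smul_apply, superLeft_apply, sourceRight_apply,
      map_mul, hπ x, hπ y]
    cases P.odd x <;> cases P.odd y <;> simp [sgn]
  obtain ⟨F, h0, h1⟩ := exists_tensor_lift_two
    (A := Module.End Scalars (P.Alg →ₗ[Scalars] P.Alg)) (superLeft hπ) P.sourceRight key
  refine ⟨LinearMap.applyₗ (1 : P.Alg) ∘ₗ LinearMap.applyₗ f ∘ₗ F.toLinearMap, fun a b => ?_⟩
  simp only [LinearMap.comp_apply, AlgHom.toLinearMap_apply, LinearMap.applyₗ_apply_apply, tmul,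
    map_mul, h0, h1, Module.End.mul_apply, superLeft_apply, sourceRight_apply, map_one, one_mul]
  rw [← add_mul]
  congr 1
  module

end tensor

end SuperPres

/-! ### Calculus of mapping functions -/

namespace MapFun

/-- The derivative with respect to `x`, as a derivation. -/
def dxD : Derivation Scalars MapFun MapFun :=
  Derivation.mk'
    { toFun := dx
      map_add' := fun φ ψ => by
        ext1 n
        simp [dx]
      map_smul' := fun c φ => by
        ext1 n
        simp only [dx, Algebra.smul_def, PowerSeries.coeff_mk, PowerSeries.coeff_mul,
          map_sum, RingHom.id_apply]
        refine sum_congr rfl fun p _ => ?_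
        have : PowerSeries.coeff p.1 (algebraMap Scalars MapFun c) =
          Polynomial.C (PowerSeries.coeff p.1 c) := PowerSeries.coeff_map _ _ _
        rw [this, Polynomial.derivative_C_mul] }
    (fun φ ψ => by
      ext1 n
      simp only [LinearMap.coe_mk, AddHom.coe_mk, smul_eq_mul, map_add, dx, PowerSeries.coeff_mk,
        PowerSeries.coeff_mul, map_sum, Polynomial.derivative_mul]
      rw [sum_add_distrib, add_comm]
      congr 1
      rw [← Finset.Nat.sum_antidiagonal_swap]
      exact sum_congr rfl fun p _ => mul_comm _ _)

theorem dxD_apply (φ : MapFun) : dxD φ = dx φ := rfl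

@[simp] theorem dx_add (φ ψ : MapFun) : dx (φ + ψ) = dx φ + dx ψ := map_add dxD φ ψ
@[simp] theorem dx_sub (φ ψ : MapFun) : dx (φ - ψ) = dx φ - dx ψ := map_sub dxD φ ψ
@[simp] theorem dx_neg (φ : MapFun) : dx (-φ) = -dx φ := map_neg dxD φ
@[simp] theorem dx_mul (φ ψ : MapFun) : dx (φ * ψ) = dx φ * ψ + φ * dx ψ := by
  have := dxD.leibniz φ ψ
  simp only [dxD_apply, smul_eq_mul] at this
  rw [this]
  ring
@[simp] theorem dx_one : dx 1 = 0 := dxD.map_one_eq_zero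
@[simp] theorem dx_x : dx x = 1 := by
  ext1 n
  simp only [dx, x, PowerSeries.coeff_mk, PowerSeries.coeff_C, PowerSeries.coeff_one]
  split_ifs <;> simp
@[simp] theorem dx_hb : dx hb = 0 := by
  ext1 n
  simp only [dx, hb, PowerSeries.coeff_mk, PowerSeries.coeff_X, map_zero]
  split_ifs <;> simp
@[simp] theorem dx_c (r : ℂ) : dx (c r) = 0 := by
  ext1 n
  simp only [dx, c, PowerSeries.coeff_mk, PowerSeries.coeff_C, map_zero]
  split_ifs <;> simp
@[simp] theorem dx_pow (φ : MapFun) (n : ℕ) : dx (φ ^ n) = n * φ ^ (n - 1) * dx φ := by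
  have := dxD.leibniz_pow φ n
  simp only [dxD_apply, smul_eq_mul, nsmul_eq_mul] at this
  rw [this]
  ring

/-! Constants -/

theorem c_mul (r s : ℂ) : c (r * s) = c r * c s := by simp [c]
@[simp] theorem c_one : c 1 = 1 := by simp [c]
@[simp] theorem c_zero : c 0 = 0 := by simp [c]
theorem c_neg (r : ℂ) : c (-r) = -c r := by simp [c]
theorem c_natCast (n : ℕ) : c n = n := by simp [c]
theorem c_ofNat (n : ℕ) [n.AtLeastTwo] : c (OfNat.ofNat n) = OfNat.ofNat n := c_natCast n
theorem c_eq_algebraMap (r : ℂ) : c r = algebraMap ℂ MapFun r :=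
  (PowerSeries.algebraMap_apply ..).symm
theorem smul_eq_c_mul (r : ℂ) (φ : MapFun) : r • φ = c r * φ := by
  rw [c_eq_algebraMap, Algebra.smul_def]
theorem algebraMap_hbar : algebraMap Scalars MapFun hbar = hb := PowerSeries.map_X _
theorem hbar_smul (φ : MapFun) : hbar • φ = hb * φ := by
  rw [Algebra.smul_def, algebraMap_hbar]

theorem hb_ne_zero : hb ≠ 0 := PowerSeries.X_ne_zero
theorem c_injective : Function.Injective c :=
  PowerSeries.C_injective.comp Polynomial.C_injective
theorem x_ne_zero : x ≠ 0 := fun h => Polynomial.X_ne_zero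
  (PowerSeries.C_injective (h.trans (map_zero PowerSeries.C).symm))

theorem dx_aeval (g : MapFun) (p : Polynomial ℂ) :
    dx (Polynomial.aeval g p) = Polynomial.aeval g (Polynomial.derivative p) * dx g := by
  induction p using Polynomial.induction_on' with
  | add p q hp hq => simp only [map_add, dx_add, add_mul, hp, hq]
  | monomial n r =>
    simp only [Polynomial.aeval_monomial, Polynomial.derivative_monomial, ← c_eq_algebraMap,
      dx_mul, dx_c, dx_pow, c_mul, c_natCast]
    ring

theorem dx_evalAt (g φ : MapFun) : dx (evalAt g φ) = evalAt g (dx φ) * dx g := by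
  simp only [evalAt_apply, ext_apply]
  rw [← hsum_mul_right]
  refine (map_hsum (dxD : Derivation Scalars MapFun MapFun).toLinearMap _).trans ?_
  congr 1
  funext n
  have e : PowerSeries.coeff n (dx φ) = Polynomial.derivative (PowerSeries.coeff n φ) := by
    rw [dx, PowerSeries.coeff_mk]
  rw [e]
  exact dx_aeval g _

/-! The classical limit -/

@[simp] theorem limit_add (φ ψ : MapFun) : limit (φ + ψ) = limit φ + limit ψ := map_add _ φ ψ
@[simp] theorem limit_sub (φ ψ : MapFun) : limit (φ - ψ) = limit φ - limit ψ := map_sub _ φ ψ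
@[simp] theorem limit_neg (φ : MapFun) : limit (-φ) = -limit φ := map_neg _ φ
@[simp] theorem limit_mul (φ ψ : MapFun) : limit (φ * ψ) = limit φ * limit ψ := map_mul _ φ ψ
@[simp] theorem limit_pow (φ : MapFun) (n : ℕ) : limit (φ ^ n) = limit φ ^ n := map_pow _ φ n
@[simp] theorem limit_one : limit 1 = 1 := map_one _
@[simp] theorem limit_x : limit x = Polynomial.X := PowerSeries.constantCoeff_C _
@[simp] theorem limit_hb : limit hb = 0 := PowerSeries.constantCoeff_X
@[simp] theorem limit_c (r : ℂ) : limit (c r) = Polynomial.C r := PowerSeries.constantCoeff_C _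
theorem limit_eq_coeff (φ : MapFun) : limit φ = PowerSeries.coeff 0 φ :=
  (PowerSeries.coeff_zero_eq_constantCoeff_apply φ).symm
@[simp] theorem limit_dx (φ : MapFun) : limit (dx φ) = Polynomial.derivative (limit φ) := by
  simp only [limit_eq_coeff, dx, PowerSeries.coeff_mk]

theorem constantCoeff_evalAt {R : Type} [CommRing R] [Algebra ℂ R] (g : PowerSeries R)
    (φ : MapFun) : PowerSeries.constantCoeff (evalAt g φ) =
      Polynomial.aeval (PowerSeries.constantCoeff g) (limit φ) := by
  have h2 : algebraMap Scalars (PowerSeries R) hbar = PowerSeries.X := PowerSeries.map_X _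
  have h3 : ∃ z, evalAt g φ = Polynomial.aeval g (limit φ) + PowerSeries.X * z := by
    rw [evalAt_apply, ext_apply, hsum_cons, Algebra.smul_def, h2]
    exact ⟨_, by rw [limit_eq_coeff]⟩
  obtain ⟨z, h3⟩ := h3
  rw [h3, map_add, map_mul, PowerSeries.constantCoeff_X, zero_mul, add_zero]
  let f : PowerSeries R →ₐ[ℂ] R :=
    { (PowerSeries.constantCoeff : PowerSeries R →+* R) with
      commutes' := fun r => by
        rw [PowerSeries.algebraMap_apply]
        exact PowerSeries.constantCoeff_C _ }
  exact (Polynomial.aeval_algHom_apply f g (limit φ)).symm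

@[simp] theorem limit_evalAt (g φ : MapFun) : limit (evalAt g φ) = (limit φ).comp (limit g) := by
  rw [limit, constantCoeff_evalAt, Polynomial.aeval_def, Polynomial.comp]
  rfl

theorem ne_zero_of_limit {φ : MapFun} (h : limit φ ≠ 0) : φ ≠ 0 := by
  rintro rfl
  exact h (map_zero _)

theorem exists_inv {φ : MapFun} {r : ℂ} (hr : r ≠ 0) (h : limit φ = Polynomial.C r) :
    ∃ ψ, ψ * φ = 1 := by
  have : IsUnit φ := by
    rw [PowerSeries.isUnit_iff_constantCoeff]
    change IsUnit (limit φ)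
    rw [h]
    exact (isUnit_iff_ne_zero.2 hr).map Polynomial.C
  obtain ⟨u, rfl⟩ := this
  exact ⟨_, u.inv_mul⟩

theorem exists_inv' {φ : MapFun} (h : limit φ = 1) : ∃ ψ, ψ * φ = 1 :=
  exists_inv one_ne_zero (h.trans Polynomial.C_1.symm)

theorem limit_inv {φ ψ : MapFun} (h : limit φ = 1) (hψ : ψ * φ = 1) : limit ψ = 1 := by
  simpa [h] using congrArg limit hψ

/-- Mapping functions form a domain, so only a sign is open, and the limit 1 fixes it. -/
theorem eq_of_sq_eq_sq {φ ψ : MapFun} (h : φ ^ 2 = ψ ^ 2) (h1 : limit φ = 1) (h2 : limit ψ = 1) :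
    φ = ψ := by
  rcases sq_eq_sq_iff_eq_or_eq_neg.1 h with h | h
  · exact h
  · rw [h, limit_neg, h2] at h1
    have := congrArg (Polynomial.eval 0) h1
    norm_num at this

/-! Values at `x = 0` -/

/-- The value at `x = 0`. -/
def atZero : MapFun →+* Scalars := PowerSeries.map (Polynomial.evalRingHom 0)

@[simp] theorem atZero_x : atZero x = 0 := by simp [atZero, x]

theorem exists_eq_x_mul {φ : MapFun} (h : atZero φ = 0) : ∃ ψ, φ = x * ψ := by
  have h' (n : ℕ) : Polynomial.X ∣ PowerSeries.coeff n φ := by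
    rw [Polynomial.X_dvd_iff, Polynomial.coeff_zero_eq_eval_zero]
    simpa [atZero] using congrArg (PowerSeries.coeff n) h
  choose ψ hψ using h'
  refine ⟨PowerSeries.mk ψ, ?_⟩
  ext1 n
  rw [x, PowerSeries.coeff_C_mul, PowerSeries.coeff_mk, hψ n]

/-- In characteristic zero a polynomial with zero derivative is constant. Binomial and logarithmic
series are identified in this way, by a differential equation and the value at x = 0. -/
theorem eq_of_dx_eq {φ ψ : MapFun} (h : dx φ = dx ψ) (h0 : atZero φ = atZero ψ) : φ = ψ := by
  rw [← sub_eq_zero] at h h0 ⊢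
  rw [← dx_sub] at h
  rw [← map_sub] at h0
  ext1 n
  have h1 : Polynomial.derivative (PowerSeries.coeff n (φ - ψ)) = 0 := by
    simpa [dx] using congrArg (PowerSeries.coeff n) h
  have h2 : Polynomial.eval 0 (PowerSeries.coeff n (φ - ψ)) = 0 := by
    simpa [atZero] using congrArg (PowerSeries.coeff n) h0
  rw [Polynomial.eq_C_of_derivative_eq_zero h1, Polynomial.coeff_zero_eq_eval_zero, h2]
  simp

/-! Inverses for composition -/

/-- Substitution of g, which is x modulo ħ, has the form φ ↦ φ − ħKφ. It is inverted at x by the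
Neumann series ∑ ħ^n K^n x. -/
theorem exists_comp_eq {g : MapFun} (hg : limit g = Polynomial.X) :
    ∃ g', limit g' = Polynomial.X ∧ evalAt g g' = x := by
  have h1 (φ : MapFun) : ∃ ψ, evalAt g φ = φ - hbar • ψ := by
    have : PowerSeries.X ∣ φ - evalAt g φ := by
      rw [PowerSeries.X_dvd_iff]
      change limit _ = 0
      rw [limit_sub, limit_evalAt, hg, Polynomial.comp_X, sub_self]
    obtain ⟨ψ, hψ⟩ := this
    exact ⟨ψ, by rw [hbar_smul, hb, ← hψ]; abel⟩
  choose K hK using h1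
  have h2 : evalAt g (hsum fun n => K^[n] x) = x := by
    -- The sum telescopes: the n-th term contributes ħ^n K^n x − ħ^(n+1) K^(n+1) x.
    have e1 := map_hsum (evalAt g).toLinearMap fun n => K^[n] x
    simp only [AlgHom.toLinearMap_apply, hK (K^[_] x)] at e1
    rw [e1]
    have e2 := hsum_add (fun n => K^[n] x - hbar • K (K^[n] x)) (fun n => hbar • K (K^[n] x))
    simp only [sub_add_cancel] at e2
    have e3 := map_hsum (LinearMap.lsmul Scalars MapFun hbar) (fun n => K (K^[n] x))
    simp only [LinearMap.lsmul_apply] at e3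
    rw [← sub_eq_iff_eq_add] at e2
    rw [← e2, ← e3, hsum_cons]
    simp only [← Function.iterate_succ_apply' K, Function.iterate_zero, id_eq]
    abel
  refine ⟨_, ?_, h2⟩
  have := congrArg limit h2
  rwa [limit_evalAt, hg, Polynomial.comp_X, limit_x] at this

/-- The one-sided inverse also has limit x, so it has a one-sided inverse of its own, which must be
g by associativity of substitution. -/
theorem exists_compInv {g : MapFun} (hg : limit g = Polynomial.X) :
    ∃ g', limit g' = Polynomial.X ∧ evalAt g g' = x ∧ evalAt g' g = x := by
  obtain ⟨g', h1, h2⟩ := exists_comp_eq hg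
  obtain ⟨g'', -, h3⟩ := exists_comp_eq h1
  refine ⟨g', h1, h2, ?_⟩
  have : g'' = g := by
    rw [← evalAt_self g'', ← h2, ← evalAt_evalAt, h3, evalAt_x]
  rw [← this, h3]

/-! Exponentials -/

theorem limit_expPow (r : ℂ) : limit (expPow r) = 1 := by
  simp [limit_eq_coeff, expPow, -PowerSeries.coeff_zero_eq_constantCoeff]

theorem atZero_expPow (r : ℂ) : atZero (expPow r) = 1 := by
  ext n
  cases n <;> simp [atZero, expPow, PowerSeries.coeff_one]

theorem dx_expPow (r : ℂ) : dx (expPow r) = c r * hb * expPow r := by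
  ext1 n
  rw [c, hb, mul_assoc, PowerSeries.coeff_C_mul]
  cases n with
  | zero => simp [dx, expPow]
  | succ n =>
    rw [PowerSeries.coeff_succ_X_mul]
    simp only [dx, expPow, PowerSeries.coeff_mk, Polynomial.derivative_C_mul_X_pow]
    rw [← mul_assoc, ← map_mul, Nat.add_sub_cancel]
    congr 2
    rw [Nat.factorial_succ]
    have := Nat.cast_add_one_ne_zero (R := ℂ) n
    have := Nat.cast_ne_zero (R := ℂ).2 n.factorial_ne_zero
    push_cast
    field_simp
    ring

theorem expPow_zero : expPow 0 = 1 :=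
  eq_of_dx_eq (by simp [dx_expPow]) (by rw [atZero_expPow, map_one])

end MapFun

/-! ### Exponentials in complete algebras -/

section expo

open MapFun

variable {A : Type} [Ring A] [Algebra Scalars A] [HComplete A] [Algebra ℂ A]
  [IsScalarTower ℂ Scalars A]

/-- `exp (r 𝐡 a)`. -/
def expo (r : ℂ) (a : A) : A := evalAt a (expPow r)

theorem expo_eq_ev (r : ℂ) (a : A) :
    expo r a = ev A (PowerSeries.mk fun n => (r ^ n / (n.factorial : ℂ)) • a ^ n) := by
  rw [expo, evalAt_apply, ext_apply, ev_apply]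
  congr 1
  funext n
  simp [expPow, Algebra.smul_def]

/-- The binomial theorem for commuting elements, applied to the coefficients before the series are
evaluated at ħ. -/
theorem expo_add_of_commute (r : ℂ) {a b : A} (h : Commute a b) :
    expo r (a + b) = expo r a * expo r b := by
  simp only [expo_eq_ev, ← map_mul]
  congr 1
  ext1 n
  rw [PowerSeries.coeff_mul, PowerSeries.coeff_mk, h.add_pow', smul_sum]
  refine sum_congr rfl fun p hp => ?_
  rw [HasAntidiagonal.mem_antidiagonal] at hp
  simp only [PowerSeries.coeff_mk, smul_mul_smul_comm, ← hp]
  rw [← Nat.cast_smul_eq_nsmul ℂ, smul_smul]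
  congr 1
  rw [Nat.choose_symm_add, Nat.add_choose, Nat.cast_div (Nat.factorial_mul_factorial_dvd_factorial_add _ _)
    (by exact_mod_cast mul_ne_zero p.1.factorial_ne_zero p.2.factorial_ne_zero)]
  have h1 := Nat.cast_ne_zero (R := ℂ).2 (p.1 + p.2).factorial_ne_zero
  have h2 := Nat.cast_ne_zero (R := ℂ).2 p.1.factorial_ne_zero
  have h3 := Nat.cast_ne_zero (R := ℂ).2 p.2.factorial_ne_zero
  push_cast
  field_simp
  ring

theorem expo_smul (r s : ℂ) (a : A) : expo r (s • a) = expo (r * s) a := by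
  simp only [expo_eq_ev]
  congr 1
  ext1 n
  simp only [PowerSeries.coeff_mk, smul_pow, smul_smul]
  congr 1
  ring

theorem expo_add (r s : ℂ) (a : A) : expo (r + s) a = expo r a * expo s a := by
  have := expo_add_of_commute 1 (((Commute.refl a).smul_left r).smul_right s)
  simpa only [← add_smul, expo_smul, one_mul] using this

@[simp] theorem expo_zero (a : A) : expo 0 a = 1 := by rw [expo, expPow_zero, map_one]

theorem expo_mul_neg (r : ℂ) (a : A) : expo r a * expo (-r) a = 1 := by
  rw [← expo_add, add_neg_cancel, expo_zero]

theorem expo_neg_mul (r : ℂ) (a : A) : expo (-r) a * expo r a = 1 := by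
  rw [← expo_add, neg_add_cancel, expo_zero]

theorem expo_neg (r : ℂ) (a : A) : expo r (-a) = expo (-r) a := by
  have := expo_smul r (-1) a
  simpa using this

theorem evalAt_expPow (r : ℂ) (a : A) : evalAt a (expPow r) = expo r a := rfl

theorem map_expo {B : Type} [Ring B] [Algebra Scalars B] [HComplete B] [Algebra ℂ B]
    [IsScalarTower ℂ Scalars B] (g : A →ₐ[Scalars] B) (r : ℂ) (a : A) :
    g (expo r a) = expo r (g a) := map_evalAt ..

theorem MapFun.expPow_eq_expo (r : ℂ) : expPow r = expo r MapFun.x := (evalAt_self _).symm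

theorem MapFun.expPow_add (r s : ℂ) : expPow (r + s) = expPow r * expPow s := by
  simp only [MapFun.expPow_eq_expo, expo_add]

theorem expo_pow (r : ℂ) (a : A) (n : ℕ) : expo r a ^ n = expo (n * r) a := by
  induction n with
  | zero => simp
  | succ n ih => rw [pow_succ, ih, ← expo_add]; congr 1; push_cast; ring

theorem isExp_expo (a : A) : IsExp (hbar • a) (expo 1 a) := by
  intro N
  obtain ⟨z, hz⟩ := hasHSum_hsum (fun n => (1 ^ n / (n.factorial : ℂ)) • a ^ n) N
  refine ⟨z, ?_⟩
  have : expo 1 a = hsum fun n => (1 ^ n / (n.factorial : ℂ)) • a ^ n := by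
    rw [expo_eq_ev, ev_apply]
    simp only [PowerSeries.coeff_mk]
  rw [this, hz]
  congr 1
  refine sum_congr rfl fun n _ => ?_
  simp only [one_pow, smul_pow]
  rw [smul_comm (cst _)]
  refine congrArg _ ?_
  exact (algebraMap_smul Scalars (1 / (n.factorial : ℂ)) (a ^ n)).symm

end expo

namespace MapFun

/-! ### Hyperbolic functions, logarithm and binomial series -/

instance : CharZero MapFun :=
  ⟨fun a b h => by
    rw [← c_natCast, ← c_natCast] at h
    exact_mod_cast c_injective h⟩

theorem c_two : c 2 = 2 := c_ofNat 2

@[simp] theorem dx_two : dx 2 = 0 := by rw [← c_two, dx_c]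

/-- `cosh (𝐡 x)`. -/
def ch : MapFun := c (1 / 2) * (expPow 1 + expPow (-1))

theorem c_half_mul_two : c (1 / 2) * 2 = 1 := by
  rw [← c_two, ← c_mul]
  norm_num

theorem two_ch : 2 * ch = expPow 1 + expPow (-1) := by
  rw [ch]
  linear_combination (expPow 1 + expPow (-1)) * c_half_mul_two

theorem two_hb_sinhDiv : 2 * hb * sinhDiv = expPow 1 - expPow (-1) := by
  ext1 n
  rw [mul_comm 2 hb, mul_assoc, ← c_two]
  cases n with
  | zero => simp [hb, expPow]
  | succ n =>
    rw [hb, PowerSeries.coeff_succ_X_mul, c, PowerSeries.coeff_C_mul, map_sub]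
    simp only [sinhDiv, expPow, PowerSeries.coeff_mk]
    rw [← sub_mul, ← map_sub]
    split_ifs with h
    · rw [← mul_assoc, ← map_mul]
      congr 2
      rw [h.add_one.neg_one_pow]
      ring
    · have h' := (Nat.not_even_iff_odd.1 h).add_one
      rw [h'.neg_one_pow]
      simp

theorem expPow_one_mul_neg : expPow 1 * expPow (-1) = 1 := by
  rw [← expPow_add, add_neg_cancel, expPow_zero]

theorem ch_sq : ch ^ 2 = 1 + hb ^ 2 * sinhDiv ^ 2 := by
  have h : 4 * ch ^ 2 = 4 * (1 + hb ^ 2 * sinhDiv ^ 2) := by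
    linear_combination (2 * ch + expPow 1 + expPow (-1)) * two_ch -
      (2 * hb * sinhDiv + expPow 1 - expPow (-1)) * two_hb_sinhDiv + 4 * expPow_one_mul_neg
  exact mul_left_cancel₀ (by norm_num) h

theorem expPow_one_eq : expPow 1 = ch + hb * sinhDiv := by
  have : 2 * expPow 1 = 2 * (ch + hb * sinhDiv) := by
    linear_combination -two_ch - two_hb_sinhDiv
  exact mul_left_cancel₀ (by norm_num) this

theorem expPow_neg_one_eq : expPow (-1) = ch - hb * sinhDiv := by
  linear_combination two_hb_sinhDiv + expPow_one_eq

theorem dx_sinhDiv : dx sinhDiv = ch := by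
  have h := congrArg dx two_hb_sinhDiv
  simp only [dx_mul, dx_sub, dx_expPow, dx_two, dx_hb, c_neg, c_one] at h
  have : 2 * hb * dx sinhDiv = 2 * hb * ch := by
    linear_combination h - hb * two_ch
  exact mul_left_cancel₀ (mul_ne_zero (by norm_num) hb_ne_zero) this

theorem dx_ch : dx ch = hb ^ 2 * sinhDiv := by
  have h := congrArg dx two_ch
  simp only [dx_mul, dx_add, dx_expPow, dx_two, c_neg, c_one] at h
  have : 2 * dx ch = 2 * (hb ^ 2 * sinhDiv) := by
    linear_combination h - hb * two_hb_sinhDiv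
  exact mul_left_cancel₀ (by norm_num) this

theorem limit_sinhDiv : limit sinhDiv = Polynomial.X := by
  simp [limit_eq_coeff, sinhDiv, -PowerSeries.coeff_zero_eq_constantCoeff]

theorem limit_ch : limit ch = 1 := by
  simp only [ch, limit_mul, limit_c, limit_add, limit_expPow]
  rw [← Polynomial.C_1, ← Polynomial.C_add, ← Polynomial.C_mul]
  norm_num

theorem atZero_sinhDiv : atZero sinhDiv = 0 := by
  ext n
  simp only [atZero, sinhDiv, PowerSeries.coeff_map, PowerSeries.coeff_mk]
  split_ifs <;> simp

/-- `(1 - 𝐓⁻²) / (2 𝐡)` as a function of `𝐗`. -/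
def oneSubDiv : MapFun := expPow (-1) * sinhDiv

theorem two_hb_oneSubDiv : 2 * hb * oneSubDiv = 1 - expPow (-2) := by
  have : expPow (-2) = expPow (-1) * expPow (-1) := by rw [← expPow_add]; norm_num
  rw [oneSubDiv, this]
  linear_combination expPow (-1) * two_hb_sinhDiv + expPow_one_mul_neg

theorem limit_oneSubDiv : limit oneSubDiv = Polynomial.X := by
  rw [oneSubDiv, limit_mul, limit_expPow, limit_sinhDiv, one_mul]

theorem dx_oneSubDiv : dx oneSubDiv = expPow (-2) := by
  have h := congrArg dx two_hb_oneSubDiv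
  simp only [dx_mul, dx_sub, dx_one, dx_expPow, dx_two, dx_hb, c_neg, c_two] at h
  have : 2 * hb * dx oneSubDiv = 2 * hb * expPow (-2) := by
    linear_combination h
  exact mul_left_cancel₀ (mul_ne_zero (by norm_num) hb_ne_zero) this

theorem atZero_oneSubDiv : atZero oneSubDiv = 0 := by
  rw [oneSubDiv, map_mul, atZero_sinhDiv, mul_zero]

/-- `-ln (1 - 2 𝐡 x) / (2 𝐡)`. -/
def logDiv : MapFun := (exists_compInv limit_oneSubDiv).choose

theorem evalAt_oneSubDiv_logDiv : evalAt oneSubDiv logDiv = x :=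
  (exists_compInv limit_oneSubDiv).choose_spec.2.1

theorem evalAt_logDiv_oneSubDiv : evalAt logDiv oneSubDiv = x :=
  (exists_compInv limit_oneSubDiv).choose_spec.2.2

/-- `arsinh (𝐡 x) / 𝐡`. -/
def arsinhDiv : MapFun := (exists_compInv limit_sinhDiv).choose

theorem evalAt_sinhDiv_arsinhDiv : evalAt sinhDiv arsinhDiv = x :=
  (exists_compInv limit_sinhDiv).choose_spec.2.1

theorem evalAt_arsinhDiv_sinhDiv : evalAt arsinhDiv sinhDiv = x :=
  (exists_compInv limit_sinhDiv).choose_spec.2.2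

theorem expo_logDiv_neg_two : expo (-2) logDiv = 1 - 2 * hb * x := by
  have h := congrArg (evalAt logDiv) two_hb_oneSubDiv
  simp only [map_mul, map_sub, map_one, evalAt_hb, evalAt_logDiv_oneSubDiv, map_ofNat,
    algebraMap_hbar] at h
  rw [expo]
  linear_combination h

theorem dx_logDiv : (1 - 2 * hb * x) * dx logDiv = 1 := by
  have h := congrArg dx evalAt_logDiv_oneSubDiv
  rwa [dx_evalAt, dx_oneSubDiv, evalAt_expPow, expo_logDiv_neg_two, dx_x] at h

/-- A function minus its value at 0 is a multiple of x, which the substitution turns into a multiple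
of g. -/
theorem atZero_evalAt_eq {g φ : MapFun} (hg : atZero g = 0) : atZero (evalAt g φ) = atZero φ := by
  obtain ⟨ψ, hψ⟩ := exists_eq_x_mul (φ := φ - algebraMap Scalars MapFun (atZero φ)) (by
    rw [map_sub, sub_eq_zero]
    ext n
    have : PowerSeries.coeff n (algebraMap Scalars MapFun (atZero φ)) =
      Polynomial.C (PowerSeries.coeff n (atZero φ)) := PowerSeries.coeff_map _ _ _
    rw [atZero, PowerSeries.coeff_map, PowerSeries.coeff_map, ← atZero, this]
    simp [atZero])
  have e (s : Scalars) : atZero (algebraMap Scalars MapFun s) = s := by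
    ext n
    have : PowerSeries.coeff n (algebraMap Scalars MapFun s) =
      Polynomial.C (PowerSeries.coeff n s) := PowerSeries.coeff_map _ _ _
    rw [atZero, PowerSeries.coeff_map, this]
    simp
  rw [sub_eq_iff_eq_add] at hψ
  rw [hψ, map_add, map_mul, evalAt_x, AlgHom.commutes, map_add, map_mul, hg, map_add, map_mul,
    atZero_x, e, zero_mul, zero_mul]

theorem atZero_logDiv : atZero logDiv = 0 := by
  rw [← atZero_evalAt_eq atZero_oneSubDiv (φ := logDiv), evalAt_oneSubDiv_logDiv, atZero_x]

/-- The binomial series `(1 - 2 𝐡 x) ^ r`. -/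
def bin (r : ℂ) : MapFun :=
  PowerSeries.mk fun n => Polynomial.C (binom r n * (-2) ^ n) * Polynomial.X ^ n

theorem binom_succ (r : ℂ) (n : ℕ) : (n + 1) * binom r (n + 1) = (r - n) * binom r n := by
  have := Nat.cast_add_one_ne_zero (R := ℂ) n
  have := Nat.cast_ne_zero (R := ℂ).2 n.factorial_ne_zero
  rw [binom, binom, prod_range_succ, Nat.factorial_succ]
  push_cast
  field_simp

/-- The recursion of the binomial coefficients in the form of a differential equation. -/
theorem dx_bin (r : ℂ) : (1 - 2 * hb * x) * dx (bin r) = -(2 * c r * hb * bin r) := by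
  ext1 n
  have e1 : (1 - 2 * hb * x) * dx (bin r) = dx (bin r) - hb * (c 2 * (x * dx (bin r))) := by
    rw [c_two]; ring
  have e2 : -(2 * c r * hb * bin r) = hb * (c (-2 * r) * bin r) := by
    rw [c_mul, c_neg, c_two]; ring
  rw [e1, e2, map_sub, hb]
  cases n with
  | zero => simp [dx, bin]
  | succ n =>
    simp only [PowerSeries.coeff_succ_X_mul, c, PowerSeries.coeff_C_mul, x]
    simp only [bin, dx, PowerSeries.coeff_mk, Polynomial.derivative_C_mul_X_pow,
      Nat.add_sub_cancel]
    have h := binom_succ r n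
    have e3 : (Polynomial.X : Polynomial ℂ) * (Polynomial.C (binom r n * (-2) ^ n * n) *
        Polynomial.X ^ (n - 1)) = Polynomial.C (binom r n * (-2) ^ n * n) * Polynomial.X ^ n := by
      cases n with
      | zero => simp
      | succ n => rw [Nat.add_sub_cancel, pow_succ']; ring
    rw [e3, ← mul_assoc, ← mul_assoc, ← map_mul, ← map_mul, ← sub_mul, ← map_sub]
    congr 2
    push_cast
    linear_combination (-2 : ℂ) ^ (n + 1) * h

theorem limit_bin (r : ℂ) : limit (bin r) = 1 := by
  simp [limit_eq_coeff, bin, binom, -PowerSeries.coeff_zero_eq_constantCoeff]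

theorem atZero_bin (r : ℂ) : atZero (bin r) = 1 := by
  ext n
  cases n <;> simp [atZero, bin, PowerSeries.coeff_one, binom]

/-- The substitution turns 1 − 2ħx into T⁻². The product of the left side with T^{2r} has derivative
zero and value 1 at x = 0. The exponent laws of the binomial series are then inherited from the
exponential. -/
theorem evalAt_oneSubDiv_bin (r : ℂ) : evalAt oneSubDiv (bin r) = expPow (-2 * r) := by
  have h1 : evalAt oneSubDiv (bin r) * expPow (2 * r) = 1 := by
    refine eq_of_dx_eq ?_ ?_
    · have h := congrArg (evalAt oneSubDiv) (dx_bin r)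
      simp only [map_mul, map_sub, map_one, evalAt_hb, evalAt_x, map_ofNat, algebraMap_hbar,
        map_neg, evalAt_c, ← c_eq_algebraMap, two_hb_oneSubDiv, sub_sub_cancel] at h
      rw [dx_one, dx_mul, dx_evalAt, dx_expPow, dx_oneSubDiv, c_mul, c_two]
      linear_combination expPow (2 * r) * h
    · rw [map_mul, atZero_evalAt_eq atZero_oneSubDiv, atZero_bin, atZero_expPow, map_one, one_mul]
  have h2 : expPow (2 * r) * expPow (-2 * r) = 1 := by
    rw [← expPow_add, ← expPow_zero]
    congr 1
    ring
  linear_combination expPow (-2 * r) * h1 - evalAt oneSubDiv (bin r) * h2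

theorem bin_eq_expo (r : ℂ) : bin r = expo (-2 * r) logDiv := by
  have h := congrArg (evalAt logDiv) (evalAt_oneSubDiv_bin r)
  rwa [evalAt_evalAt, evalAt_logDiv_oneSubDiv, evalAt_self, evalAt_expPow] at h

theorem bin_add (r s : ℂ) : bin (r + s) = bin r * bin s := by
  simp only [bin_eq_expo, mul_add, expo_add]

theorem bin_zero : bin 0 = 1 := by simp [bin_eq_expo]

theorem bin_one : bin 1 = 1 - 2 * hb * x := by
  rw [bin_eq_expo, mul_one, expo_logDiv_neg_two]

/-- At x = −z/2 the series (1 − 2ħx)^r becomes (1 + ħz)^r. Terms of index above N are divisible by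
ħ^(N+1), so the truncation in the definition of `onePlusPow` loses nothing. -/
theorem onePlusPow_hb_mul (r : ℂ) (z : MapFun) :
    onePlusPow r (hb * z) = evalAt (c (-1 / 2) * z) (bin r) := by
  ext1 N
  obtain ⟨w, hw⟩ := hasHSum_hsum
    (fun n => Polynomial.aeval (c (-1 / 2) * z) (PowerSeries.coeff n (bin r))) (N + 1)
  rw [evalAt_apply, ext_apply, hw]
  have hX (w : MapFun) (n : ℕ) : hbar ^ n • w = hb ^ n * w := by
    rw [Algebra.smul_def, map_pow, algebraMap_hbar]
  have h0 : PowerSeries.coeff N (hb ^ (N + 1) * w) = 0 := by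
    rw [hb, PowerSeries.coeff_X_pow_mul', if_neg (by omega)]
  rw [map_add, hX, h0, add_zero, onePlusPow, PowerSeries.coeff_mk, map_sum]
  refine sum_congr rfl fun n _ => ?_
  simp only [bin, PowerSeries.coeff_mk]
  rw [hX, map_mul (Polynomial.aeval _), map_pow (Polynomial.aeval _), Polynomial.aeval_C, Polynomial.aeval_X,
    ← c_eq_algebraMap, mul_pow, mul_pow, Polynomial.smul_eq_C_mul]
  have e : hb ^ n * (c (binom r n * (-2) ^ n) * (c (-1 / 2) ^ n * z ^ n)) =
      c (binom r n) * (hb ^ n * z ^ n) := by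
    have h3 : c ((-2) ^ n) * c (-1 / 2) ^ n = 1 := by
      rw [c, c, ← map_pow, ← map_pow, ← map_mul, ← map_mul, ← mul_pow]
      norm_num
    rw [c_mul]
    linear_combination hb ^ n * c (binom r n) * z ^ n * h3
  rw [e, c, PowerSeries.coeff_C_mul]

theorem mtm_eq_bin (r : ℂ) : mtm r = bin r := by
  have : -(c 2 * hb * x) = hb * (-2 * x) := by rw [c_two]; ring
  rw [mtm, this, onePlusPow_hb_mul, ← mul_assoc]
  have h : c (-1 / 2) * -2 = 1 := by
    rw [← c_two, ← c_neg, ← c_mul]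
    norm_num
  rw [h, one_mul, evalAt_self]

theorem root_sq (φ : MapFun) : root φ ^ 2 = 1 + hb ^ 2 * x ^ 2 * φ ^ 4 := by
  have e : hb ^ 2 * x ^ 2 * φ ^ 4 = hb * (hb * x ^ 2 * φ ^ 4) := by ring
  have hb2 : bin (1 / 2) ^ 2 = 1 - 2 * hb * x := by rw [sq, ← bin_add, add_halves, bin_one]
  rw [root, e, onePlusPow_hb_mul, ← map_pow, hb2]
  simp only [map_sub, map_mul, map_one, map_ofNat, evalAt_hb, evalAt_x, algebraMap_hbar]
  have h : 2 * c (-1 / 2) = -1 := by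
    rw [← c_two, ← c_mul, ← c_one, ← c_neg]
    norm_num
  linear_combination -(hb ^ 2 * x ^ 2 * φ ^ 4) * h

theorem limit_root (φ : MapFun) : limit (root φ) = 1 := by
  have e : hb ^ 2 * x ^ 2 * φ ^ 4 = hb * (hb * x ^ 2 * φ ^ 4) := by ring
  rw [root, e, onePlusPow_hb_mul, limit_evalAt, limit_bin, Polynomial.one_comp]

/-- Both sides satisfy (1 − 2ħx)ℓ' = −2ħ and vanish at x = 0. -/
theorem logOnePlus_eq : logOnePlus (-(c 2 * hb * x)) = -(2 * hb * logDiv) := by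
  have hy (n N : ℕ) : PowerSeries.coeff N ((-(c 2 * hb * x)) ^ n) =
      if N = n then Polynomial.C ((-2) ^ n) * Polynomial.X ^ n else 0 := by
    have e : (-(c 2 * hb * x)) ^ n = hb ^ n * PowerSeries.C (Polynomial.C ((-2) ^ n) *
        Polynomial.X ^ n) := by
      have e1 : (PowerSeries.C (Polynomial.C ((-2) ^ n) * Polynomial.X ^ n) : MapFun) =
          c (-2) ^ n * x ^ n := by simp [c, x]
      rw [e1, c_neg, ← mul_pow, ← mul_pow]
      congr 1
      ring
    rw [e, hb, PowerSeries.coeff_X_pow_mul']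
    by_cases h : N = n
    · simp [h]
    · rw [if_neg h]
      split_ifs with h'
      · rw [PowerSeries.coeff_C, if_neg (by omega)]
      · rfl
  have h1 (N : ℕ) : PowerSeries.coeff (N + 1) (logOnePlus (-(c 2 * hb * x))) =
      Polynomial.C (-2 * (2 ^ N / (N + 1)) : ℂ) * Polynomial.X ^ (N + 1) := by
    rw [logOnePlus, PowerSeries.coeff_mk, sum_eq_single (N + 1)]
    · rw [hy, if_pos rfl, Polynomial.smul_eq_C_mul, ← mul_assoc, ← map_mul]
      congr 2
      rw [neg_pow (2 : ℂ)]
      have : ((-1 : ℂ) ^ (N + 1)) * (-1) ^ (N + 1) = 1 := by rw [← mul_pow]; norm_num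
      push_cast
      rw [pow_succ (-1 : ℂ) (N + 1)]
      linear_combination (-(2 ^ (N + 1) / (N + 1)) : ℂ) * this
    · intro n _ hn
      rw [hy, if_neg (Ne.symm hn), smul_zero]
    · simp
  have h0 : PowerSeries.coeff 0 (logOnePlus (-(c 2 * hb * x))) = 0 := by
    rw [logOnePlus, PowerSeries.coeff_mk]
    simp
  generalize logOnePlus (-(c 2 * hb * x)) = ℓ at h0 h1 ⊢
  have hd : (1 - 2 * hb * x) * dx ℓ = -(2 * hb) := by
    have e1 : (1 - 2 * hb * x) * dx ℓ =
        dx ℓ -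
          hb * (c 2 * (x * dx ℓ)) := by
      rw [c_two]; ring
    have e2 : -(2 * hb) = hb * c (-2) := by rw [c_neg, c_two]; ring
    have hdx (n : ℕ) : PowerSeries.coeff n (dx ℓ) =
        Polynomial.derivative (PowerSeries.coeff n ℓ) := by
      rw [dx, PowerSeries.coeff_mk]
    have hdx' (n : ℕ) : PowerSeries.coeff (n + 1) (dx ℓ) =
        Polynomial.C (-2 * 2 ^ n : ℂ) * Polynomial.X ^ n := by
      have := Nat.cast_add_one_ne_zero (R := ℂ) n
      rw [hdx, h1, Polynomial.derivative_C_mul_X_pow, Nat.add_sub_cancel]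
      congr 2
      push_cast
      field_simp
    rw [e1, e2]
    ext1 n
    rw [map_sub, hb]
    cases n with
    | zero =>
      rw [PowerSeries.coeff_zero_X_mul, PowerSeries.coeff_zero_X_mul, hdx, h0]
      simp
    | succ n =>
      simp only [PowerSeries.coeff_succ_X_mul]
      rw [hdx', c, PowerSeries.coeff_C_mul, x, PowerSeries.coeff_C_mul, c]
      cases n with
      | zero => simp [-PowerSeries.coeff_zero_eq_constantCoeff, hdx, h0]
      | succ n =>
        rw [hdx', PowerSeries.coeff_C, if_neg (by omega), mul_left_comm (Polynomial.X),
          ← pow_succ', ← mul_assoc, ← map_mul, ← sub_mul, ← map_sub]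
        have : (-2 * 2 ^ (n + 1) - 2 * (-2 * 2 ^ n) : ℂ) = 0 := by ring
        rw [this, map_zero, zero_mul]
  refine eq_of_dx_eq ?_ ?_
  · have h2 : (1 - 2 * hb * x) * dx ℓ =
        (1 - 2 * hb * x) * dx (-(2 * hb * logDiv)) := by
      rw [hd, ← c_two]
      simp only [dx_neg, dx_mul, dx_c, dx_hb]
      rw [c_two]
      linear_combination 2 * hb * dx_logDiv
    refine mul_left_cancel₀ (ne_zero_of_limit ?_) h2
    simp
  · rw [map_neg, map_mul, atZero_logDiv, mul_zero, neg_zero]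
    ext n
    cases n with
    | zero => simp [atZero, h0]
    | succ n => simp [atZero, h1]

/-- The limit of ψ is constant, so ψ' is divisible by ħ and the shift of coefficients in `dT` is
exactly that division. -/
theorem hb_mul_dT {ψ : MapFun} (h : limit ψ = 1) : hb * expPow 1 * dT ψ = dx ψ := by
  have h1 : hb * (PowerSeries.mk fun n => PowerSeries.coeff (n + 1) (dx ψ)) = dx ψ := by
    ext1 n
    cases n with
    | zero =>
      rw [← limit_eq_coeff, ← limit_eq_coeff, limit_dx, h]
      simp
    | succ n => rw [hb, PowerSeries.coeff_succ_X_mul, PowerSeries.coeff_mk]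
  rw [dT]
  linear_combination h1 + hb * (PowerSeries.mk fun n => PowerSeries.coeff (n + 1) (dx ψ)) *
    expPow_one_mul_neg

end MapFun

open MapFun

/-! ### The classical superalgebra -/

section osp_hom

variable {A : Type} [Ring A] [Algebra Scalars A] [HComplete A] [Algebra ℂ A]
  [IsScalarTower ℂ Scalars A]

/-- The defining relations of `osp(1|2)` between the elements `h`, `e`, `f`. -/
structure OspTriple (h e f : A) : Prop where
  he : h * e - e * h = e
  hf : h * f - f * h = -f
  ef : e * f + f * e = -h

theorem OspTriple.bpf {h e f : A} (t : OspTriple h e f) : e ^ 2 * f - f * e ^ 2 = e := by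
  linear_combination (norm := noncomm_ring) e * t.ef - t.ef * e + t.he

/-- The images of the generators in an algebra that contains an `osp(1|2)`-triple. -/
def OspGen.image (h e f : A) : OspGen → A
  | .h => h
  | .e => e
  | .f => f
  | .bp => e ^ 2
  | .bm => -f ^ 2

/-- With b₊ = e² and b₋ = −f², every relation that involves b₊ or b₋ follows from the three brackets
of h, e and f. -/
theorem OspTriple.lift_eq_zero {h e f : A} (t : OspTriple h e f) {r : FreeAlgebra ℂ OspGen}
    (hr : r ∈ ospRel) : FreeAlgebra.lift ℂ (OspGen.image h e f) r = 0 := by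
  have h1 : h * e ^ 2 - e ^ 2 * h - 2 * e ^ 2 = 0 := by
    linear_combination (norm := noncomm_ring) t.he * e + e * t.he
  have h2 : h * f ^ 2 - f ^ 2 * h + 2 * f ^ 2 = 0 := by
    linear_combination (norm := noncomm_ring) t.hf * f + f * t.hf
  have h3 : e ^ 2 * f ^ 2 - f ^ 2 * e ^ 2 + h = 0 := by
    linear_combination (norm := noncomm_ring) t.bpf * f + f * t.bpf + t.ef
  have h4 : f ^ 2 * e - e * f ^ 2 + f = 0 := by
    linear_combination (norm := noncomm_ring) f * t.ef + t.hf - t.ef * f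
  simp only [ospRel, Set.mem_insert_iff, Set.mem_singleton_iff] at hr
  rcases hr with rfl | rfl | rfl | rfl | rfl | rfl | rfl | rfl | rfl | rfl <;>
  simp only [Ring.lie_def, map_add, map_sub, map_mul, map_smul, map_pow,
    FreeAlgebra.lift_ι_apply, OspGen.image, two_smul]
  · rw [t.he, sub_self]
  · rw [t.hf, neg_add_cancel]
  · rw [t.ef, neg_add_cancel]
  · rw [← h1, two_mul]
  · rw [← neg_eq_zero, ← h2, two_mul]
    noncomm_ring
  · rw [← neg_eq_zero, ← h3]
    noncomm_ring
  · rw [t.bpf, sub_self]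
  · rw [← neg_eq_zero, ← h4]
    noncomm_ring
  · rw [sub_self]
  · rw [neg_add_cancel]

theorem OspTriple.exists_hom {h e f : A} (t : OspTriple h e f) : ∃ F : U →ₐ[Scalars] A,
    F Jordanian.h = h ∧ F Jordanian.e = e ∧ F Jordanian.f = f := by
  have hg : ∀ r ∈ osp.rel, ext (FreeAlgebra.lift ℂ (OspGen.image h e f)) r = 0 := by
    rintro _ ⟨r, hr, rfl⟩
    exact (ext_C _ r).trans (t.lift_eq_zero hr)
  exact ⟨SuperPres.lift (P := osp) (OspGen.image h e f) hg,
    SuperPres.lift_gen (P := osp) _ hg OspGen.h, SuperPres.lift_gen (P := osp) _ hg OspGen.e,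
    SuperPres.lift_gen (P := osp) _ hg OspGen.f⟩

end osp_hom

/-- The map from the free algebra to `U`. -/
def ospFree : FreeAlgebra ℂ OspGen →ₐ[ℂ] U := osp.freeProj

theorem ospFree_eq_zero {r : FreeAlgebra ℂ OspGen} (hr : r ∈ ospRel) : ospFree r = 0 := by
  refine (osp.proj_C r).symm.trans ?_
  rw [SuperPres.proj_eq_zero_iff, closedIdeal, TwoSidedIdeal.mem_iInf]
  exact fun n => TwoSidedIdeal.subset_span (Or.inl ⟨r, hr, rfl⟩)

theorem ospFree_ι (x : OspGen) : ospFree (FreeAlgebra.ι ℂ x) = osp.gen x :=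
  FreeAlgebra.lift_ι_apply ..

theorem he_sub : h * e - e * h = e := by
  have := ospFree_eq_zero (r := ⁅FreeAlgebra.ι ℂ OspGen.h, FreeAlgebra.ι ℂ OspGen.e⁆ -
    FreeAlgebra.ι ℂ OspGen.e) (by simp [ospRel])
  rwa [Ring.lie_def, map_sub, map_sub, map_mul, map_mul, ospFree_ι, ospFree_ι,
    sub_eq_zero] at this

theorem hf_sub : h * f - f * h = -f := by
  have := ospFree_eq_zero (r := ⁅FreeAlgebra.ι ℂ OspGen.h, FreeAlgebra.ι ℂ OspGen.f⁆ +
    FreeAlgebra.ι ℂ OspGen.f) (by simp [ospRel])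
  rwa [Ring.lie_def, map_add, map_sub, map_mul, map_mul, ospFree_ι, ospFree_ι,
    add_eq_zero_iff_eq_neg] at this

theorem ef_add : e * f + f * e = -h := by
  have := ospFree_eq_zero (r := FreeAlgebra.ι ℂ OspGen.e * FreeAlgebra.ι ℂ OspGen.f +
    FreeAlgebra.ι ℂ OspGen.f * FreeAlgebra.ι ℂ OspGen.e + FreeAlgebra.ι ℂ OspGen.h)
    (by simp [ospRel])
  rwa [map_add, map_add, map_mul, map_mul, ospFree_ι, ospFree_ι, ospFree_ι,
    add_eq_zero_iff_eq_neg] at this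

theorem ospTriple : OspTriple h e f := ⟨he_sub, hf_sub, ef_add⟩

theorem e_sq : e ^ 2 = bp := by
  have := ospFree_eq_zero (r := FreeAlgebra.ι ℂ OspGen.bp - FreeAlgebra.ι ℂ OspGen.e ^ 2)
    (by simp [ospRel])
  rw [map_sub, map_pow, ospFree_ι, ospFree_ι, sub_eq_zero] at this
  exact this.symm

theorem f_sq : f ^ 2 = -bm := by
  have := ospFree_eq_zero (r := FreeAlgebra.ι ℂ OspGen.bm + FreeAlgebra.ι ℂ OspGen.f ^ 2)
    (by simp [ospRel])
  rw [map_add, map_pow, ospFree_ι, ospFree_ι, add_eq_zero_iff_eq_neg] at this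
  rw [f, ← neg_eq_iff_eq_neg, ← this]
  rfl

/-- The elements e and f generate: h = −{e, f}, b₊ = e² and b₋ = −f². -/
theorem osp_hom_ext {A : Type} [Ring A] [Algebra Scalars A] [HComplete A] [Algebra ℂ A]
    [IsScalarTower ℂ Scalars A] {F G : U →ₐ[Scalars] A} (he : F e = G e) (hf : F f = G f) :
    F = G := by
  refine SuperPres.hom_ext fun x => ?_
  cases x with
  | h =>
    have : h = -(e * f + f * e) := by rw [ef_add, neg_neg]
    change F h = G h
    rw [this]
    simp [he, hf]
  | e => exact he
  | f => exact hf
  | bp =>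
    change F bp = G bp
    rw [← e_sq, map_pow, map_pow, he]
  | bm =>
    change F bm = G bm
    have : bm = -f ^ 2 := by rw [f_sq, neg_neg]
    rw [this]
    simp [hf]

theorem ofBp_eq (φ : MapFun) : ofBp φ = evalAt bp φ := osp.fn_eq_evalAt _ φ

theorem ofBp_hb : ofBp hb = algebraMap Scalars U hbar := by rw [ofBp_eq, evalAt_hb]

theorem ofBp_x : ofBp x = bp := by rw [ofBp_eq, evalAt_x]

/-- Functions of `b₊` acting by left multiplication. -/
instance : Module MapFun U := Module.compHom U (osp.fn OspGen.bp)

theorem fn_smul (φ : MapFun) (u : U) : φ • u = ofBp φ * u := rfl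

instance : IsScalarTower MapFun U U := ⟨fun φ u v => mul_assoc (ofBp φ) u v⟩

theorem hbar_smul_U (u : U) : hbar • u = hb • u := by rw [fn_smul, ofBp_hb, Algebra.smul_def]

theorem complex_smul_U (r : ℂ) (u : U) : r • u = c r • u := by
  rw [fn_smul, ofBp_eq, evalAt_c, Algebra.smul_def]

theorem bp_mul (u : U) : bp * u = x • u := by rw [fn_smul, ofBp_x]

theorem bp_lie_e : bp * e = e * bp := by rw [← e_sq]; noncomm_ring

theorem bp_lie_f : bp * f = f * bp + e := by
  have := ospTriple.bpf
  rw [e_sq] at this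
  rw [← this]
  abel

theorem bp_lie_h : bp * h = h * bp - (2 : ℂ) • bp := by
  have := ospTriple.he
  rw [← e_sq, two_smul]
  linear_combination (norm := noncomm_ring) -(e * this) - this * e

theorem e_mul_smul (φ : MapFun) (u : U) : e * (φ • u) = φ • (e * u) := by
  rw [fn_smul, fn_smul, ofBp_eq, ← mul_assoc, ← (evalAt_commute bp_lie_e φ).eq, mul_assoc]

/-- From [h, b₊] = 2b₊: the commutator with h acts on functions of b₊ as 2x d/dx. -/
theorem h_mul_smul (φ : MapFun) (u : U) :
    h * (φ • u) = φ • (h * u) + (2 * x * dx φ) • u := by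
  have h1 : ⁅bp, h⁆ = -((2 : ℂ) • bp) := by rw [Ring.lie_def, bp_lie_h]; abel
  have h2 := evalAt_lie (a := bp) (z := h) (by
    rw [h1]; exact ((Commute.refl bp).smul_right _).neg_right) φ
  rw [h1, Ring.lie_def] at h2
  have h3 : h * evalAt bp φ = evalAt bp φ * h + (2 * x * dx φ) • 1 := by
    rw [fn_smul, ofBp_eq, map_mul, map_mul, evalAt_x, map_ofNat, mul_one, mul_assoc,
      ← (evalAt_commute (Commute.refl bp) (dx φ)).eq, eq_comm, ← sub_eq_zero,
      ← sub_eq_zero.2 h2, two_smul]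
    noncomm_ring
  rw [fn_smul, fn_smul, ofBp_eq, ← mul_assoc, h3, add_mul, smul_mul_assoc, one_mul, mul_assoc]

/-- From [b₊, f] = e, which commutes with b₊. -/
theorem f_mul_smul (φ : MapFun) (u : U) :
    f * (φ • u) = φ • (f * u) - dx φ • (e * u) := by
  have h1 : ⁅bp, f⁆ = e := by rw [Ring.lie_def, bp_lie_f]; abel
  have h2 := evalAt_lie (a := bp) (z := f) (by rw [h1]; exact bp_lie_e) φ
  rw [h1, Ring.lie_def] at h2
  rw [fn_smul, fn_smul, fn_smul, ofBp_eq, ofBp_eq, ← mul_assoc, ← mul_assoc, ← mul_assoc,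
    ← sub_mul, ← h2]
  congr 1
  abel

theorem h_mul_e : h * e = e * h + e := by rw [← sub_eq_iff_eq_add', he_sub]

theorem f_mul_e : f * e = -(e * f) - h := by rw [sub_eq_add_neg, ← ef_add]; abel

theorem f_mul_h : f * h = h * f + f := by
  have := hf_sub
  rw [sub_eq_iff_eq_add] at this
  rw [this]
  abel

theorem h_mul_e_mul (u : U) : h * (e * u) = e * (h * u) + e * u := by
  rw [← mul_assoc, h_mul_e, add_mul, mul_assoc]

theorem f_mul_e_mul (u : U) : f * (e * u) = -(e * (f * u)) - h * u := by
  rw [← mul_assoc, f_mul_e, sub_mul, neg_mul, mul_assoc]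

theorem f_mul_h_mul (u : U) : f * (h * u) = h * (f * u) + f * u := by
  rw [← mul_assoc, f_mul_h, add_mul, mul_assoc]

theorem e_mul_e : e * e = x • (1 : U) := by rw [← sq, e_sq, ← bp_mul, mul_one]

theorem e_mul_e_mul (u : U) : e * (e * u) = x • u := by
  rw [← mul_assoc, e_mul_e, smul_mul_assoc, one_mul]

/-! ### A module of lowest weight type -/

/-- The operator `e` on `u + y w`, `y ^ 2 = x`. -/
def vermaE : Module.End Scalars (MapFun × MapFun) where
  toFun v := (x * v.2, v.1)
  map_add' v w := by simp [mul_add]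
  map_smul' s v := by simp

/-- The operator `h` on `u + y w`, `y ^ 2 = x`. -/
def vermaH (r : ℂ) : Module.End Scalars (MapFun × MapFun) where
  toFun v := (2 * x * dxD v.1 + c r * v.1, 2 * x * dxD v.2 + v.2 + c r * v.2)
  map_add' v w := by
    ext1 <;> simp only [Prod.fst_add, Prod.snd_add, map_add] <;> ring
  map_smul' s v := by
    ext1 <;> simp only [Prod.smul_fst, Prod.smul_snd, Derivation.map_smul, mul_smul_comm, RingHom.id_apply,
      smul_add]

/-- The operator `f` on `u + y w`, `y ^ 2 = x`. -/
def vermaF (r : ℂ) : Module.End Scalars (MapFun × MapFun) where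
  toFun v := (-(x * dxD v.2 + c r * v.2), -dxD v.1)
  map_add' v w := by
    ext1 <;> simp only [Prod.fst_add, Prod.snd_add, map_add] <;> ring
  map_smul' s v := by
    ext1 <;> simp only [Prod.smul_fst, Prod.smul_snd, Derivation.map_smul, mul_smul_comm, RingHom.id_apply,
      smul_add, smul_neg]

/-- The vector (1, 0) is annihilated by f and has weight r. Repeated action of e on it gives the
powers of y. -/
theorem verma_triple (r : ℂ) : OspTriple (vermaH r) vermaE (vermaF r) where
  he := by
    refine LinearMap.ext fun v => ?_
    ext1 <;> simp [vermaH, vermaE, Module.End.mul_apply, dxD_apply] <;> ring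
  hf := by
    refine LinearMap.ext fun v => ?_
    ext1 <;> simp [vermaH, vermaF, Module.End.mul_apply, dxD_apply] <;> ring
  ef := by
    refine LinearMap.ext fun v => ?_
    ext1 <;> simp [vermaH, vermaF, vermaE, Module.End.mul_apply, dxD_apply] <;> ring

instance : Algebra ℕ MapFun := Semiring.toNatAlgebra

instance : Algebra ℤ MapFun := Ring.toIntAlgebra _

theorem MapFun.limit_two : limit 2 = 2 := by
  rw [← c_two, limit_c]
  rfl

theorem MapFun.dx_zero : dx 0 = 0 := map_zero dxD

/-! ### Endomorphisms of `U` given by mapping functions -/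

/-- The action on the module of lowest weight type. -/
theorem exists_verma (r : ℂ) : ∃ ρ : U →ₐ[Scalars] Module.End Scalars (MapFun × MapFun),
    (ρ h = vermaH r ∧ ρ e = vermaE ∧ ρ f = vermaF r) ∧ ∀ (φ : MapFun) (u : U) (v : MapFun × MapFun), ρ (φ • u) v = φ • ρ u v := by
  obtain ⟨ρ, hh, he, hf⟩ := (verma_triple r).exists_hom
  refine ⟨ρ, ⟨hh, he, hf⟩, fun φ u v => ?_⟩
  have h1 : ρ bp = Algebra.lsmul Scalars Scalars (MapFun × MapFun) x := by
    rw [← e_sq, map_pow, he]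
    refine LinearMap.ext fun v => ?_
    rw [sq, Module.End.mul_apply]
    rfl
  have h2 : ρ (ofBp φ) = Algebra.lsmul Scalars Scalars (MapFun × MapFun) φ := by
    rw [ofBp_eq, map_evalAt, h1, ← map_evalAt, evalAt_self]
  rw [fn_smul, map_mul, h2]
  rfl

/-- This replaces a Poincaré–Birkhoff–Witt theorem for the five elements that occur in the ansatz.
Functions of b₊ act on the lowest weight modules by multiplication, so the coefficients can be read
off from a few vectors. -/
theorem linearIndependent_U {A B C D G : MapFun}
    (h0 : A • (1 : U) + B • e + C • f + D • h + G • (e * h) = 0) :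
    A = 0 ∧ B = 0 ∧ C = 0 ∧ D = 0 ∧ G = 0 := by
  obtain ⟨ρ, ⟨hh, he, hf⟩, hρ⟩ := exists_verma 0
  obtain ⟨σ, ⟨kh, ke, kf⟩, hσ⟩ := exists_verma 1
  -- Lowest weight 0 on (1, 0) isolates A and B. Lowest weight 1 then gives D and G on (1, 0) and C
  -- on (0, 1).
  have e1 := DFunLike.congr_fun (congrArg ρ h0) ((1, 0) : MapFun × MapFun)
  have e2 := DFunLike.congr_fun (congrArg σ h0) ((1, 0) : MapFun × MapFun)
  have e3 := DFunLike.congr_fun (congrArg σ h0) ((0, 1) : MapFun × MapFun)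
  simp only [map_add, LinearMap.add_apply, hρ, map_one, map_mul, hh, he, hf, Module.End.mul_apply,
    Module.End.one_apply, map_zero, LinearMap.zero_apply] at e1
  simp only [map_add, LinearMap.add_apply, hσ, map_one, map_mul, kh, ke, kf, Module.End.mul_apply,
    Module.End.one_apply, map_zero, LinearMap.zero_apply] at e2 e3
  simp [Prod.ext_iff, vermaE, vermaF, vermaH] at e1 e2 e3
  obtain ⟨a1, a2⟩ := e1
  obtain ⟨b1, b2⟩ := e2
  obtain ⟨c1, c2⟩ := e3
  subst a1 a2
  simp at b1 b2
  subst b1 b2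
  simp at c1
  simp [c1]

/-- The equations satisfied by the functions of an endomorphism
`e ↦ α e`, `h ↦ β h`, `f ↦ γ f + p e + q e h`. -/
structure KSol (α β γ p q : MapFun) : Prop where
  eq_β : β * (α + 2 * x * dx α) = α
  eq_γ : α * γ = 1
  eq_p : p = 0
  eq_q : 2 * x * α * q = 1 - β

/-- An endomorphism of `U` given by mapping functions. -/
structure IsK (α β γ p q : MapFun) (k : U →ₐ[Scalars] U) : Prop where
  on_e : k e = α • e
  on_h : k h = β • h
  on_f : k f = γ • f + p • e + q • (e * h)

theorem limit_add_two_x_dx {α : MapFun} (hα : limit α = 1) :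
    limit (α + 2 * x * dx α) = 1 := by
  simp [hα]

theorem exists_kSol {α : MapFun} (hα : limit α = 1) : ∃ β γ p q, KSol α β γ p q := by
  obtain ⟨ι, hι⟩ := exists_inv' (limit_add_two_x_dx hα)
  obtain ⟨γ, hγ⟩ := exists_inv' hα
  -- With ι the inverse of α + 2xα', one has 1 − ια = 2xια', so q = ια'/α needs no division by x.
  refine ⟨ι * α, γ, 0, ι * dx α * γ, by linear_combination α * hι, by rw [mul_comm, hγ], rfl, ?_⟩
  linear_combination 2 * x * ι * dx α * hγ + hι

theorem KSol.limit_β {α β γ p q : MapFun} (s : KSol α β γ p q) (hα : limit α = 1) :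
    limit β = 1 := by
  have := congrArg limit s.eq_β
  rwa [limit_mul, limit_add_two_x_dx hα, mul_one, hα] at this

theorem KSol.unique {α β γ p q β' γ' p' q' : MapFun} (hα : limit α = 1) (s : KSol α β γ p q)
    (t : KSol α β' γ' p' q') : β = β' ∧ γ = γ' ∧ p = p' ∧ q = q' := by
  have h0 : α ≠ 0 := ne_zero_of_limit (by simp [hα])
  have h1 : β = β' := mul_right_cancel₀ (ne_zero_of_limit (by simp [limit_add_two_x_dx hα]))
    (s.eq_β.trans t.eq_β.symm)
  refine ⟨h1, mul_left_cancel₀ h0 (s.eq_γ.trans t.eq_γ.symm), s.eq_p.trans t.eq_p.symm,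
    mul_left_cancel₀ (mul_ne_zero (mul_ne_zero two_ne_zero x_ne_zero) h0)
      (s.eq_q.trans ((congrArg (1 - ·) h1).trans t.eq_q.symm))⟩

theorem kSol_one : KSol 1 1 1 0 0 := ⟨by simp, by simp, rfl, by simp⟩

/-! ### Brackets of the ansatz elements in normal order -/

section rules

theorem smul_he (α β : MapFun) :
    (β • h) * (α • e) - (α • e) * (β • h) = (β * (α + 2 * x * dx α)) • e := by
  simp only [smul_mul_assoc, h_mul_smul, e_mul_smul, h_mul_e]
  match_scalars <;> ring

theorem smul_ef (α γ p q : MapFun) :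
    (α • e) * (γ • f + p • e + q • (e * h)) + (γ • f + p • e + q • (e * h)) * (α • e) =
      (x * (2 * α * p - γ * dx α + q * (α + 2 * x * dx α))) • (1 : U) +
        (2 * x * α * q - α * γ) • h := by
  simp only [smul_mul_assoc, h_mul_smul, e_mul_smul, f_mul_smul, h_mul_e, f_mul_e, mul_add,
    add_mul, e_mul_e, e_mul_e_mul, mul_assoc]
  match_scalars <;> ring

theorem smul_hf (β γ p q : MapFun) :
    (β • h) * (γ • f + p • e + q • (e * h)) - (γ • f + p • e + q • (e * h)) * (β • h) =
      (β * (2 * x * dx γ - γ)) • f + (β * (p + 2 * x * dx p)) • e +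
        (β * q + 2 * x * β * dx q + γ * dx β - 2 * x * q * dx β) • (e * h) := by
  simp only [smul_mul_assoc, h_mul_smul, e_mul_smul, f_mul_smul, h_mul_e, f_mul_h, mul_add,
    add_mul, mul_assoc, h_mul_e_mul]
  match_scalars <;> ring

end rules

/-- The brackets in normal order involve γ' and q', which are found by differentiating αγ = 1 and
2xαq = 1 − β. Factors 2, x and α are cancelled because mapping functions form a domain. -/
theorem KSol.exists_isK {α β γ p q : MapFun} (s : KSol α β γ p q) :
    ∃ k, IsK α β γ p q k := by
  obtain ⟨hβ, hγ, rfl, hq⟩ := s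
  have hα : α ≠ 0 := left_ne_zero_of_mul_eq_one hγ
  have dγ : dx α * γ + α * dx γ = 0 := by
    have := congrArg dx hγ
    simp only [dx_mul, dx_one] at this
    linear_combination this
  have dq : 2 * α * q + 2 * x * dx α * q + 2 * x * α * dx q = -dx β := by
    have := congrArg dx hq
    simp only [dx_mul, dx_one, dx_sub, dx_x, dx_two] at this
    linear_combination this
  have t : OspTriple (β • h) (α • e) (γ • f + (0 : MapFun) • e + q • (e * h)) := by
    refine ⟨?_, ?_, ?_⟩
    · rw [smul_he, hβ]
    · rw [smul_hf]
      have h1 : β * (2 * x * dx γ - γ) = -γ := by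
        refine mul_left_cancel₀ hα ?_
        linear_combination 2 * x * β * dγ - γ * hβ
      have h2 : β * q + 2 * x * β * dx q + γ * dx β - 2 * x * q * dx β = -q := by
        refine mul_left_cancel₀ (mul_ne_zero (mul_ne_zero two_ne_zero x_ne_zero) hα) ?_
        linear_combination 2 * x * dx β * hγ + 2 * x * β * dq - 2 * x * q * hβ - 2 * x * dx β * hq
      rw [h1, h2, dx_zero]
      module
    · rw [smul_ef]
      have h1 : x * (2 * α * 0 - γ * dx α + q * (α + 2 * x * dx α)) = 0 := by
        refine mul_left_cancel₀ (mul_ne_zero two_ne_zero hα) ?_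
        linear_combination -(2 * x * dx α) * hγ + (α + 2 * x * dx α) * hq - hβ
      rw [h1, hγ, hq]
      simp
  obtain ⟨k, kh, ke, kf⟩ := t.exists_hom
  exact ⟨k, ke, kh, kf⟩

/-- At ħ = 0 the equation says that 2(n + 1) times the coefficient of x^n vanishes. So p is
divisible by ħ, and the quotient satisfies the same equation; iteration puts p in every ħ^n. -/
theorem eq_zero_of_homogeneous {β p : MapFun} (hβ : limit β = 1)
    (h : β * (p + 2 * x * dx p) = -p) : p = 0 := by
  have step (p : MapFun) (h : β * (p + 2 * x * dx p) = -p) :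
      ∃ p', p = hb * p' ∧ β * (p' + 2 * x * dx p') = -p' := by
    have h1 := congrArg limit h
    simp only [limit_mul, hβ, limit_add, limit_x, limit_neg, one_mul, limit_dx, limit_two] at h1
    have h2 : limit p = 0 := by
      ext n
      have h3 := congrArg (Polynomial.coeff · n) h1
      rw [mul_assoc, ← Polynomial.C_ofNat] at h3
      simp only [Polynomial.coeff_add, Polynomial.coeff_C_mul, Polynomial.coeff_neg] at h3
      cases n with
      | zero =>
        rw [Polynomial.coeff_X_mul_zero] at h3
        rw [Polynomial.coeff_zero]
        linear_combination h3 / 2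
      | succ n =>
        rw [Polynomial.coeff_X_mul, Polynomial.coeff_derivative] at h3
        rw [Polynomial.coeff_zero]
        have : (2 * (n + 2 : ℂ)) * Polynomial.coeff (limit p) (n + 1) = 0 := by
          linear_combination h3
        exact (mul_eq_zero.1 this).resolve_left (mul_ne_zero two_ne_zero (by norm_cast))
    obtain ⟨p', rfl⟩ := PowerSeries.X_dvd_iff.2 h2
    refine ⟨p', rfl, mul_left_cancel₀ hb_ne_zero ?_⟩
    change β * (hb * p' + 2 * x * dx (hb * p')) = -(hb * p') at h
    rw [dx_mul, dx_hb] at h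
    linear_combination h
  have key (n : ℕ) : ∃ p', p = hb ^ n * p' ∧ β * (p' + 2 * x * dx p') = -p' := by
    induction n with
    | zero => exact ⟨p, by simp, h⟩
    | succ n ih =>
      obtain ⟨p', rfl, h'⟩ := ih
      obtain ⟨p'', rfl, h''⟩ := step p' h'
      exact ⟨p'', by ring, h''⟩
  refine eq_of_forall_hbar fun n => ?_
  obtain ⟨p', hp, -⟩ := key n
  exact ⟨p', by rw [zero_add, Algebra.smul_def, map_pow, algebraMap_hbar, hp]⟩

/-- By `linearIndependent_U` the three brackets split into equations between coefficients. The
bracket of h and f serves only to show p = 0; the other two then yield the rest. -/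
theorem IsK.kSol {α β γ p q : MapFun} {k : U →ₐ[Scalars] U} (hk : IsK α β γ p q k)
    (hα : limit α = 1) : KSol α β γ p q := by
  have h1 := congrArg k he_sub
  have h2 := congrArg k hf_sub
  have h3 := congrArg k ef_add
  simp only [map_sub, map_add, map_neg, map_mul, hk.on_e, hk.on_f, hk.on_h] at h1 h2 h3
  rw [smul_he] at h1
  rw [smul_hf] at h2
  rw [smul_ef] at h3
  have i1 : β * (α + 2 * x * dx α) - α = 0 := (linearIndependent_U (A := 0) (C := 0) (D := 0) (G := 0)
    (by rw [sub_smul, h1]; simp)).2.1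
  have i2 := linearIndependent_U (A := 0) (B := β * (p + 2 * x * dx p) + p)
    (C := β * (2 * x * dx γ - γ) + γ)
    (D := 0) (G := β * q + 2 * x * β * dx q + γ * dx β - 2 * x * q * dx β + q)
    (by linear_combination (norm := module) h2)
  have i3 := linearIndependent_U (A := x * (2 * α * p - γ * dx α + q * (α + 2 * x * dx α)))
    (B := 0) (C := 0) (D := 2 * x * α * q - α * γ + β) (G := 0)
    (by linear_combination (norm := module) h3)
  have hβ : limit β = 1 := by
    have := congrArg limit (sub_eq_zero.1 i1)
    rwa [limit_mul, limit_add_two_x_dx hα, mul_one, hα] at this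
  have hα0 : α ≠ 0 := ne_zero_of_limit (by simp [hα])
  obtain rfl : p = 0 := eq_zero_of_homogeneous hβ (by linear_combination i2.2.1)
  have j1 := i3.2.2.2.1
  have j2 : -γ * dx α + q * (α + 2 * x * dx α) = 0 := by
    refine mul_left_cancel₀ x_ne_zero ?_
    linear_combination i3.1
  -- Elimination of q between the two components of {e, f}, using the equation for β.
  have j3 : α * γ = 1 := by
    refine mul_left_cancel₀ hα0 ?_
    linear_combination 2 * x * α * j2 + i1 - (α + 2 * x * dx α) * j1
  exact ⟨by linear_combination i1, j3, rfl, by linear_combination j1 + j3⟩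

/-- As b₊ = e², the endomorphism sends b₊ to b₊α(b₊)² and hence substitutes xα² in functions of b₊.
-/
theorem IsK.on_smul {α β γ p q : MapFun} {k : U →ₐ[Scalars] U} (hk : IsK α β γ p q k)
    (φ : MapFun) (u : U) : k (φ • u) = evalAt (x * α ^ 2) φ • k u := by
  have h1 : k bp = ofBp (x * α ^ 2) := by
    rw [← e_sq, map_pow, hk.on_e, sq, smul_mul_assoc, e_mul_smul, e_mul_e, smul_smul, smul_smul,
      fn_smul, mul_one]
    congr 1
    ring
  rw [fn_smul, fn_smul, map_mul, ofBp_eq, map_evalAt, h1, ofBp_eq, ofBp_eq, evalAt_evalAt]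

/-- Only the first function of the composite is recorded, because it determines the other four. -/
theorem IsK.comp {α β γ p q α' β' γ' p' q' : MapFun} {k k' : U →ₐ[Scalars] U}
    (hk : IsK α β γ p q k) (hk' : IsK α' β' γ' p' q' k') :
    ∃ β'' γ'' p'' q'', IsK (evalAt (x * α ^ 2) α' * α) β'' γ'' p'' q'' (k.comp k') := by
  let j : MapFun →ₐ[Scalars] MapFun := evalAt (x * α ^ 2)
  refine ⟨j β' * β, j γ' * γ, j γ' * p + j p' * α, j γ' * q + j q' * α * β, ?_, ?_, ?_⟩
  · rw [AlgHom.comp_apply, hk'.on_e, hk.on_smul, hk.on_e, smul_smul]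
  · rw [AlgHom.comp_apply, hk'.on_h, hk.on_smul, hk.on_h, smul_smul]
  · rw [AlgHom.comp_apply, hk'.on_f, map_add, map_add, hk.on_smul, hk.on_smul, hk.on_smul,
      map_mul, hk.on_e, hk.on_h, hk.on_f, smul_mul_assoc, e_mul_smul]
    change j γ' • _ + j p' • _ + j q' • _ = _
    module

theorem IsK.eq_id {β γ p q : MapFun} {k : U →ₐ[Scalars] U} (hk : IsK 1 β γ p q k) :
    k = AlgHom.id Scalars U := by
  obtain ⟨-, rfl, rfl, rfl⟩ := kSol_one.unique limit_one (hk.kSol limit_one)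
  exact osp_hom_ext (by simp [hk.on_e]) (by simp [hk.on_f])

theorem exists_evalAt_eq {α : MapFun} (hα : limit α = 1) (φ : MapFun) (hφ : limit φ = 1) :
    ∃ ψ, limit ψ = 1 ∧ evalAt (x * α ^ 2) ψ = φ := by
  obtain ⟨g, hg, hg1, hg2⟩ := exists_compInv (g := x * α ^ 2) (by simp [hα])
  refine ⟨evalAt g φ, ?_, ?_⟩
  · rw [limit_evalAt, hφ, Polynomial.one_comp]
  · rw [evalAt_evalAt, hg1, evalAt_self]

/-- The function α' is chosen so that the composite has first function 1. This is possible because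
the substitution of xα² is invertible. -/
theorem IsK.exists_rightInverse {α β γ p q : MapFun} {k : U →ₐ[Scalars] U}
    (hk : IsK α β γ p q k) (hα : limit α = 1) : ∃ α' β' γ' p' q' k', limit α' = 1 ∧
      IsK α' β' γ' p' q' k' ∧ k.comp k' = AlgHom.id Scalars U := by
  obtain ⟨ι, hι⟩ := exists_inv' hα
  obtain ⟨α', hα', h'⟩ := exists_evalAt_eq hα ι (limit_inv hα hι)
  obtain ⟨β', γ', p', q', s⟩ := exists_kSol hα'
  obtain ⟨k', hk'⟩ := s.exists_isK
  obtain ⟨β'', γ'', p'', q'', hk''⟩ := hk.comp hk'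
  rw [h', hι] at hk''
  exact ⟨α', β', γ', p', q', k', hα', hk', hk''.eq_id⟩

/-- The right inverse has a right inverse by the same construction, and the latter must be k. -/
theorem IsK.exists_inverse {α β γ p q : MapFun} {k : U →ₐ[Scalars] U}
    (hk : IsK α β γ p q k) (hα : limit α = 1) : ∃ α' β' γ' p' q' k', limit α' = 1 ∧
      IsK α' β' γ' p' q' k' ∧ k.comp k' = AlgHom.id Scalars U ∧ k'.comp k = AlgHom.id Scalars U := by
  obtain ⟨α', β', γ', p', q', k', hα', hk', h1⟩ := hk.exists_rightInverse hα
  obtain ⟨-, -, -, -, -, k'', -, -, h2⟩ := hk'.exists_rightInverse hα'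
  refine ⟨α', β', γ', p', q', k', hα', hk', h1, ?_⟩
  have : k = k'' := by
    rw [← AlgHom.comp_id k, ← h2, ← AlgHom.comp_assoc, h1, AlgHom.id_comp]
  rwa [← this] at h2

/-! ### Normal ordering in the Jordanian superalgebra -/

theorem MapFun.two_mul_c_half : 2 * c (1 / 2) = 1 := by
  rw [mul_comm, c_half_mul_two]

section

variable {A : Type} [Ring A] [Module MapFun A] [IsScalarTower MapFun A A]

/-- The functions of `X` act by left multiplication. -/
structure JRules (H E F : A) : Prop where
  E_smul (φ : MapFun) (u : A) : E * (φ • u) = φ • (E * u)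
  H_smul (φ : MapFun) (u : A) : H * (φ • u) = φ • (H * u) + (2 * sinhDiv * dx φ) • u
  F_smul (φ : MapFun) (u : A) : F * (φ • u) = φ • (F * u) - (dx φ * ch) • (E * u)
  EE : E * E = sinhDiv • (1 : A)
  HE : H * E = E * H + ch • E
  FE : F * E = -(E * F) - ch • H - (hb ^ 2 * sinhDiv ^ 2) • (1 : A)
  FH : F * H = H * F + ch • F + (hb ^ 2 * sinhDiv) • (E * H) + (hb ^ 2 * sinhDiv * ch) • E

/-- The generator `Y` in terms of the others. -/
def jY (H E F : A) : A := -(F * F) + (c (1 / 2) ^ 2 * hb ^ 2 * sinhDiv) • (H * H)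
  + (c (1 / 2) * hb ^ 2 * sinhDiv) • (E * F) + (3 * c (1 / 2) ^ 2 * hb ^ 2 * sinhDiv * ch) • H
  + (c (1 / 2) * hb ^ 2 * sinhDiv + 9 * c (1 / 2) ^ 4 * hb ^ 4 * sinhDiv ^ 3) • (1 : A)

namespace JRules

variable {H E F : A}

theorem EE_mul (r : JRules H E F) (u : A) : E * (E * u) = sinhDiv • u := by
  rw [← mul_assoc, r.EE, smul_mul_assoc, one_mul]

theorem HE_mul (r : JRules H E F) (u : A) : H * (E * u) = E * (H * u) + ch • (E * u) := by
  rw [← mul_assoc, r.HE, add_mul, mul_assoc, smul_mul_assoc]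

theorem FE_mul (r : JRules H E F) (u : A) :
    F * (E * u) = -(E * (F * u)) - ch • (H * u) - (hb ^ 2 * sinhDiv ^ 2) • u := by
  rw [← mul_assoc, r.FE, sub_mul, sub_mul, neg_mul, smul_mul_assoc, smul_mul_assoc, one_mul,
    mul_assoc]

theorem FH_mul (r : JRules H E F) (u : A) : F * (H * u) = H * (F * u) + ch • (F * u) +
    (hb ^ 2 * sinhDiv) • (E * (H * u)) + (hb ^ 2 * sinhDiv * ch) • (E * u) := by
  rw [← mul_assoc, r.FH, add_mul, add_mul, add_mul, smul_mul_assoc, smul_mul_assoc,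
    smul_mul_assoc, mul_assoc, mul_assoc]

end JRules

end

theorem MapFun.dx_three : dx 3 = 0 := by rw [← c_ofNat 3, dx_c]

theorem MapFun.dx_nine : dx 9 = 0 := by rw [← c_ofNat 9, dx_c]

theorem MapFun.c_one_div_four : c (1 / 4) = c (1 / 2) ^ 2 := by
  rw [sq, ← c_mul]
  norm_num

theorem MapFun.c_one_div_eight : c (1 / 8) = c (1 / 2) ^ 3 := by
  rw [pow_three, ← c_mul, ← c_mul]
  norm_num

theorem MapFun.c_three_div_eight : c (3 / 8) = 3 * c (1 / 2) ^ 3 := by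
  rw [← c_one_div_eight, ← c_ofNat 3, ← c_mul]
  norm_num

theorem MapFun.c_three_div_sixteen : c (3 / 16) = 3 * c (1 / 2) ^ 4 := by
  rw [pow_succ, ← c_one_div_eight, ← c_ofNat 3, ← c_mul, ← c_mul]
  norm_num

theorem MapFun.c_fifteen_div_sixtyfour : c (15 / 64) = 15 * c (1 / 2) ^ 6 := by
  rw [pow_mul _ 3 2, ← c_one_div_eight, ← c_ofNat 15, sq, ← c_mul, ← c_mul]
  norm_num

theorem MapFun.c_nine_div_onehundredtwentyeight : c (9 / 128) = 9 * c (1 / 2) ^ 7 := by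
  rw [pow_succ, pow_mul _ 3 2, ← c_one_div_eight, ← c_ofNat 9, sq, ← c_mul, ← c_mul, ← c_mul]
  norm_num

/-! ### Homomorphisms out of the Jordanian superalgebra -/

section

variable {A : Type} [Ring A] [Algebra Scalars A] [HComplete A] [Algebra ℂ A]
  [IsScalarTower ℂ Scalars A]

theorem ext_fn {R : Type} [Ring R] [Algebra ℂ R] (σ : R →ₐ[ℂ] A) (a : R) (φ : MapFun) :
    ext σ (PowerSeries.map (Polynomial.aeval (R := ℂ) a).toRingHom φ) = evalAt (σ a) φ := by
  have : σ.comp (Polynomial.aeval a) = Polynomial.aeval (σ a) :=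
    Polynomial.algHom_ext (by
      rw [AlgHom.comp_apply, Polynomial.aeval_X, Polynomial.aeval_X])
  rw [ext_map, evalAt_apply, this]

/-- The images of the generators. -/
def JGen.image (H E F X Y : A) : JGen → A
  | .H => H
  | .E => E
  | .F => F
  | .X => X
  | .Y => Y

theorem complex_smul_of {X : A} [Module MapFun A] (hX : ∀ (φ : MapFun) (u : A), φ • u = evalAt X φ * u)
    (r : ℂ) (u : A) : r • u = c r • u := by
  rw [hX, evalAt_c, Algebra.smul_def]

theorem evalAt_eq_smul_one {X : A} [Module MapFun A]
    (hX : ∀ (φ : MapFun) (u : A), φ • u = evalAt X φ * u) (φ : MapFun) :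
    evalAt X φ = φ • (1 : A) := by
  rw [hX, mul_one]

theorem ext_X_eq_smul_one {R : Type} [Ring R] [Algebra ℂ R] (σ : R →ₐ[ℂ] A) {X : A}
    [Module MapFun A] (hX : ∀ (φ : MapFun) (u : A), φ • u = evalAt X φ * u) :
    ext σ PowerSeries.X = hb • (1 : A) := by
  rw [← evalAt_eq_smul_one hX, evalAt_hb, ext_X]

-- Each of the fourteen relations is brought to normal order: a function of X, then E, H, F. The
-- coefficients agree because cosh² − sinh² = 1 and because `sinhDiv` and `ch` have the expected
-- derivatives. Relations with Y need no assumption of their own, as Y is replaced by `jY`.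
set_option maxHeartbeats 2000000 in
theorem JRules.lift_eq_zero {X : A} [Module MapFun A] [IsScalarTower MapFun A A]
    (hX : ∀ (φ : MapFun) (u : A), φ • u = evalAt X φ * u) {H E F : A} (r : JRules H E F)
    {a : PowerSeries (FreeAlgebra ℂ JGen)} (ha : a ∈ jordRel) :
    ext (FreeAlgebra.lift ℂ (JGen.image H E F X (jY H E F))) a = 0 := by
  have k1 := two_mul_c_half
  have k2 := ch_sq
  simp only [jordRel, Set.mem_insert_iff, Set.mem_singleton_iff] at ha
  rcases ha with rfl | rfl | rfl | rfl | rfl | rfl | rfl | rfl | rfl | rfl | rfl | rfl | rfl | rfl <;>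
  simp only [Ring.lie_def, map_add, map_sub, map_neg, map_mul, map_pow, map_one, ext_smul, ext_C,
    ext_X_eq_smul_one _ hX, ext_fn, FreeAlgebra.lift_ι_apply, JGen.image, evalAt_eq_smul_one hX,
    complex_smul_of hX, expPow_one_eq, expPow_neg_one_eq, c_one_div_four, c_one_div_eight,
    c_three_div_eight, c_three_div_sixteen, c_fifteen_div_sixtyfour,
    c_nine_div_onehundredtwentyeight, pow_succ, pow_zero] <;>
  simp only [jY, r.E_smul, r.H_smul, r.F_smul, r.EE, r.HE, r.FE, r.FH, r.EE_mul, r.HE_mul,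
    r.FE_mul, r.FH_mul, smul_mul_assoc, mul_assoc, mul_add, add_mul, mul_sub, sub_mul, mul_neg,
    neg_mul, one_mul, mul_one] <;>
  match_scalars <;>
  (try simp only [dx_add, dx_sub, dx_one, dx_mul, dx_pow, dx_hb, dx_sinhDiv, dx_ch, dx_c, dx_two, dx_three, dx_nine, dx_zero, mul_one, mul_zero]) <;>
  grind

theorem JRules.exists_hom {X : A} [Module MapFun A] [IsScalarTower MapFun A A]
    (hX : ∀ (φ : MapFun) (u : A), φ • u = evalAt X φ * u) {H E F : A} (r : JRules H E F) :
    ∃ m : Uh →ₐ[Scalars] A,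
      m Jordanian.H = H ∧ m Jordanian.E = E ∧ m Jordanian.F = F ∧ m Jordanian.X = X := by
  have hg : ∀ a ∈ jord.rel, ext (FreeAlgebra.lift ℂ (JGen.image H E F X (jY H E F))) a = 0 :=
    fun a ha => r.lift_eq_zero hX ha
  exact ⟨SuperPres.lift (P := jord) _ hg, SuperPres.lift_gen (P := jord) _ hg JGen.H,
    SuperPres.lift_gen (P := jord) _ hg JGen.E, SuperPres.lift_gen (P := jord) _ hg JGen.F,
    SuperPres.lift_gen (P := jord) _ hg JGen.X⟩

end

/-! ### The Jordanian superalgebra -/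

/-- The map from the free algebra to `Uh`. -/
def jordFree : FreeAlgebra ℂ JGen →ₐ[ℂ] Uh := jord.freeProj

theorem jordFree_ι (x : JGen) : jordFree (FreeAlgebra.ι ℂ x) = jord.gen x :=
  FreeAlgebra.lift_ι_apply ..

theorem jordFree_H : jordFree (FreeAlgebra.ι ℂ JGen.H) = H := jordFree_ι _

theorem jordFree_E : jordFree (FreeAlgebra.ι ℂ JGen.E) = E := jordFree_ι _

theorem jordFree_F : jordFree (FreeAlgebra.ι ℂ JGen.F) = F := jordFree_ι _

theorem jordFree_X : jordFree (FreeAlgebra.ι ℂ JGen.X) = X := jordFree_ι _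

theorem jordFree_Y : jordFree (FreeAlgebra.ι ℂ JGen.Y) = Y := jordFree_ι _

theorem ext_jordFree_eq_zero {a : PowerSeries (FreeAlgebra ℂ JGen)} (ha : a ∈ jordRel) :
    ext jordFree a = 0 := by
  refine (jord.proj_eq_ext a).symm.trans ?_
  exact (jord.proj_eq_zero_iff a).2
    ((TwoSidedIdeal.mem_iInf _).2 fun n => TwoSidedIdeal.subset_span (Or.inl ha))

/-- Functions of `X` acting by left multiplication. -/
instance : Module MapFun Uh := Module.compHom Uh (jord.fn JGen.X)

theorem ofT_eq (φ : MapFun) : ofT φ = evalAt X φ := jord.fn_eq_evalAt _ φ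

theorem ofT_smul (φ : MapFun) (u : Uh) : φ • u = ofT φ * u := rfl

theorem smul_Uh (φ : MapFun) (u : Uh) : φ • u = evalAt X φ * u := by rw [ofT_smul, ofT_eq]

instance : IsScalarTower MapFun Uh Uh := ⟨fun φ u v => mul_assoc (ofT φ) u v⟩

theorem complex_smul_Uh (r : ℂ) (u : Uh) : r • u = c r • u := complex_smul_of smul_Uh r u

theorem E_sq : E ^ 2 = evalAt X sinhDiv := by
  have := ext_jordFree_eq_zero (a := PowerSeries.C (FreeAlgebra.ι ℂ JGen.E) ^ 2 -
    PowerSeries.map (Polynomial.aeval (R := ℂ) (FreeAlgebra.ι ℂ JGen.X)).toRingHom sinhDiv)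
    (by simp [jordRel])
  rwa [map_sub, map_pow, ext_C, ext_fn, jordFree_E, jordFree_X, sub_eq_zero] at this

theorem H_mul_E_sub : H * E - E * H = ch • E := by
  have k1 := two_mul_c_half
  have := ext_jordFree_eq_zero (a := _) (by rw [jordRel]; exact Or.inl rfl)
  simp only [Ring.lie_def, map_add, map_sub, map_neg, map_mul, ext_smul, ext_C, ext_fn, jordFree_H, jordFree_E,
    jordFree_F, jordFree_X,
    evalAt_eq_smul_one smul_Uh, complex_smul_Uh, expPow_one_eq, expPow_neg_one_eq,
    sub_eq_zero, smul_mul_assoc, one_mul, add_mul, sub_mul] at this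
  refine this.trans ?_
  match_scalars
  grind

/-- No relation states this, but X = arsinh(ħE²)/ħ is a function of E². -/
theorem commute_X_E : Commute X E := by
  have h1 : X = evalAt (E ^ 2) arsinhDiv := by
    rw [E_sq, ← evalAt_evalAt, evalAt_sinhDiv_arsinhDiv, evalAt_x]
  rw [h1]
  exact evalAt_commute ((Commute.refl E).pow_left 2) _

theorem E_mul_smul_Uh (φ : MapFun) (u : Uh) : E * (φ • u) = φ • (E * u) := by
  rw [smul_Uh, smul_Uh, ← mul_assoc, ← (evalAt_commute commute_X_E φ).eq, mul_assoc]

/-- Commutators with X itself are not among the relations. They are derived from commutators with E²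
= sinh(ħX)/ħ by the chain rule, where the derivative of arsinh cancels the factor `ch`. -/
theorem X_lie {z w : Uh} (hw : Commute X w) (h : E ^ 2 * z - z * E ^ 2 = ch • w) :
    X * z - z * X = w := by
  have h1 : X = evalAt (E ^ 2) arsinhDiv := by
    rw [E_sq, ← evalAt_evalAt, evalAt_sinhDiv_arsinhDiv, evalAt_x]
  have h2 : ⁅E ^ 2, z⁆ = evalAt X ch * w := by rw [Ring.lie_def, h, smul_Uh]
  have h3 := evalAt_lie (a := E ^ 2) (z := z) (by
    rw [h2, E_sq]
    exact (evalAt_commute_evalAt (Commute.refl X) _ _).mul_right (evalAt_commute hw _)) arsinhDiv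
  have h4 := congrArg dx evalAt_sinhDiv_arsinhDiv
  rw [dx_evalAt, dx_sinhDiv, dx_x] at h4
  rw [← h1, h2, E_sq, ← evalAt_evalAt, ← mul_assoc, ← map_mul, h4, map_one, one_mul,
    Ring.lie_def] at h3
  exact h3

theorem evalAt_X_mul {z : Uh} {φ : MapFun} {w : Uh} (hw : Commute X w)
    (h : E ^ 2 * z - z * E ^ 2 = ch • w) : z * evalAt X φ = evalAt X φ * z - evalAt X (dx φ) * w := by
  have h1 := X_lie hw h
  have h2 := evalAt_lie (a := X) (z := z) (by rwa [Ring.lie_def, h1]) φ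
  rw [Ring.lie_def, Ring.lie_def, h1] at h2
  rw [← h2]
  abel

theorem H_mul_smul_Uh (φ : MapFun) (u : Uh) :
    H * (φ • u) = φ • (H * u) + (2 * sinhDiv * dx φ) • u := by
  have h1 : E ^ 2 * H - H * E ^ 2 = ch • ((-(2 * sinhDiv)) • (1 : Uh)) := by
    have h2 : E ^ 2 * H - H * E ^ 2 = -(E * (ch • E) + ch • E * E) := by
      rw [← H_mul_E_sub]
      noncomm_ring
    have h3 : E * E = sinhDiv • (1 : Uh) := by rw [← sq, E_sq, smul_Uh, mul_one]
    rw [h2, E_mul_smul_Uh, smul_mul_assoc, h3]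
    module
  have h2 := evalAt_X_mul (φ := φ) (z := H) (by
    rw [smul_Uh, mul_one]
    exact (evalAt_commute (Commute.refl X) _).symm) h1
  rw [smul_Uh, smul_Uh, ← mul_assoc, h2, sub_mul, mul_assoc, ← smul_Uh, mul_assoc, ← smul_Uh, smul_mul_assoc,
    one_mul]
  module

/-- The relation contains H(T + T⁻¹); moving the function of T to the left produces the term without
H. -/
theorem E_mul_F_add : E * F + F * E = -(ch • H) - (hb ^ 2 * sinhDiv ^ 2) • (1 : Uh) := by
  have k1 := two_mul_c_half
  have := ext_jordFree_eq_zero (a := _) (by rw [jordRel]; exact Or.inr (Or.inr (Or.inl rfl)))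
  simp only [map_add, map_sub, map_neg, map_mul, ext_smul, ext_C, ext_fn, jordFree_H, jordFree_E,
    jordFree_F, jordFree_X,
    evalAt_eq_smul_one smul_Uh, complex_smul_Uh, expPow_one_eq, expPow_neg_one_eq,
    sub_eq_zero, smul_mul_assoc, one_mul, add_mul, sub_mul, mul_sub, c_one_div_four, mul_add, H_mul_smul_Uh,
    mul_one] at this
  refine this.trans ?_
  match_scalars <;> (try simp only [dx_add, dx_sub, dx_mul, dx_ch, dx_hb, dx_sinhDiv]) <;> grind

theorem F_mul_smul_Uh (φ : MapFun) (u : Uh) :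
    F * (φ • u) = φ • (F * u) - (dx φ * ch) • (E * u) := by
  have h1 : E ^ 2 * F - F * E ^ 2 = ch • (ch • E) := by
    have h2 : E ^ 2 * F - F * E ^ 2 = E * (E * F + F * E) - (E * F + F * E) * E := by
      noncomm_ring
    have h3 : H * E = E * H + ch • E := by rw [← H_mul_E_sub]; abel
    rw [h2, E_mul_F_add, mul_sub, sub_mul, mul_neg, neg_mul, E_mul_smul_Uh, E_mul_smul_Uh,
      smul_mul_assoc, smul_mul_assoc, h3, mul_one, one_mul]
    module
  have h2 := evalAt_X_mul (φ := φ) (z := F) (by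
    rw [smul_Uh]
    exact (evalAt_commute (Commute.refl X) _).symm.mul_right commute_X_E) h1
  rw [smul_Uh, smul_Uh, ← mul_assoc, h2, sub_mul, mul_assoc, ← smul_Uh, ← smul_Uh, smul_mul_assoc,
    smul_mul_assoc, smul_smul]

/-- The converse of `JRules.lift_eq_zero`: the rules, together with the formula for Y, are an
equivalent form of the presentation. -/
theorem jRules : JRules H E F := by
  have h1 : E * E = sinhDiv • (1 : Uh) := by rw [← sq, E_sq, smul_Uh, mul_one]
  have h2 : H * E = E * H + ch • E := by rw [← H_mul_E_sub]; abel
  refine ⟨E_mul_smul_Uh, H_mul_smul_Uh, F_mul_smul_Uh, h1, h2, ?_, ?_⟩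
  · linear_combination (norm := module) E_mul_F_add
  · have k1 := two_mul_c_half
    have := ext_jordFree_eq_zero (a := _) (by rw [jordRel]; exact Or.inr (Or.inl rfl))
    simp only [Ring.lie_def, map_add, map_sub, map_neg, map_mul, ext_smul, ext_C, ext_fn,
      jordFree_H, jordFree_E, jordFree_F, jordFree_X, jordFree_Y, evalAt_eq_smul_one smul_Uh, complex_smul_Uh, expPow_one_eq, expPow_neg_one_eq,
      ext_X_eq_smul_one _ smul_Uh, smul_mul_assoc, one_mul, add_mul, sub_mul, c_one_div_four,
      c_one_div_eight, mul_add, mul_sub, H_mul_smul_Uh, F_mul_smul_Uh, E_mul_smul_Uh, mul_one, h2,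
      mul_assoc] at this
    have h3 := congrArg (-·) this
    simp only [neg_zero] at h3
    refine sub_eq_zero.1 (Eq.trans ?_ h3)
    match_scalars <;> (try simp only [dx_add, dx_sub, dx_mul, dx_ch, dx_hb, dx_sinhDiv]) <;> grind

theorem Y_eq : Y = jY H E F := by
  have k1 := two_mul_c_half
  have := ext_jordFree_eq_zero (a := _) (by
    rw [jordRel]
    iterate 12 apply Or.inr
    exact Or.inl rfl)
  simp only [map_add, map_sub, map_neg, map_mul, map_pow, ext_smul, ext_C, ext_fn, sq, pow_three,
    jordFree_H, jordFree_E, jordFree_F, jordFree_X, jordFree_Y, evalAt_eq_smul_one smul_Uh, complex_smul_Uh, expPow_one_eq, expPow_neg_one_eq,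
    ext_X_eq_smul_one _ smul_Uh, smul_mul_assoc, one_mul, add_mul, sub_mul, c_one_div_four, c_one_div_eight,
    c_three_div_sixteen, c_nine_div_onehundredtwentyeight, mul_assoc] at this
  refine sub_eq_zero.1 (Eq.trans ?_ this)
  simp only [jY]
  match_scalars <;> grind

theorem X_eq : X = evalAt (E ^ 2) arsinhDiv := by
  rw [E_sq, ← evalAt_evalAt, evalAt_sinhDiv_arsinhDiv, evalAt_x]

/-- X is a function of E², and Y is a polynomial in H, E, F over functions of X, so three generators
suffice. -/
theorem jord_hom_ext {A : Type} [Ring A] [Algebra Scalars A] [HComplete A] [Algebra ℂ A]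
    [IsScalarTower ℂ Scalars A] {P Q : Uh →ₐ[Scalars] A} (hH : P H = Q H) (hE : P E = Q E)
    (hF : P F = Q F) : P = Q := by
  have hX : P X = Q X := by
    rw [X_eq, map_evalAt, map_evalAt, map_pow, map_pow, hE]
  have hs (φ : MapFun) {u : Uh} (hu : P u = Q u) : P (φ • u) = Q (φ • u) := by
    rw [smul_Uh, map_mul, map_mul, map_evalAt, map_evalAt, hX, hu]
  have hm {u v : Uh} (hu : P u = Q u) (hv : P v = Q v) : P (u * v) = Q (u * v) := by
    rw [map_mul, map_mul, hu, hv]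
  refine SuperPres.hom_ext fun x => ?_
  cases x with
  | H => exact hH
  | E => exact hE
  | F => exact hF
  | X => exact hX
  | Y =>
    change P Y = Q Y
    rw [Y_eq, jY]
    simp only [map_add, map_neg, hs _ (hm hH hH), hs _ (hm hE hF), hs _ hH,
      hs _ ((map_one P).trans (map_one Q).symm), hm hF hF]

/-! ### The minimal twist map -/

namespace MapFun

theorem bin_quarter_mul : bin (1 / 4) * bin (-1 / 4) = 1 := by
  rw [← bin_add, ← bin_zero]
  norm_num

theorem bin_quarter_pow : bin (1 / 4) ^ 4 = 1 - 2 * hb * x := by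
  rw [← bin_one, pow_succ, pow_succ, sq, ← bin_add, ← bin_add, ← bin_add]
  norm_num

theorem bin_half : bin (1 / 2) = bin (1 / 4) ^ 2 := by
  rw [sq, ← bin_add]
  norm_num

theorem bin_neg_half : bin (-1 / 2) = bin (-1 / 4) ^ 2 := by
  rw [sq, ← bin_add]
  norm_num

theorem bin_neg_three_quarters : bin (-3 / 4) = bin (-1 / 4) ^ 3 := by
  rw [pow_three, ← bin_add, ← bin_add]
  norm_num

theorem c_neg_one_div_four : c (-1 / 4) = -c (1 / 2) ^ 2 := by
  rw [neg_div, c_neg, c_one_div_four]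

theorem dx_bin_quarter : dx (bin (1 / 4)) = -(c (1 / 2) * hb * bin (-1 / 4) ^ 3) := by
  have h1 := bin_quarter_mul
  have h2 := bin_quarter_pow
  have h3 := dx_bin (1 / 4)
  have h4 := two_mul_c_half
  rw [c_one_div_four, ← h2] at h3
  grind

theorem dx_bin_neg_quarter : dx (bin (-1 / 4)) = c (1 / 2) * hb * bin (-1 / 4) ^ 5 := by
  have h1 := bin_quarter_mul
  have h2 := bin_quarter_pow
  have h3 := dx_bin (-1 / 4)
  have h4 := two_mul_c_half
  rw [c_neg_one_div_four, ← h2] at h3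
  grind

theorem dx_logDiv_eq : dx logDiv = bin (-1 / 4) ^ 4 := by
  have h1 := bin_quarter_mul
  have h2 := bin_quarter_pow
  have h3 := dx_logDiv
  rw [← h2] at h3
  grind

/-- Under the twist map X becomes L(b₊) with L = `logDiv`, so T^r becomes (1 − 2ħb₊)^{−r/2}. -/
theorem evalAt_logDiv_expPow (r : ℂ) : evalAt logDiv (expPow r) = bin (-r / 2) := by
  rw [bin_eq_expo, evalAt_expPow]
  congr 1
  ring

theorem evalAt_logDiv_sinhDiv : evalAt logDiv sinhDiv = bin (-1 / 4) ^ 2 * x := by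
  have h : sinhDiv = expPow 1 * oneSubDiv := by
    rw [oneSubDiv, ← mul_assoc, expPow_one_mul_neg, one_mul]
  rw [h, map_mul, evalAt_logDiv_expPow, evalAt_logDiv_oneSubDiv, bin_neg_half]

theorem evalAt_logDiv_ch :
    evalAt logDiv ch = c (1 / 2) * (bin (-1 / 4) ^ 2 + bin (1 / 4) ^ 2) := by
  have h : evalAt logDiv (c (1 / 2)) = c (1 / 2) := by rw [evalAt_c, c_eq_algebraMap]
  rw [ch, map_mul, map_add, h, evalAt_logDiv_expPow, evalAt_logDiv_expPow, neg_neg, bin_half,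
    bin_neg_half]

end MapFun

/-- The image of `H` under the minimal twist map. -/
def twistH : U := bin (1 / 4) ^ 2 • h

/-- The image of `E` under the minimal twist map. -/
def twistE : U := bin (-1 / 4) • e

/-- The image of `F` under the minimal twist map. -/
def twistF : U := bin (1 / 4) • f - (c (1 / 2) ^ 2 * hb ^ 2 * x * bin (-1 / 4) ^ 3) • e
  + (c (1 / 2) * hb * bin (1 / 4)) • (e * h)

theorem twistE_smul (φ : MapFun) (u : U) : twistE * (φ • u) = φ • (twistE * u) := by
  simp only [twistE, smul_mul_assoc, e_mul_smul]
  match_scalars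
  ring

theorem twistH_smul (φ : MapFun) (u : U) : twistH * (evalAt logDiv φ • u) =
    evalAt logDiv φ • (twistH * u) + evalAt logDiv (2 * sinhDiv * dx φ) • u := by
  have k2 := bin_quarter_mul
  simp only [twistH, smul_mul_assoc, h_mul_smul, dx_evalAt, dx_logDiv_eq, map_mul, map_ofNat,
    evalAt_logDiv_sinhDiv]
  match_scalars <;> grind

theorem twistF_smul (φ : MapFun) (u : U) : twistF * (evalAt logDiv φ • u) =
    evalAt logDiv φ • (twistF * u) - evalAt logDiv (dx φ * ch) • (twistE * u) := by
  have k1 := two_mul_c_half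
  have k2 := bin_quarter_mul
  have k3 := bin_quarter_pow
  simp only [twistF, twistE, smul_mul_assoc, h_mul_smul, e_mul_smul, f_mul_smul, dx_evalAt,
    dx_logDiv_eq, map_mul, evalAt_logDiv_ch, add_mul, sub_mul, mul_add, mul_sub, mul_assoc]
  match_scalars <;> grind

theorem twistE_twistE : twistE * twistE = evalAt logDiv sinhDiv • (1 : U) := by
  simp only [twistE, smul_mul_assoc, e_mul_smul, e_mul_e, evalAt_logDiv_sinhDiv]
  match_scalars
  ring

theorem twistH_twistE : twistH * twistE = twistE * twistH + evalAt logDiv ch • twistE := by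
  have k1 := two_mul_c_half
  have k2 := bin_quarter_mul
  have k3 := bin_quarter_pow
  simp only [twistH, twistE, smul_mul_assoc, e_mul_smul, h_mul_smul, h_mul_e, evalAt_logDiv_ch,
    dx_bin_neg_quarter]
  match_scalars <;> grind

theorem twistF_twistE : twistF * twistE = -(twistE * twistF) - evalAt logDiv ch • twistH
    - evalAt logDiv (hb ^ 2 * sinhDiv ^ 2) • (1 : U) := by
  have k1 := two_mul_c_half
  have k2 := bin_quarter_mul
  have k3 := bin_quarter_pow
  have hb' : evalAt logDiv hb = hb := by rw [evalAt_hb, algebraMap_hbar]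
  simp only [twistH, twistE, twistF, smul_mul_assoc, e_mul_smul, h_mul_smul, f_mul_smul, h_mul_e,
    f_mul_e, evalAt_logDiv_ch, map_mul, map_pow, hb', evalAt_logDiv_sinhDiv, mul_add, mul_sub,
    add_mul, sub_mul, mul_assoc, e_mul_e, e_mul_e_mul, h_mul_e_mul, dx_bin_neg_quarter]
  match_scalars <;> grind

theorem twistF_twistH : twistF * twistH = twistH * twistF + evalAt logDiv ch • twistF
    + evalAt logDiv (hb ^ 2 * sinhDiv) • (twistE * twistH)
    + evalAt logDiv (hb ^ 2 * sinhDiv * ch) • twistE := by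
  have k1 := two_mul_c_half
  have k2 := bin_quarter_mul
  have k3 := bin_quarter_pow
  have hb' : evalAt logDiv hb = hb := by rw [evalAt_hb, algebraMap_hbar]
  simp only [twistH, twistE, twistF, smul_mul_assoc, e_mul_smul, h_mul_smul, f_mul_smul, h_mul_e,
    f_mul_e, f_mul_h, evalAt_logDiv_ch, map_mul, map_pow, hb', evalAt_logDiv_sinhDiv, mul_add,
    mul_sub, add_mul, sub_mul, mul_assoc, e_mul_e, e_mul_e_mul, h_mul_e_mul, dx_bin_neg_quarter,
    dx_bin_quarter, dx_mul, dx_pow, dx_c, dx_hb, dx_x]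
  match_scalars <;> grind

/-- The functions of `X` act on `U` through the substitution of a function of `b₊`. -/
abbrev substModule (g : MapFun) : Module MapFun U := Module.compHom U (evalAt g).toRingHom

/-- The rules are required for the action in which φ(X) multiplies by φ(L(b₊)), not by φ(b₊); hence
the module structure is passed explicitly. -/
theorem twist_jRules : @JRules U _ (substModule logDiv) twistH twistE twistF :=
  @JRules.mk U _ (substModule logDiv) _ _ _ (fun φ u => twistE_smul (evalAt logDiv φ) u)
    twistH_smul twistF_smul twistE_twistE twistH_twistE twistF_twistE twistF_twistH

theorem exists_twist : ∃ m : Uh →ₐ[Scalars] U, m H = twistH ∧ m E = twistE ∧ m F = twistF ∧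
    ∀ (φ : MapFun) (u : Uh), m (φ • u) = evalAt logDiv φ • m u := by
  have k (φ : MapFun) (u : U) : evalAt logDiv φ • u = evalAt (evalAt bp logDiv) φ * u := by
    rw [fn_smul, ofBp_eq, evalAt_evalAt]
  have t : @IsScalarTower MapFun U U (substModule logDiv).toSMul _ (substModule logDiv).toSMul :=
    @IsScalarTower.mk _ _ _ (_) (_) (_) fun φ u v => mul_assoc (ofBp (evalAt logDiv φ)) u v
  obtain ⟨m, hH, hE, hF, hX⟩ := @JRules.exists_hom U _ _ _ _ _ (evalAt bp logDiv)
    (substModule logDiv) t k _ _ _ twist_jRules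
  refine ⟨m, hH, hE, hF, fun φ u => ?_⟩
  rw [smul_Uh, map_mul, map_evalAt, hX, k]

namespace MapFun

theorem expPow_half_mul : expPow (1 / 2) * expPow (-1 / 2) = 1 := by
  rw [← expPow_add, ← expPow_zero]
  norm_num

theorem expPow_one_eq_sq : expPow 1 = expPow (1 / 2) ^ 2 := by
  rw [sq, ← expPow_add]
  norm_num

theorem expPow_neg_one_eq_sq : expPow (-1) = expPow (-1 / 2) ^ 2 := by
  rw [sq, ← expPow_add]
  norm_num

end MapFun

/-- Normal ordering with `jRules` turns the brackets into identities between functions of X, which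
are polynomial once hyperbolic functions are related to T^{1/2} and T^{−1/2}. -/
theorem inverseTwist_triple : OspTriple (expPow (1 / 2) ^ 2 • H) (expPow (-1 / 2) • E)
    (expPow (1 / 2) • F + (c (1 / 2) ^ 3 * hb * expPow (1 / 2) *
      (expPow (1 / 2) ^ 2 - expPow (-1 / 2) ^ 2)) • E
      - (c (1 / 2) * hb * expPow (1 / 2)) • (E * H)) := by
  have k1 := two_mul_c_half
  have k2 := expPow_half_mul
  have k3 := two_ch
  have k4 := two_hb_sinhDiv
  rw [expPow_one_eq_sq, expPow_neg_one_eq_sq] at k3 k4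
  have r := jRules
  have d1 : dx (expPow (1 / 2)) = c (1 / 2) * hb * expPow (1 / 2) := dx_expPow _
  have d2 : dx (expPow (-1 / 2)) = -c (1 / 2) * hb * expPow (-1 / 2) := by
    rw [dx_expPow, neg_div, c_neg]
  refine ⟨?_, ?_, ?_⟩ <;>
  simp only [r.E_smul, r.H_smul, r.F_smul, r.EE, r.HE, r.FE, r.FH, r.EE_mul, r.HE_mul,
    r.FE_mul, r.FH_mul, smul_mul_assoc, mul_assoc, mul_add, add_mul, mul_sub, sub_mul, mul_neg,
    neg_mul, one_mul, mul_one] <;>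
  match_scalars <;>
  (try simp only [dx_add, dx_sub, dx_mul, dx_pow, dx_hb, dx_c, d1, d2]) <;>
  grind

/-- The minimal twist map. -/
def twist : Uh →ₐ[Scalars] U := exists_twist.choose

theorem twist_H : twist H = twistH := exists_twist.choose_spec.1

theorem twist_E : twist E = twistE := exists_twist.choose_spec.2.1

theorem twist_F : twist F = twistF := exists_twist.choose_spec.2.2.1

theorem twist_smul (φ : MapFun) (u : Uh) : twist (φ • u) = evalAt logDiv φ • twist u :=
  exists_twist.choose_spec.2.2.2 φ u

/-- The inverse of the minimal twist map. -/
def untwist : U →ₐ[Scalars] Uh := inverseTwist_triple.exists_hom.choose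

theorem untwist_h : untwist h = expPow (1 / 2) ^ 2 • H :=
  inverseTwist_triple.exists_hom.choose_spec.1

theorem untwist_e : untwist e = expPow (-1 / 2) • E :=
  inverseTwist_triple.exists_hom.choose_spec.2.1

theorem untwist_f : untwist f = expPow (1 / 2) • F + (c (1 / 2) ^ 3 * hb * expPow (1 / 2) *
      (expPow (1 / 2) ^ 2 - expPow (-1 / 2) ^ 2)) • E
      - (c (1 / 2) * hb * expPow (1 / 2)) • (E * H) :=
  inverseTwist_triple.exists_hom.choose_spec.2.2

theorem untwist_bp : untwist bp = ofT oneSubDiv := by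
  have h : expPow (-1 / 2) * expPow (-1 / 2) * sinhDiv = oneSubDiv := by
    rw [oneSubDiv, expPow_neg_one_eq_sq, sq]
  rw [← e_sq, map_pow, untwist_e, sq, smul_mul_assoc, jRules.E_smul, jRules.EE, smul_smul,
    smul_smul, h, ofT_smul, mul_one]

theorem untwist_smul (φ : MapFun) (u : U) : untwist (φ • u) = evalAt oneSubDiv φ • untwist u := by
  rw [fn_smul, map_mul, ofBp_eq, map_evalAt, untwist_bp, ofT_eq, ← evalAt_evalAt, smul_Uh]

theorem MapFun.evalAt_logDiv_half : evalAt logDiv (expPow (1 / 2)) = bin (-1 / 4) := by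
  rw [evalAt_logDiv_expPow]
  norm_num

theorem MapFun.evalAt_logDiv_neg_half : evalAt logDiv (expPow (-1 / 2)) = bin (1 / 4) := by
  rw [evalAt_logDiv_expPow]
  norm_num

theorem MapFun.evalAt_oneSubDiv_quarter : evalAt oneSubDiv (bin (1 / 4)) = expPow (-1 / 2) := by
  rw [evalAt_oneSubDiv_bin]
  norm_num

theorem MapFun.evalAt_oneSubDiv_neg_quarter :
    evalAt oneSubDiv (bin (-1 / 4)) = expPow (1 / 2) := by
  rw [evalAt_oneSubDiv_bin]
  norm_num

theorem MapFun.evalAt_MapFun_hb (g : MapFun) : evalAt g hb = hb := by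
  rw [evalAt_hb, algebraMap_hbar]

theorem MapFun.evalAt_MapFun_c (g : MapFun) (r : ℂ) : evalAt g (c r) = c r := by
  rw [evalAt_c, c_eq_algebraMap]

theorem twist_untwist : twist.comp untwist = AlgHom.id Scalars U := by
  have k1 := two_mul_c_half
  have k2 := bin_quarter_mul
  have k3 := bin_quarter_pow
  refine osp_hom_ext ?_ ?_
  · rw [AlgHom.comp_apply, untwist_e, twist_smul, twist_E, evalAt_logDiv_neg_half, twistE,
      smul_smul, k2, one_smul, AlgHom.id_apply]
  · rw [AlgHom.comp_apply, untwist_f, map_sub, map_add, twist_smul, twist_smul, twist_smul, map_mul twist,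
      twist_H, twist_E, twist_F, AlgHom.id_apply]
    simp only [map_mul, map_sub, map_pow, evalAt_MapFun_hb, evalAt_MapFun_c, evalAt_logDiv_half,
      evalAt_logDiv_neg_half, twistE, twistF, twistH, smul_mul_assoc, e_mul_smul]
    match_scalars <;> grind

theorem untwist_twist : untwist.comp twist = AlgHom.id Scalars Uh := by
  have k1 := two_mul_c_half
  have k2 := expPow_half_mul
  have k4 := two_hb_sinhDiv
  have k5 : oneSubDiv = expPow (-1 / 2) ^ 2 * sinhDiv := by rw [oneSubDiv, expPow_neg_one_eq_sq]
  rw [expPow_one_eq_sq, expPow_neg_one_eq_sq] at k4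
  refine jord_hom_ext ?_ ?_ ?_
  · rw [AlgHom.comp_apply, twist_H, twistH, untwist_smul, untwist_h, smul_smul, map_pow,
      evalAt_oneSubDiv_quarter, ← mul_pow, mul_comm, k2, one_pow, one_smul, AlgHom.id_apply]
  · rw [AlgHom.comp_apply, twist_E, twistE, untwist_smul, untwist_e, smul_smul,
      evalAt_oneSubDiv_neg_quarter, k2, one_smul, AlgHom.id_apply]
  · rw [AlgHom.comp_apply, twist_F, twistF, map_add, map_sub, untwist_smul, untwist_smul,
      untwist_smul, map_mul untwist, untwist_e, untwist_f, untwist_h, AlgHom.id_apply]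
    simp only [map_mul, map_sub, map_pow, evalAt_MapFun_hb, evalAt_MapFun_c,
      evalAt_oneSubDiv_quarter, evalAt_oneSubDiv_neg_quarter, evalAt_x,
      smul_mul_assoc, jRules.E_smul]
    match_scalars <;> grind

/-! ### Direct and inverse maps -/

theorem smul_one_injective {φ ψ : MapFun} (hφ : φ • (1 : U) = ψ • (1 : U)) : φ = ψ := by
  have := linearIndependent_U (A := φ - ψ) (B := 0) (C := 0) (D := 0) (G := 0)
    (by rw [sub_smul, hφ]; module)
  exact sub_eq_zero.1 this.1

theorem smul_e_injective {φ ψ : MapFun} (hφ : φ • e = ψ • e) : φ = ψ := by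
  have := linearIndependent_U (A := 0) (B := φ - ψ) (C := 0) (D := 0) (G := 0)
    (by rw [sub_smul, hφ]; module)
  exact sub_eq_zero.1 this.2.1

/-- The function of `b₊` that represents `X` under the direct map given by `φ`. -/
def logT (φ : MapFun) : MapFun := evalAt (x * φ ^ 2) arsinhDiv

theorem evalAt_logT_sinhDiv (φ : MapFun) : evalAt (logT φ) sinhDiv = x * φ ^ 2 := by
  rw [logT, ← evalAt_evalAt, evalAt_arsinhDiv_sinhDiv, evalAt_x]

/-- The substitution sends `sinhDiv` to xφ², so both sides are square roots of 1 + ħ²x²φ⁴ with limit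
1. This is where the square root in the direct maps comes from. -/
theorem evalAt_logT_ch {φ : MapFun} : evalAt (logT φ) ch = root φ := by
  refine eq_of_sq_eq_sq ?_ ?_ (limit_root φ)
  · rw [← map_pow, ch_sq, map_add, map_one, map_mul, map_pow, map_pow, evalAt_logT_sinhDiv,
      evalAt_MapFun_hb, root_sq]
    ring
  · rw [limit_evalAt, limit_ch, Polynomial.one_comp]

theorem evalAt_logT_expPow_one (φ : MapFun) :
    evalAt (logT φ) (expPow 1) = hb * x * φ ^ 2 + root φ := by
  rw [expPow_one_eq, map_add, map_mul, evalAt_logT_sinhDiv, evalAt_logT_ch, evalAt_MapFun_hb]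
  ring

theorem evalAt_logT_expPow_neg_one (φ : MapFun) :
    evalAt (logT φ) (expPow (-1)) = -(hb * x * φ ^ 2) + root φ := by
  rw [expPow_neg_one_eq, map_sub, map_mul, evalAt_logT_sinhDiv, evalAt_logT_ch, evalAt_MapFun_hb]
  ring

/-- The function `T ^ {1/2}` under the direct map given by `φ`. -/
def sqrtT (φ : MapFun) : MapFun := evalAt (logT φ) (expPow (1 / 2))

/-- The function `T ^ {-1/2}` under the direct map given by `φ`. -/
def sqrtT' (φ : MapFun) : MapFun := evalAt (logT φ) (expPow (-1 / 2))

theorem sqrtT_mul (φ : MapFun) : sqrtT φ * sqrtT' φ = 1 := by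
  rw [sqrtT, sqrtT', ← map_mul, expPow_half_mul, map_one]

theorem sqrtT_sq (φ : MapFun) : sqrtT φ ^ 2 = hb * x * φ ^ 2 + root φ := by
  rw [sqrtT, ← map_pow, ← expPow_one_eq_sq, evalAt_logT_expPow_one]

theorem sqrtT'_sq (φ : MapFun) : sqrtT' φ ^ 2 = -(hb * x * φ ^ 2) + root φ := by
  rw [sqrtT', ← map_pow, ← expPow_neg_one_eq_sq, evalAt_logT_expPow_neg_one]

theorem limit_sqrtT' (φ : MapFun) : limit (sqrtT' φ) = 1 := by
  rw [sqrtT', limit_evalAt, limit_expPow, Polynomial.one_comp]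

theorem root_mul_dx_logT (φ : MapFun) :
    root φ * dx (logT φ) = φ * (φ + 2 * x * dx φ) := by
  have := congrArg dx (evalAt_logT_sinhDiv φ)
  rw [dx_evalAt, dx_sinhDiv, evalAt_logT_ch] at this
  rw [this]
  simp only [dx_mul, dx_x, dx_pow]
  push_cast
  ring

theorem dx_sqrtT' (φ : MapFun) :
    dx (sqrtT' φ) = -(c (1 / 2) * hb * sqrtT' φ * dx (logT φ)) := by
  rw [sqrtT', dx_evalAt, dx_expPow, map_mul, map_mul, evalAt_MapFun_c, evalAt_MapFun_hb, neg_div,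
    c_neg]
  ring

/-- The direct map enters its system through φ + 2xφ', and the associated endomorphism of U through
α + 2xα' with α = T^{−1/2}φ. This identity converts one into the other. -/
theorem root_mul_eq (φ : MapFun) : root φ * (sqrtT' φ * φ + 2 * x * dx (sqrtT' φ * φ)) =
    sqrtT' φ ^ 3 * (φ + 2 * x * dx φ) := by
  have k1 := two_mul_c_half
  have k2 := root_mul_dx_logT φ
  have k3 := sqrtT'_sq φ
  rw [dx_mul, dx_sqrtT']
  have : root φ = sqrtT' φ ^ 2 + hb * x * φ ^ 2 := by rw [k3]; ring
  linear_combination (-(2 * c (1 / 2)) * x * hb * sqrtT' φ * φ) * k2 +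
    (sqrtT' φ * (φ + 2 * x * dx φ)) * this - x * hb * sqrtT' φ * φ ^ 2 * (φ + 2 * x * dx φ) * k1

/-- The functions on the right are those of m ∘ untwist, see `IsDirect.comp_untwist`. The systems
agree equation by equation, after cancelling powers of T and the square root, which are not zero. -/
theorem directSolution_iff {φ₁ φ₂ φ₃ u₁ u₂ : MapFun} :
    DirectSolution φ₁ φ₂ φ₃ u₁ u₂ ↔ KSol (sqrtT' φ₁ * φ₁) (sqrtT φ₁ ^ 2 * φ₂) (sqrtT φ₁ * φ₃)
      (sqrtT φ₁ * u₁ + c (1 / 2) ^ 3 * hb * sqrtT φ₁ * (sqrtT φ₁ ^ 2 - sqrtT' φ₁ ^ 2) * φ₁)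
      (sqrtT φ₁ * u₂ - c (1 / 2) * hb * sqrtT φ₁ * φ₁ * φ₂) := by
  have k1 := two_mul_c_half
  have k2 := sqrtT_mul φ₁
  have k3 := sqrtT_sq φ₁
  have k4 := sqrtT'_sq φ₁
  have k5 := root_mul_eq φ₁
  have hR : root φ₁ ≠ 0 := ne_zero_of_limit (by simp [limit_root])
  have hπ : sqrtT φ₁ ≠ 0 := left_ne_zero_of_mul_eq_one k2
  have hμ : sqrtT' φ₁ ≠ 0 := right_ne_zero_of_mul_eq_one k2
  constructor
  · rintro ⟨e1, e2, e3, e4⟩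
    rw [c_two] at e1 e4
    rw [c_one_div_four] at e3
    refine ⟨mul_left_cancel₀ hR ?_, ?_, ?_, ?_⟩
    · linear_combination sqrtT φ₁ ^ 2 * φ₂ * k5 + sqrtT φ₁ ^ 2 * sqrtT' φ₁ ^ 3 * e1
        + sqrtT' φ₁ * root φ₁ * φ₁ * (sqrtT φ₁ * sqrtT' φ₁ + 1) * k2
    · linear_combination φ₁ * φ₃ * k2 + e2
    · rw [e3, k3, k4]
      linear_combination sqrtT φ₁ * c (1 / 2) ^ 2 * hb ^ 2 * x * φ₁ ^ 3 * k1
    · linear_combination (2 * x * φ₁ * u₂ - 2 * c (1 / 2) * hb * x * φ₁ ^ 2 * φ₂) * k2 + e4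
        + φ₂ * k3 - hb * x * φ₁ ^ 2 * φ₂ * k1
  · rintro ⟨e1, e2, e3, e4⟩
    refine ⟨mul_left_cancel₀ hμ ?_, ?_, mul_left_cancel₀ hπ ?_, ?_⟩
    · rw [c_two]
      linear_combination root φ₁ * e1 - sqrtT φ₁ ^ 2 * φ₂ * k5 -
        (sqrtT φ₁ * sqrtT' φ₁ + 1) * sqrtT' φ₁ * φ₂ * (φ₁ + 2 * x * dx φ₁) * k2
    · linear_combination e2 - φ₁ * φ₃ * k2
    · rw [k3, k4] at e3
      rw [c_one_div_four]
      linear_combination e3 - sqrtT φ₁ * c (1 / 2) ^ 2 * hb ^ 2 * x * φ₁ ^ 3 * k1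
    · rw [c_two]
      linear_combination e4 - (2 * x * φ₁ * u₂ - 2 * c (1 / 2) * hb * x * φ₁ ^ 2 * φ₂) * k2
        - φ₂ * k3 + hb * x * φ₁ ^ 2 * φ₂ * k1

theorem exists_directSolution {φ₁ : MapFun} (h₁ : limit φ₁ = 1) :
    ∃ φ₂ φ₃ u₁ u₂ : MapFun, DirectSolution φ₁ φ₂ φ₃ u₁ u₂ ∧
      φ₂.limit = 1 ∧ φ₃.limit = 1 ∧ u₁.limit = 0 ∧ u₂.limit = 0 := by
  have hα : limit (sqrtT' φ₁ * φ₁) = 1 := by rw [limit_mul, limit_sqrtT', h₁, mul_one]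
  obtain ⟨β, γ, p, q, s⟩ := exists_kSol hα
  have k2 := sqrtT_mul φ₁
  have t : DirectSolution φ₁ (sqrtT' φ₁ ^ 2 * β) (sqrtT' φ₁ * γ)
      (-(c (1 / 4) * hb ^ 2 * x * φ₁ ^ 3))
      (sqrtT' φ₁ * q + c (1 / 2) * hb * φ₁ * (sqrtT' φ₁ ^ 2 * β)) := by
    rw [directSolution_iff]
    have e1 : sqrtT φ₁ ^ 2 * (sqrtT' φ₁ ^ 2 * β) = β := by
      linear_combination (sqrtT φ₁ * sqrtT' φ₁ + 1) * β * k2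
    have e2 : sqrtT φ₁ * (sqrtT' φ₁ * γ) = γ := by
      linear_combination γ * k2
    have e3 : sqrtT φ₁ * (sqrtT' φ₁ * q + c (1 / 2) * hb * φ₁ * (sqrtT' φ₁ ^ 2 * β)) -
        c (1 / 2) * hb * sqrtT φ₁ * φ₁ * (sqrtT' φ₁ ^ 2 * β) = q := by
      linear_combination q * k2
    have e4 : sqrtT φ₁ * -(c (1 / 4) * hb ^ 2 * x * φ₁ ^ 3) +
        c (1 / 2) ^ 3 * hb * sqrtT φ₁ * (sqrtT φ₁ ^ 2 - sqrtT' φ₁ ^ 2) * φ₁ = 0 := by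
      rw [sqrtT_sq, sqrtT'_sq, c_one_div_four]
      linear_combination sqrtT φ₁ * c (1 / 2) ^ 2 * hb ^ 2 * x * φ₁ ^ 3 * two_mul_c_half
    rw [e1, e2, e3, e4]
    exact ⟨s.eq_β, s.eq_γ, rfl, s.eq_q⟩
  refine ⟨_, _, _, _, t, ?_, ?_, ?_, ?_⟩
  · rw [limit_mul, limit_pow, limit_sqrtT', s.limit_β hα, one_pow, one_mul]
  · have := limit_inv hα (by rw [mul_comm, s.eq_γ] : γ * _ = 1)
    rw [limit_mul, limit_sqrtT', this, one_mul]
  · simp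
  · have := congrArg limit s.eq_q
    rw [limit_mul, limit_mul, limit_mul, hα, limit_sub, limit_one, s.limit_β hα, sub_self, limit_x,
      limit_two, mul_one] at this
    have h0 : limit q = 0 := (mul_eq_zero.1 this).resolve_left
      (mul_ne_zero two_ne_zero Polynomial.X_ne_zero)
    rw [limit_add, limit_mul, h0]
    simp

/-- The ansatz does not prescribe m(X), but m(E)² = b₊φ₁(b₊)² and X is a function of E². -/
theorem IsDirect.on_X {φ₁ φ₂ φ₃ u₁ u₂ : MapFun} {m : Uh →ₐ[Scalars] U}
    (hm : IsDirect φ₁ φ₂ φ₃ u₁ u₂ m) : m X = ofBp (logT φ₁) := by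
  have h1 : (ofBp φ₁ * e) ^ 2 = ofBp (x * φ₁ ^ 2) := by
    have h2 : φ₁ * φ₁ * x = x * φ₁ ^ 2 := by ring
    rw [← fn_smul, sq, smul_mul_assoc, e_mul_smul, e_mul_e, smul_smul, smul_smul, h2, fn_smul,
      mul_one]
  rw [X_eq, map_evalAt, map_pow, hm.on_E, h1, ofBp_eq, ← evalAt_evalAt, ofBp_eq, logT]

theorem IsDirect.on_ofT {φ₁ φ₂ φ₃ u₁ u₂ : MapFun} {m : Uh →ₐ[Scalars] U}
    (hm : IsDirect φ₁ φ₂ φ₃ u₁ u₂ m) (φ : MapFun) : m (ofT φ) = ofBp (evalAt (logT φ₁) φ) := by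
  rw [ofT_eq, map_evalAt, hm.on_X, ofBp_eq, ofBp_eq, evalAt_evalAt]

theorem IsDirect.on_smul {φ₁ φ₂ φ₃ u₁ u₂ : MapFun} {m : Uh →ₐ[Scalars] U}
    (hm : IsDirect φ₁ φ₂ φ₃ u₁ u₂ m) (φ : MapFun) (u : Uh) :
    m (φ • u) = evalAt (logT φ₁) φ • m u := by
  rw [ofT_smul, map_mul, hm.on_ofT, fn_smul]

theorem IsDirect.comp_untwist {φ₁ φ₂ φ₃ u₁ u₂ : MapFun} {m : Uh →ₐ[Scalars] U}
    (hm : IsDirect φ₁ φ₂ φ₃ u₁ u₂ m) : IsK (sqrtT' φ₁ * φ₁) (sqrtT φ₁ ^ 2 * φ₂) (sqrtT φ₁ * φ₃)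
      (sqrtT φ₁ * u₁ + c (1 / 2) ^ 3 * hb * sqrtT φ₁ * (sqrtT φ₁ ^ 2 - sqrtT' φ₁ ^ 2) * φ₁)
      (sqrtT φ₁ * u₂ - c (1 / 2) * hb * sqrtT φ₁ * φ₁ * φ₂) (m.comp untwist) := by
  have hE : m E = φ₁ • e := hm.on_E
  have hH : m H = φ₂ • h := hm.on_H
  have hF : m F = φ₃ • f + u₁ • e + u₂ • (e * h) := by rw [hm.on_F, mul_assoc]; rfl
  refine ⟨?_, ?_, ?_⟩
  · rw [AlgHom.comp_apply, untwist_e, hm.on_smul, hE, smul_smul]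
    rfl
  · rw [AlgHom.comp_apply, untwist_h, hm.on_smul, hH, smul_smul, map_pow]
    rfl
  · rw [AlgHom.comp_apply, untwist_f, map_sub, map_add, hm.on_smul, hm.on_smul, hm.on_smul,
      map_mul m, hE, hH, hF]
    simp only [map_mul, map_sub, map_pow, evalAt_MapFun_hb, evalAt_MapFun_c, smul_mul_assoc,
      e_mul_smul]
    change sqrtT φ₁ • _ + (c (1 / 2) ^ 3 * hb * sqrtT φ₁ * (sqrtT φ₁ ^ 2 - sqrtT' φ₁ ^ 2)) • _ -
      (c (1 / 2) * hb * sqrtT φ₁) • _ = _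
    match_scalars <;> ring

theorem IsK.comp_twist {α β γ p q : MapFun} {k : U →ₐ[Scalars] U} (hk : IsK α β γ p q k) :
    IsDirect (evalAt (x * α ^ 2) (bin (-1 / 4)) * α) (evalAt (x * α ^ 2) (bin (1 / 4)) ^ 2 * β)
      (evalAt (x * α ^ 2) (bin (1 / 4)) * γ)
      (evalAt (x * α ^ 2) (bin (1 / 4)) * p - c (1 / 2) ^ 2 * hb ^ 2 * (x * α ^ 2) *
        evalAt (x * α ^ 2) (bin (-1 / 4)) ^ 3 * α)
      (evalAt (x * α ^ 2) (bin (1 / 4)) * q + c (1 / 2) * hb *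
        evalAt (x * α ^ 2) (bin (1 / 4)) * α * β) (k.comp twist) := by
  refine ⟨?_, ?_, ?_⟩
  · rw [AlgHom.comp_apply, twist_E, twistE, hk.on_smul, hk.on_e, smul_smul]
    rfl
  · rw [AlgHom.comp_apply, twist_H, twistH, hk.on_smul, hk.on_h, smul_smul, map_pow]
    rfl
  · rw [AlgHom.comp_apply, twist_F, twistF, map_add, map_sub, hk.on_smul, hk.on_smul, hk.on_smul,
      map_mul k, hk.on_e, hk.on_h, hk.on_f, mul_assoc (ofBp _)]
    simp only [← fn_smul, map_mul, map_pow, evalAt_MapFun_hb, evalAt_MapFun_c, smul_mul_assoc,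
      e_mul_smul, evalAt_x]
    match_scalars <;> ring

theorem evalAt_sqrtT'_bin (φ : MapFun) {r : ℂ} :
    evalAt (x * (sqrtT' φ * φ) ^ 2) (bin r) = evalAt (logT φ) (expPow (-2 * r)) := by
  have : x * (sqrtT' φ * φ) ^ 2 = evalAt (logT φ) oneSubDiv := by
    rw [oneSubDiv, map_mul, evalAt_logT_sinhDiv, expPow_neg_one_eq_sq, map_pow, sqrtT']
    ring
  rw [this, ← evalAt_evalAt, evalAt_oneSubDiv_bin]

/-- Composition with `untwist` turns direct maps into endomorphisms of U of the form `IsK`, and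
composition with `twist` turns these back. Existence is therefore decided by `KSol`. -/
theorem exists_isDirect_iff {φ₁ φ₂ φ₃ u₁ u₂ : MapFun} (h₁ : limit φ₁ = 1) :
    (∃ m, IsDirect φ₁ φ₂ φ₃ u₁ u₂ m) ↔ DirectSolution φ₁ φ₂ φ₃ u₁ u₂ := by
  rw [directSolution_iff]
  constructor
  · rintro ⟨m, hm⟩
    refine hm.comp_untwist.kSol ?_
    rw [limit_mul, limit_sqrtT', h₁, mul_one]
  · intro s
    obtain ⟨k, hk⟩ := s.exists_isK
    have k1 := two_mul_c_half
    have k2 := sqrtT_mul φ₁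
    have k3 := sqrtT_sq φ₁
    have k4 := sqrtT'_sq φ₁
    have e1 : evalAt (x * (sqrtT' φ₁ * φ₁) ^ 2) (bin (-1 / 4)) = sqrtT φ₁ := by
      rw [evalAt_sqrtT'_bin, sqrtT]
      norm_num
    have e2 : evalAt (x * (sqrtT' φ₁ * φ₁) ^ 2) (bin (1 / 4)) = sqrtT' φ₁ := by
      rw [evalAt_sqrtT'_bin, sqrtT']
      norm_num
    have hm := hk.comp_twist
    rw [e1, e2] at hm
    refine ⟨k.comp twist, ?_⟩
    convert hm using 1 <;> grind

theorem IsInverse.twist_comp {ψ₁ ψ₂ ψ₃ w₁ w₂ : MapFun} {n : U →ₐ[Scalars] Uh}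
    (hn : IsInverse ψ₁ ψ₂ ψ₃ w₁ w₂ n) :
    IsK (evalAt logDiv ψ₁ * bin (-1 / 4)) (evalAt logDiv ψ₂ * bin (1 / 4) ^ 2)
      (evalAt logDiv ψ₃ * bin (1 / 4))
      (evalAt logDiv w₁ * bin (-1 / 4) -
        c (1 / 2) ^ 2 * hb ^ 2 * x * bin (-1 / 4) ^ 3 * evalAt logDiv ψ₃)
      (bin (1 / 4) * (c (1 / 2) * hb * evalAt logDiv ψ₃ + evalAt logDiv w₂))
      (twist.comp n) := by
  have k2 := bin_quarter_mul
  have hE : n e = ψ₁ • E := hn.on_e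
  have hH : n h = ψ₂ • H := hn.on_h
  have hF : n f = ψ₃ • F + w₁ • E + w₂ • (E * H) := by rw [hn.on_f, mul_assoc]; rfl
  refine ⟨?_, ?_, ?_⟩
  · rw [AlgHom.comp_apply, hE, twist_smul, twist_E, twistE, smul_smul]
  · rw [AlgHom.comp_apply, hH, twist_smul, twist_H, twistH, smul_smul]
  · rw [AlgHom.comp_apply, hF, map_add, map_add, twist_smul, twist_smul, twist_smul,
      map_mul twist, twist_E, twist_H, twist_F, twistE, twistF, twistH, smul_mul_assoc, e_mul_smul]
    match_scalars <;> grind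

theorem IsK.untwist_comp {α β γ p q : MapFun} {k : U →ₐ[Scalars] U} (hk : IsK α β γ p q k) :
    IsInverse (evalAt oneSubDiv α * expPow (-1 / 2)) (evalAt oneSubDiv β * expPow (1 / 2) ^ 2)
      (evalAt oneSubDiv γ * expPow (1 / 2))
      (evalAt oneSubDiv γ * (c (1 / 2) ^ 3 * hb * expPow (1 / 2) *
        (expPow (1 / 2) ^ 2 - expPow (-1 / 2) ^ 2)) + evalAt oneSubDiv p * expPow (-1 / 2))
      (evalAt oneSubDiv q * expPow (1 / 2) -
        evalAt oneSubDiv γ * (c (1 / 2) * hb * expPow (1 / 2))) (untwist.comp k) := by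
  have k2 := expPow_half_mul
  refine ⟨?_, ?_, ?_⟩
  · rw [AlgHom.comp_apply, hk.on_e, untwist_smul, untwist_e, smul_smul]
    rfl
  · rw [AlgHom.comp_apply, hk.on_h, untwist_smul, untwist_h, smul_smul]
    rfl
  · rw [AlgHom.comp_apply, hk.on_f, map_add, map_add, untwist_smul, untwist_smul, untwist_smul,
      map_mul untwist, untwist_e, untwist_h, untwist_f, mul_assoc (ofT _), smul_mul_assoc,
      jRules.E_smul, ← ofT_smul, ← ofT_smul, ← ofT_smul]
    match_scalars <;> grind

theorem evalAt_logDiv_injective : Function.Injective (evalAt (A := MapFun) logDiv) := by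
  intro φ ψ h
  rw [← evalAt_self φ, ← evalAt_self ψ, ← evalAt_oneSubDiv_logDiv, ← evalAt_evalAt,
    ← evalAt_evalAt, h]

theorem evalAt_oneSubDiv_evalAt_logDiv (φ : MapFun) :
    evalAt oneSubDiv (evalAt logDiv φ) = φ := by
  rw [evalAt_evalAt, evalAt_oneSubDiv_logDiv, evalAt_self]

theorem evalAt_logDiv_two : evalAt logDiv (2 : MapFun) = 2 := map_ofNat _ 2

theorem evalAt_logDiv_eight : evalAt logDiv (8 : MapFun) = 8 := map_ofNat _ 8

/-- Substitution of L(b₊) for X is injective on mapping functions, so the equations may be compared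
after it. The functions on the right are those of twist ∘ n, see `IsInverse.twist_comp`. -/
theorem inverseSolution_iff {ψ₁ ψ₂ ψ₃ w₁ w₂ : MapFun} (h₁ : limit ψ₁ = 1) :
    InverseSolution ψ₁ ψ₂ ψ₃ w₁ w₂ ↔
    KSol (evalAt logDiv ψ₁ * bin (-1 / 4)) (evalAt logDiv ψ₂ * bin (1 / 4) ^ 2)
      (evalAt logDiv ψ₃ * bin (1 / 4))
      (evalAt logDiv w₁ * bin (-1 / 4) -
        c (1 / 2) ^ 2 * hb ^ 2 * x * bin (-1 / 4) ^ 3 * evalAt logDiv ψ₃)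
      (bin (1 / 4) * (c (1 / 2) * hb * evalAt logDiv ψ₃ + evalAt logDiv w₂)) := by
  have k1 := two_mul_c_half
  have k2 := bin_quarter_mul
  have k3 := bin_quarter_pow
  have k4 := congrArg (evalAt logDiv) (hb_mul_dT h₁)
  have k5 := dx_evalAt logDiv ψ₁
  have k6 := dx_bin_neg_quarter
  rw [map_mul, map_mul, expPow_one_eq_sq, map_pow, evalAt_logDiv_half, evalAt_MapFun_hb] at k4
  rw [dx_logDiv_eq, ← k4] at k5
  have k7 : 2 * hb * x * bin (-1 / 4) ^ 4 = bin (-1 / 4) ^ 4 - 1 := by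
    linear_combination bin (-1 / 4) ^ 4 * k3 - (bin (1 / 4) * bin (-1 / 4) + 1) *
      (bin (1 / 4) ^ 2 * bin (-1 / 4) ^ 2 + 1) * k2
  have k8 : bin (-1 / 4) ^ 2 - bin (1 / 4) ^ 2 = 2 * hb * x * bin (-1 / 4) ^ 2 := by
    linear_combination bin (1 / 4) ^ 2 * (bin (1 / 4) * bin (-1 / 4) + 1) * k2 -
      bin (-1 / 4) ^ 2 * k3
  have h8 : c 8 = (8 : MapFun) := c_ofNat 8
  have e1 : evalAt logDiv (ψ₂ * ((expPow 1 + expPow (-1)) * ψ₁ +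
      c 2 * (expPow 1 ^ 2 - 1) * dT ψ₁)) = evalAt logDiv (c 2 * ψ₁) ↔
      evalAt logDiv ψ₂ * ((bin (-1 / 4) ^ 2 + bin (1 / 4) ^ 2) * evalAt logDiv ψ₁ +
      2 * (bin (-1 / 4) ^ 4 - 1) * evalAt logDiv (dT ψ₁)) = 2 * evalAt logDiv ψ₁ := by
    simp only [map_mul, map_add, map_sub, map_pow, map_one, expPow_one_eq_sq,
      expPow_neg_one_eq_sq, evalAt_logDiv_half, evalAt_logDiv_neg_half, c_two, evalAt_logDiv_two,
      ← pow_mul]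
  have e3 : evalAt logDiv (w₁ * (c 8 * ψ₁)) = evalAt logDiv (hb * (expPow 1 - expPow (-1))) ↔
      evalAt logDiv w₁ * (8 * evalAt logDiv ψ₁) = hb * (bin (-1 / 4) ^ 2 - bin (1 / 4) ^ 2) := by
    simp only [map_mul, map_add, map_sub, map_pow, expPow_one_eq_sq, evalAt_MapFun_hb,
      expPow_neg_one_eq_sq, evalAt_logDiv_half, evalAt_logDiv_neg_half, h8, evalAt_logDiv_eight]
  have e4 : evalAt logDiv (w₂ * (c 2 * (expPow 1 - expPow (-1)) * ψ₁)) =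
      evalAt logDiv (hb * (expPow 1 + expPow (-1) - c 2 * ψ₂)) ↔
      evalAt logDiv w₂ * (2 * (bin (-1 / 4) ^ 2 - bin (1 / 4) ^ 2) * evalAt logDiv ψ₁) =
      hb * (bin (-1 / 4) ^ 2 + bin (1 / 4) ^ 2 - 2 * evalAt logDiv ψ₂) := by
    simp only [map_mul, map_add, map_sub, map_pow, expPow_one_eq_sq, evalAt_MapFun_hb,
      expPow_neg_one_eq_sq, evalAt_logDiv_half, evalAt_logDiv_neg_half, c_two, evalAt_logDiv_two]
  have e2 : evalAt logDiv (ψ₃ * ψ₁) = evalAt logDiv 1 ↔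
      evalAt logDiv ψ₃ * evalAt logDiv ψ₁ = 1 := by
    rw [map_mul, map_one]
  have hd : dx (evalAt logDiv ψ₁ * bin (-1 / 4)) =
      hb * bin (-1 / 4) ^ 2 * evalAt logDiv (dT ψ₁) * bin (-1 / 4) ^ 5
        + evalAt logDiv ψ₁ * (c (1 / 2) * hb * bin (-1 / 4) ^ 5) := by
    rw [dx_mul, k5, k6]
    ring
  -- From here on t and s are T^{1/2} and T^{−1/2} as functions of b₊, and only polynomial
  -- identities remain.
  generalize bin (-1 / 4) = t at *
  generalize bin (1 / 4) = s at *
  generalize evalAt logDiv (dT ψ₁) = D at *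
  generalize ha : evalAt logDiv ψ₁ = a at *
  generalize hb' : evalAt logDiv ψ₂ = b at *
  generalize hc : evalAt logDiv ψ₃ = d at *
  generalize hw1 : evalAt logDiv w₁ = v₁ at *
  generalize hw2 : evalAt logDiv w₂ = v₂ at *
  constructor
  · rintro ⟨t1, t2, t3, t4⟩
    replace t1 := e1.1 (congrArg _ t1)
    replace t2 := e2.1 (congrArg _ t2)
    replace t3 := e3.1 (congrArg _ t3)
    replace t4 := e4.1 (congrArg _ t4)
    refine ⟨?_, ?_, ?_, ?_⟩
    · rw [hd]
      linear_combination b * s ^ 2 * (t ^ 3 * D +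
        c (1 / 2) * a * t) * k7 + c (1 / 2) * t * t1 +
        (b * t * (t ^ 4 - 1) * D + c (1 / 2) * b * a * t ^ 3) *
        (s * t + 1) * k2 +
        (a * t - b * t * (t ^ 4 - 1) * D -
          b * s ^ 2 * a * t) * k1
    · linear_combination t2 + d * a * k2
    · linear_combination c (1 / 2) ^ 3 * d * t * t3 + c (1 / 2) ^ 3 * d * t * hb * k8 -
        v₁ * t * d * a * (4 * c (1 / 2) ^ 2 + 2 * c (1 / 2) + 1) * k1 - v₁ * t * t2 +
        c (1 / 2) ^ 2 * hb ^ 2 * x * t ^ 3 * d * k1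
    -- The denominator T − T⁻¹ equals 2ħxT, so the equation for w₂ is the equation for q multiplied
    -- by ħ.
    · refine mul_left_cancel₀ hb_ne_zero ?_
      linear_combination c (1 / 2) * s ^ 2 * t4 +
        (-2 * c (1 / 2) * s ^ 2 * v₂ * a * k8 -
        2 * hb * x * a * v₂ * t * s * (2 * c (1 / 2) * k2 + k1) +
        2 * c (1 / 2) * hb ^ 2 * x * (t * s * t2 + k2) - hb * b * s ^ 2 * k1 +
        c (1 / 2) * hb * (s * t + 1) * k2 + c (1 / 2) * hb * k3 + hb * k1)
  · rintro ⟨t1, t2, t3, t4⟩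
    rw [hd] at t1
    replace t2 : d * a = 1 := by linear_combination t2 - d * a * k2
    refine ⟨evalAt_logDiv_injective (e1.2 ?_), evalAt_logDiv_injective (e2.2 ?_),
      evalAt_logDiv_injective (e3.2 ?_), evalAt_logDiv_injective (e4.2 ?_)⟩
    · linear_combination 2 * s * (t1 - b * s ^ 2 * (t ^ 3 * D +
        c (1 / 2) * a * t) * k7 -
        (b * t * (t ^ 4 - 1) * D + c (1 / 2) * b * a * t ^ 3) *
        (s * t + 1) * k2 -
        (a * t - b * t * (t ^ 4 - 1) * D -
          b * s ^ 2 * a * t) * k1) -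
        (b * ((t ^ 2 + s ^ 2) * a + 2 * (t ^ 4 - 1) * D) - 2 * a) *
          (2 * c (1 / 2) * k2 + k1)
    · exact t2
    · linear_combination 8 * a * s * t3 - 8 * a * v₁ * k2 +
        8 * c (1 / 2) ^ 2 * hb ^ 2 * x * t ^ 2 * (a * d * k2 + t2) +
        2 * t ^ 2 * hb ^ 2 * x * (2 * c (1 / 2) + 1) * k1 - hb * k8
    · linear_combination 2 * t ^ 2 * (hb * t4 -
        (-2 * c (1 / 2) * s ^ 2 * v₂ * a * k8 -
        2 * hb * x * a * v₂ * t * s * (2 * c (1 / 2) * k2 + k1) +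
        2 * c (1 / 2) * hb ^ 2 * x * (t * s * t2 + k2) - hb * b * s ^ 2 * k1 +
        c (1 / 2) * hb * (s * t + 1) * k2 + c (1 / 2) * hb * k3 + hb * k1)) -
        (v₂ * (2 * (t ^ 2 - s ^ 2) * a) - hb * (t ^ 2 + s ^ 2 - 2 * b)) *
          (2 * c (1 / 2) * (s * t + 1) * k2 + k1)

theorem exists_isInverse_iff {ψ₁ ψ₂ ψ₃ w₁ w₂ : MapFun} (h₁ : limit ψ₁ = 1) :
    (∃ n, IsInverse ψ₁ ψ₂ ψ₃ w₁ w₂ n) ↔ InverseSolution ψ₁ ψ₂ ψ₃ w₁ w₂ := by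
  rw [inverseSolution_iff h₁]
  constructor
  · rintro ⟨n, hn⟩
    refine hn.twist_comp.kSol ?_
    rw [limit_mul, limit_evalAt, h₁, limit_bin, Polynomial.one_comp, mul_one]
  · intro s
    obtain ⟨k, hk⟩ := s.exists_isK
    have k1 := two_mul_c_half
    have k2 := expPow_half_mul
    have k4 := two_hb_sinhDiv
    have k5 : oneSubDiv = expPow (-1 / 2) ^ 2 * sinhDiv := by
      rw [oneSubDiv, expPow_neg_one_eq_sq]
    rw [expPow_one_eq_sq, expPow_neg_one_eq_sq] at k4
    have hn := hk.untwist_comp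
    simp only [map_mul, map_sub, map_add, map_pow, evalAt_oneSubDiv_evalAt_logDiv,
      evalAt_oneSubDiv_quarter, evalAt_oneSubDiv_neg_quarter, evalAt_MapFun_c, evalAt_MapFun_hb,
      evalAt_x] at hn
    refine ⟨untwist.comp k, ?_⟩
    convert hn using 1 <;> grind

theorem exists_inverseSolution {ψ₁ : MapFun} (h₁ : limit ψ₁ = 1) :
    ∃ ψ₂ ψ₃ w₁ w₂ : MapFun, InverseSolution ψ₁ ψ₂ ψ₃ w₁ w₂ ∧
      ψ₂.limit = 1 ∧ ψ₃.limit = 1 ∧ w₁.limit = 0 ∧ w₂.limit = 0 := by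
  have k2 := expPow_half_mul
  have hα : limit (evalAt logDiv ψ₁ * bin (-1 / 4)) = 1 := by
    rw [limit_mul, limit_evalAt, h₁, limit_bin, Polynomial.one_comp, mul_one]
  obtain ⟨β, γ, p, q, s⟩ := exists_kSol hα
  obtain ⟨k, hk⟩ := s.exists_isK
  have hn := hk.untwist_comp
  have e : evalAt oneSubDiv (evalAt logDiv ψ₁ * bin (-1 / 4)) * expPow (-1 / 2) = ψ₁ := by
    rw [map_mul, evalAt_oneSubDiv_evalAt_logDiv, evalAt_oneSubDiv_neg_quarter, mul_assoc, k2,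
      mul_one]
  rw [e, s.eq_p] at hn
  refine ⟨_, _, _, _, (exists_isInverse_iff h₁).1 ⟨_, hn⟩, ?_, ?_, ?_, ?_⟩
  · simp [limit_expPow, s.limit_β hα]
  · have := limit_inv hα (by rw [mul_comm, s.eq_γ] : γ * _ = 1)
    simp [limit_expPow, this]
  · simp
  · have := congrArg limit s.eq_q
    rw [limit_mul, limit_mul, limit_mul, hα, limit_sub, limit_one, s.limit_β hα, sub_self, limit_x,
      limit_two, mul_one] at this
    have h0 : limit q = 0 := (mul_eq_zero.1 this).resolve_left
      (mul_ne_zero two_ne_zero Polynomial.X_ne_zero)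
    simp [h0]

theorem AreInverse.of_comp {m : Uh →ₐ[Scalars] U} {n : U →ₐ[Scalars] Uh}
    (h1 : m.comp n = AlgHom.id Scalars U) (h2 : n.comp m = AlgHom.id Scalars Uh) :
    AreInverse m n :=
  ⟨DFunLike.congr_fun h1, DFunLike.congr_fun h2⟩

theorem limit_evalAt_eq_one {g φ : MapFun} (h : limit φ = 1) : limit (evalAt g φ) = 1 := by
  rw [limit_evalAt, h, Polynomial.one_comp]

/-- m = k₀ ∘ twist, where k₀ = m ∘ untwist is invertible among the endomorphisms `IsK`. The inverse
is untwist ∘ k₀⁻¹, which again has the form of the ansatz. -/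
theorem IsDirect.exists_inverse {φ₁ φ₂ φ₃ u₁ u₂ : MapFun} {m : Uh →ₐ[Scalars] U}
    (hm : IsDirect φ₁ φ₂ φ₃ u₁ u₂ m) (h₁ : limit φ₁ = 1) :
    ∃ (ψ₁ ψ₂ ψ₃ w₁ w₂ : MapFun) (n : U →ₐ[Scalars] Uh), limit ψ₁ = 1 ∧
        IsInverse ψ₁ ψ₂ ψ₃ w₁ w₂ n ∧ AreInverse m n := by
  obtain ⟨α, β, γ, p, q, k, hα, hk, e1, e2⟩ := hm.comp_untwist.exists_inverse
    (by rw [limit_mul, limit_sqrtT', h₁, mul_one])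
  refine ⟨_, _, _, _, _, untwist.comp k, ?_, hk.untwist_comp, .of_comp ?_ ?_⟩
  · rw [limit_mul, limit_evalAt_eq_one hα, limit_expPow, mul_one]
  · rw [← AlgHom.comp_assoc, e1]
  · have : m = (m.comp untwist).comp twist := by
      rw [AlgHom.comp_assoc, untwist_twist, AlgHom.comp_id]
    rw [this, AlgHom.comp_assoc, ← AlgHom.comp_assoc k, e2, AlgHom.id_comp, untwist_twist]

theorem IsInverse.exists_inverse {ψ₁ ψ₂ ψ₃ w₁ w₂ : MapFun} {n : U →ₐ[Scalars] Uh}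
    (hn : IsInverse ψ₁ ψ₂ ψ₃ w₁ w₂ n) (h₁ : limit ψ₁ = 1) :
    ∃ (φ₁ φ₂ φ₃ u₁ u₂ : MapFun) (m : Uh →ₐ[Scalars] U), limit φ₁ = 1 ∧
        IsDirect φ₁ φ₂ φ₃ u₁ u₂ m ∧ AreInverse m n := by
  obtain ⟨α, β, γ, p, q, k, hα, hk, e1, e2⟩ := hn.twist_comp.exists_inverse
    (by rw [limit_mul, limit_evalAt_eq_one h₁, limit_bin, mul_one])
  refine ⟨_, _, _, _, _, k.comp twist, ?_, hk.comp_twist, .of_comp ?_ ?_⟩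
  · rw [limit_mul, limit_evalAt_eq_one (limit_bin _), hα, mul_one]
  · rw [AlgHom.comp_assoc, e2]
  · have : n = untwist.comp (twist.comp n) := by
      rw [← AlgHom.comp_assoc, untwist_twist, AlgHom.id_comp]
    rw [this, AlgHom.comp_assoc, ← AlgHom.comp_assoc _ k, e1, AlgHom.id_comp, untwist_twist]

/-- The composite m ∘ n is an endomorphism `IsK` with first function m(ψ₁(T))φ₁, and it is the
identity exactly when that function is 1. One composite is enough, because m is known to have a
two-sided inverse. -/
theorem IsDirect.areInverse_iff {φ₁ φ₂ φ₃ u₁ u₂ ψ₁ ψ₂ ψ₃ w₁ w₂ : MapFun} {m : Uh →ₐ[Scalars] U}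
    {n : U →ₐ[Scalars] Uh} (h₁ : limit φ₁ = 1) (hm : IsDirect φ₁ φ₂ φ₃ u₁ u₂ m)
    (hn : IsInverse ψ₁ ψ₂ ψ₃ w₁ w₂ n) : AreInverse m n ↔ m (ofT ψ₁) * ofBp φ₁ = 1 := by
  have hE : m E = φ₁ • e := hm.on_E
  have hH : m H = φ₂ • h := hm.on_H
  have hF : m F = φ₃ • f + u₁ • e + u₂ • (e * h) := by rw [hm.on_F, mul_assoc]; rfl
  have he : n e = ψ₁ • E := hn.on_e
  have hh : n h = ψ₂ • H := hn.on_h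
  have hf : n f = ψ₃ • F + w₁ • E + w₂ • (E * H) := by rw [hn.on_f, mul_assoc]; rfl
  have hk : IsK (evalAt (logT φ₁) ψ₁ * φ₁) (evalAt (logT φ₁) ψ₂ * φ₂) (evalAt (logT φ₁) ψ₃ * φ₃)
      (evalAt (logT φ₁) ψ₃ * u₁ + evalAt (logT φ₁) w₁ * φ₁)
      (evalAt (logT φ₁) ψ₃ * u₂ + evalAt (logT φ₁) w₂ * φ₁ * φ₂) (m.comp n) := by
    refine ⟨?_, ?_, ?_⟩
    · rw [AlgHom.comp_apply, he, hm.on_smul, hE, smul_smul]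
    · rw [AlgHom.comp_apply, hh, hm.on_smul, hH, smul_smul]
    · rw [AlgHom.comp_apply, hf, map_add, map_add, hm.on_smul, hm.on_smul, hm.on_smul, map_mul m,
        hE, hH, hF, smul_mul_assoc, e_mul_smul]
      match_scalars <;> ring
  have h2 : m (ofT ψ₁) * ofBp φ₁ = (evalAt (logT φ₁) ψ₁ * φ₁) • (1 : U) := by
    rw [hm.on_ofT, ← fn_smul, mul_smul, fn_smul φ₁, mul_one]
  rw [h2]
  constructor
  · intro h
    have h3 : (evalAt (logT φ₁) ψ₁ * φ₁) • e = (1 : MapFun) • e := by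
      rw [← hk.on_e, AlgHom.comp_apply, h.1, one_smul]
    rw [smul_e_injective h3, one_smul]
  · intro h
    have h3 : evalAt (logT φ₁) ψ₁ * φ₁ = 1 := smul_one_injective (h.trans (one_smul _ _).symm)
    rw [h3] at hk
    have h4 := hk.eq_id
    obtain ⟨-, -, -, -, -, n', -, -, h5⟩ := hm.exists_inverse h₁
    refine ⟨DFunLike.congr_fun h4, fun a => ?_⟩
    have h6 (b : U) : n b = n' b := by
      rw [← h5.2 (n b)]
      exact congrArg n' (DFunLike.congr_fun h4 b)
    rw [h6, h5.2]

theorem twist_isDirect : IsDirect (mtm (-1 / 4)) (mtm (1 / 2)) (mtm (1 / 4))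
    (-(c (1 / 4) * hb ^ 2 * x * mtm (-3 / 4))) (c (1 / 2) * hb * mtm (1 / 4)) twist := by
  simp only [mtm_eq_bin]
  refine ⟨twist_E, ?_, ?_⟩
  · rw [twist_H, twistH, bin_half]
    rfl
  · rw [twist_F, twistF, bin_neg_three_quarters, c_one_div_four, mul_assoc (ofBp _)]
    simp only [← fn_smul]
    module

theorem untwist_isInverse : IsInverse (expPow (-1 / 2)) (expPow 1) (expPow (1 / 2))
    (c (1 / 8) * hb * expPow (1 / 2) * (expPow 1 - expPow (-1)))
    (-(c (1 / 2) * hb * expPow (1 / 2))) untwist := by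
  refine ⟨untwist_e, ?_, ?_⟩
  · rw [untwist_h, expPow_one_eq_sq]
    rfl
  · rw [untwist_f, mul_assoc (ofT _), expPow_one_eq_sq, expPow_neg_one_eq_sq, c_one_div_eight]
    simp only [← ofT_smul]
    module

theorem twist_T (r : ℂ) : twist (T r) = ofBp (bin (-r / 2)) := by
  have := twist_smul (expPow r) 1
  rw [map_one, evalAt_logDiv_expPow, ofT_smul, fn_smul, mul_one, mul_one] at this
  exact this

theorem twist_X : twist X = ofBp logDiv := by
  have := twist_smul x 1
  rwa [map_one, evalAt_x, smul_Uh, evalAt_x, mul_one, fn_smul, mul_one] at this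

/-! ### Two commuting variables -/

/-- Polynomials in two variables. -/
abbrev Two : Type := Polynomial (Polynomial ℂ)

/-- The inner variable. -/
def Two.x : Two := Polynomial.C Polynomial.X

/-- The outer variable. -/
def Two.y : Two := Polynomial.X

section TwoVar

variable {A B : Type} [Ring A] [Algebra Scalars A] [HComplete A] [Algebra ℂ A]
  [IsScalarTower ℂ Scalars A] [Ring B] [Algebra Scalars B] [HComplete B] [Algebra ℂ B]
  [IsScalarTower ℂ Scalars B]

/-- The extension of a homomorphism of commutative algebras to formal power series in `𝐡`, as an
algebra homomorphism. -/
def extAlg {R : Type} [CommRing R] [Algebra ℂ R] (σ : R →ₐ[ℂ] A) : PowerSeries R →ₐ[Scalars] A where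
  toRingHom := ext σ
  commutes' := ext_map_algebraMap σ

theorem extAlg_C {R : Type} [CommRing R] [Algebra ℂ R] (σ : R →ₐ[ℂ] A) (r : R) :
    extAlg σ (PowerSeries.C r) = σ r := ext_C σ r

theorem extAlg_apply {R : Type} [CommRing R] [Algebra ℂ R] (σ : R →ₐ[ℂ] A) (φ : PowerSeries R) :
    extAlg σ φ = hsum fun n => σ (PowerSeries.coeff n φ) := rfl

/-- The evaluation of polynomials in two variables at two commuting elements. -/
def evalTwo {a b : A} (h : Commute a b) : Two →ₐ[ℂ] A :=
  Polynomial.eval₂AlgHom (Polynomial.aeval a) b fun p => by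
    induction p using Polynomial.induction_on' with
    | add p q hp hq => rw [map_add]; exact hp.add_left hq
    | monomial n r =>
      rw [Polynomial.aeval_monomial]
      exact Commute.mul_left (Algebra.commutes r b) (h.pow_left n)

theorem evalTwo_x {a b : A} (h : Commute a b) : evalTwo h Two.x = a := by
  simp [evalTwo, Two.x, Two.y]

theorem evalTwo_y {a b : A} (h : Commute a b) : evalTwo h Two.y = b := by
  simp [evalTwo, Two.x, Two.y]

theorem two_hbar_smul_injective {R : Type} [CommRing R] [IsDomain R] [Algebra ℂ R]
    {a b : PowerSeries R} (h : algebraMap Scalars (PowerSeries R) (2 * hbar) * a =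
      algebraMap Scalars (PowerSeries R) (2 * hbar) * b) : a = b := by
  refine mul_left_cancel₀ ?_ h
  rw [map_mul, map_ofNat]
  have hX : algebraMap Scalars (PowerSeries R) hbar = PowerSeries.X := PowerSeries.map_X _
  rw [hX]
  refine mul_ne_zero ?_ PowerSeries.X_ne_zero
  intro h0
  have h1 : algebraMap ℂ R 2 = 0 := by
    have := congrArg PowerSeries.constantCoeff h0
    rwa [map_ofNat, map_zero, ← map_ofNat (algebraMap ℂ R)] at this
  exact two_ne_zero ((algebraMap ℂ R).injective (h1.trans (map_zero _).symm))

theorem two_hbar_evalAt_oneSubDiv (a : A) :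
    algebraMap Scalars A (2 * hbar) * evalAt a oneSubDiv = 1 - expo (-2) a := by
  have := congrArg (evalAt a) two_hb_oneSubDiv
  rwa [map_mul, map_mul, map_ofNat, evalAt_hb, map_sub, map_one, evalAt_expPow,
    ← map_ofNat (algebraMap Scalars A), ← map_mul] at this

/-- The addition theorem of 1 − T⁻² follows after multiplication by 2ħ, but ħ need not be
cancellable in A. It is therefore proved for power series over polynomials in two variables and then
specialized. -/
theorem evalAt_oneSubDiv_add {a b : A} (h : Commute a b) : evalAt (a + b) oneSubDiv =
    evalAt a oneSubDiv * expo (-2) b + evalAt b oneSubDiv := by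
  have key (u v : PowerSeries (Two)) : evalAt (u + v) oneSubDiv =
      evalAt u oneSubDiv * expo (-2) v + evalAt v oneSubDiv := by
    refine two_hbar_smul_injective ?_
    rw [mul_add, ← mul_assoc, two_hbar_evalAt_oneSubDiv, two_hbar_evalAt_oneSubDiv,
      two_hbar_evalAt_oneSubDiv, expo_add_of_commute _ (Commute.all u v)]
    ring
  have := congrArg (extAlg (evalTwo h))
    (key (PowerSeries.C Two.x) (PowerSeries.C Two.y))
  rwa [map_add, map_mul, map_evalAt, map_evalAt, map_evalAt, map_expo, map_add, extAlg_C, extAlg_C,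
    evalTwo_x, evalTwo_y] at this

theorem evalAt_logDiv_evalAt_oneSubDiv (a : A) : evalAt (evalAt a oneSubDiv) logDiv = a := by
  rw [← evalAt_evalAt, evalAt_oneSubDiv_logDiv, evalAt_x]

/-- Meant for linear maps that are multiplicative only on powers of one element, such as a ↦ right
multiplication by a and the passage to the opposite algebra. -/
theorem map_evalAt_of_map_pow (g : A →ₗ[Scalars] B) {a : A} (hg : ∀ n, g (a ^ n) = g a ^ n)
    (φ : MapFun) : g (evalAt a φ) = evalAt (g a) φ := by
  rw [evalAt_apply, evalAt_apply, ext_apply, ext_apply, map_hsum]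
  congr 1
  funext n
  induction PowerSeries.coeff n φ using Polynomial.induction_on' with
  | add p q hp hq => rw [map_add, map_add, hp, hq, map_add]
  | monomial n r =>
    rw [Polynomial.aeval_monomial, Polynomial.aeval_monomial, ← Algebra.smul_def,
      ← Algebra.smul_def, ← hg, ← algebraMap_smul Scalars, map_smul, algebraMap_smul]

theorem evalAt_mulRight (a : A) (φ : MapFun) :
    evalAt (LinearMap.mulRight Scalars a) φ = LinearMap.mulRight Scalars (evalAt a φ) := by
  let g : A →ₗ[Scalars] Module.End Scalars A :=
    { toFun := LinearMap.mulRight Scalars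
      map_add' := fun u v => by ext; simp [mul_add]
      map_smul' := fun c u => by ext; simp }
  refine (map_evalAt_of_map_pow g (fun n => ?_) φ).symm
  exact (LinearMap.pow_mulRight Scalars A a n).symm

theorem expo_mulRight (r : ℂ) (a : A) :
    expo r (LinearMap.mulRight Scalars a) = LinearMap.mulRight Scalars (expo r a) :=
  evalAt_mulRight a _

end TwoVar

/-! ### Disentanglement -/

/-- `exp (-𝐡 y L(x))`, `L(x) = -ln (1 - 2 𝐡 x) / (2 𝐡)`, is a binomial series. -/
theorem expo_mul_logDiv : expo (-1) (PowerSeries.C Two.y *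
      evalAt (PowerSeries.C Two.x) logDiv) =
    PowerSeries.mk fun n => ((-1) ^ n / (n.factorial : ℂ)) •
      ((∏ i ∈ range n, (Two.y - (2 * i : Two))) *
        Two.x ^ n) := by
  ext1 n
  -- The coefficient of ħ^n is polynomial in y, so values at all complex y = r suffice; there the
  -- exponential is (1 − 2ħx)^{r/2}.
  refine Polynomial.eq_of_infinite_eval_eq _ _ (Set.Infinite.mono
    (s := Set.range (Polynomial.C : ℂ → Polynomial ℂ)) ?_
    (Set.infinite_range_of_injective Polynomial.C_injective))
  rintro _ ⟨r, rfl⟩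
  let τ : Two →ₐ[ℂ] Polynomial ℂ :=
    { Polynomial.evalRingHom (Polynomial.C r) with
      commutes' := fun s => by
        change Polynomial.eval _ (Polynomial.C (Polynomial.C s)) = _
        rw [Polynomial.eval_C]
        rfl }
  let t : PowerSeries (Two) →ₐ[Scalars] MapFun :=
    { PowerSeries.map τ.toRingHom with
      commutes' := fun s => by
        change PowerSeries.map τ.toRingHom (PowerSeries.map _ s) = PowerSeries.map _ s
        ext1 n
        simp only [PowerSeries.coeff_map]
        exact τ.commutes _ }
  have hC (p : Two) : t (PowerSeries.C p) =
      PowerSeries.C (Polynomial.eval (Polynomial.C r) p) := PowerSeries.map_C _ _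
  have key : t (expo (-1) (PowerSeries.C Two.y *
      evalAt (PowerSeries.C Two.x) logDiv)) = bin (r / 2) := by
    rw [map_expo, map_mul, map_evalAt, hC, hC, Two.x, Two.y, Polynomial.eval_X, Polynomial.eval_C]
    change expo (-1) (c r * evalAt x logDiv) = _
    rw [evalAt_self, bin_eq_expo, ← smul_eq_c_mul, expo_smul]
    congr 1
    ring
  have h2 := congrArg (PowerSeries.coeff n) key
  refine Eq.trans ((PowerSeries.coeff_map τ.toRingHom n _).symm.trans h2) ?_
  rw [PowerSeries.coeff_mk, Polynomial.eval_smul, Polynomial.eval_mul, Polynomial.eval_prod,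
    Polynomial.eval_pow, bin, PowerSeries.coeff_mk, binom]
  have h3 : (∏ i ∈ range n, (r / 2 - i)) = (∏ i ∈ range n, (r - 2 * i)) / 2 ^ n := by
    rw [eq_div_iff (pow_ne_zero _ two_ne_zero), show (2 : ℂ) ^ n = ∏ _i ∈ range n, 2 by
      rw [prod_const, card_range], ← prod_mul_distrib]
    exact prod_congr rfl fun i _ => by ring
  rw [h3]
  have h4 (i : ℕ) : Polynomial.eval (Polynomial.C r) (Two.y - (2 * i : Two)) =
      Polynomial.C (r - 2 * i) := by
    have : Polynomial.eval (Polynomial.C r) (2 : Two) = 2 := Polynomial.eval_ofNat _ _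
    rw [Polynomial.eval_sub, Polynomial.eval_mul, Two.y, Polynomial.eval_X, this,
      Polynomial.eval_natCast]
    simp only [map_sub, map_mul, map_ofNat, map_natCast]
  have h5 : ((-2 : ℂ)) ^ n = (-1) ^ n * 2 ^ n := by rw [← mul_pow]; norm_num
  simp only [h4, Two.x, Polynomial.eval_C, ← map_prod, Polynomial.smul_eq_C_mul, ← mul_assoc, ← map_mul]
  congr 2
  rw [h5]
  field_simp

/-- The normally ordered exponential of `-𝐡 h L(b₊)`. -/
def ordExp : U := expo (-1) (LinearMap.mulLeft Scalars h * LinearMap.mulRight Scalars (ofBp logDiv)) 1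

theorem h_mul_bp_pow (n : ℕ) : (h * bp) ^ n * h = h * (h * bp) ^ n - (2 * n : ℂ) • (h * bp) ^ n := by
  induction n with
  | zero => simp
  | succ n ih =>
    have h1 : h * bp * h = h * (h * bp) - (2 : ℂ) • (h * bp) := by
      rw [mul_assoc, bp_lie_h, mul_sub, mul_smul_comm]
    rw [pow_succ, mul_assoc, h1, mul_sub, ← mul_assoc, ih, sub_mul, smul_mul_assoc, mul_smul_comm,
      mul_assoc h]
    push_cast
    module

/-- Left multiplication by h and right multiplication by b₊ commute, so `expo_mul_logDiv` applies to
them with y and x. Applied to 1, the n-th product is h(h − 2)⋯(h − 2n + 2) b₊^n, which equals (h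
b₊)^n. -/
theorem ordExp_eq : ordExp = expo (-1) (h * bp) := by
  have hc : Commute (LinearMap.mulRight Scalars bp) (LinearMap.mulLeft Scalars h) :=
    (LinearMap.commute_mulLeft_right h bp).symm
  have h1 : expo (-1) (LinearMap.mulLeft Scalars h * LinearMap.mulRight Scalars (ofBp logDiv)) =
      extAlg (evalTwo hc) (expo (-1) (PowerSeries.C Two.y *
      evalAt (PowerSeries.C Two.x) logDiv)) := by
    rw [map_expo, map_mul, map_evalAt, extAlg_C, extAlg_C, evalTwo_x, evalTwo_y, evalAt_mulRight,
      ofBp_eq]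
  have h2 (n : ℕ) : evalTwo hc ((∏ i ∈ range n, (Two.y - (2 * i : Two))) *
        Two.x ^ n) 1 = (h * bp) ^ n := by
    induction n with
    | zero => simp
    | succ n ih =>
      have : (∏ i ∈ range (n + 1), (Two.y - (2 * i : Two))) *
        Two.x ^ (n + 1) = (Two.y - 2 * n) * Two.x *
        ((∏ i ∈ range n, (Two.y - (2 * i : Two))) *
        Two.x ^ n) := by
        rw [prod_range_succ, pow_succ]
        ring
      rw [this, map_mul, Module.End.mul_apply, ih, map_mul, map_sub, evalTwo_x, evalTwo_y, map_mul,
        map_ofNat, map_natCast, Module.End.mul_apply, LinearMap.mulRight_apply, LinearMap.sub_apply,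
        LinearMap.mulLeft_apply, pow_succ, ← mul_assoc, ← mul_assoc, h_mul_bp_pow]
      have h3 : ((2 * n : Module.End Scalars U)) ((h * bp) ^ n * bp) =
          (2 * n : ℂ) • ((h * bp) ^ n * bp) := by
        rw [two_mul, two_mul, add_smul, LinearMap.add_apply, Module.End.natCast_apply,
          Nat.cast_smul_eq_nsmul]
      rw [h3, sub_mul, smul_mul_assoc]
  rw [ordExp, h1, expo_mul_logDiv, extAlg_apply, expo_eq_ev, ev_apply]
  refine (map_hsum (LinearMap.applyₗ (1 : U)) _).trans ?_
  congr 1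
  funext n
  rw [PowerSeries.coeff_mk, PowerSeries.coeff_mk, map_smul, LinearMap.applyₗ_apply_apply]
  exact congrArg (((-1) ^ n / (n.factorial : ℂ)) • · : U → U) (h2 n)

/-! ### Conjugation by the normally ordered exponential -/

theorem expo_ofBp (r : ℂ) (φ : MapFun) : expo r (ofBp φ) = ofBp (expo r φ) := by
  rw [ofBp_eq, ofBp_eq, map_expo]

theorem expo_ofBp_logDiv (r : ℂ) : expo r (ofBp logDiv) = ofBp (bin (-r / 2)) := by
  rw [expo_ofBp, bin_eq_expo]
  congr 2
  ring

theorem ofBp_mul (φ ψ : MapFun) : ofBp (φ * ψ) = ofBp φ * ofBp ψ := by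
  simp only [ofBp_eq, map_mul]

theorem ofBp_eq_smul_one (φ : MapFun) : ofBp φ = φ • (1 : U) := by rw [fn_smul, mul_one]

theorem ofBp_commute (φ ψ : MapFun) : ofBp φ * ofBp ψ = ofBp ψ * ofBp φ := by
  rw [← ofBp_mul, mul_comm, ofBp_mul]

theorem ofBp_mul_e (φ : MapFun) : ofBp φ * e = e * ofBp φ := by
  rw [ofBp_eq, (evalAt_commute bp_lie_e φ).eq]

theorem h_mul_ofBp (φ : MapFun) : h * ofBp φ = ofBp φ * h + ofBp (2 * x * dx φ) := by
  have := h_mul_smul φ 1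
  simpa only [fn_smul, mul_one] using this

theorem f_mul_ofBp (φ : MapFun) : f * ofBp φ = ofBp φ * f - ofBp (dx φ) * e := by
  have := f_mul_smul φ 1
  simpa only [fn_smul, mul_one] using this

local notation "Lh" => LinearMap.mulLeft Scalars h
local notation "LX" => Lh * LinearMap.mulRight Scalars (ofBp logDiv)

/-- The operator v ↦ h v L(b₊) commutes with right multiplication by e. Moving it past left
multiplication by e replaces h by h + 1, which adds right multiplication by L(b₊). Both facts are
exponentiated and compared at v = 1. -/
theorem ordExp_mul_e : ordExp * e = e * ordExp * ofBp (bin (1 / 2)) := by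
  have h1 : expo (-1) LX * LinearMap.mulRight Scalars e =
      LinearMap.mulRight Scalars e * expo (-1) LX :=
    evalAt_mul_eq (LinearMap.ext fun v => by simp [mul_assoc, ofBp_mul_e]) _
  have h2 : expo (-1) LX * LinearMap.mulLeft Scalars e = LinearMap.mulLeft Scalars e *
      expo (-1) (LinearMap.mulRight Scalars (ofBp logDiv) + LX) :=
    evalAt_mul_eq (LinearMap.ext fun v => by
      simp only [Module.End.mul_apply, LinearMap.mulLeft_apply, LinearMap.mulRight_apply,
        LinearMap.add_apply, mul_assoc, h_mul_e_mul, mul_add]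
      abel) _
  rw [expo_add_of_commute _ (by
    refine LinearMap.ext fun v => ?_
    simp [mul_assoc]), expo_mulRight, expo_ofBp_logDiv, neg_neg] at h2
  have h3 := LinearMap.congr_fun h1 1
  have h4 := LinearMap.congr_fun h2 1
  simp only [Module.End.mul_apply, LinearMap.mulLeft_apply, LinearMap.mulRight_apply, one_mul,
    mul_one] at h3 h4
  rw [ordExp, ← h3, h4, mul_assoc]

theorem dx_logDiv_eq_bin : dx logDiv = bin (-1) := by
  have h1 := dx_logDiv
  have h2 : bin (-1) * (1 - 2 * hb * x) = 1 := by
    rw [← bin_one, ← bin_add, neg_add_cancel, bin_zero]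
  linear_combination bin (-1) * h1 - dx logDiv * h2

theorem hb_mul_dx_logDiv : hb * (2 * x * dx logDiv) = bin (-1) - 1 := by
  have h2 : bin (-1) * (1 - 2 * hb * x) = 1 := by
    rw [← bin_one, ← bin_add, neg_add_cancel, bin_zero]
  rw [dx_logDiv_eq_bin]
  linear_combination -h2

theorem hbar_smul_ofBp (φ : MapFun) : hbar • ofBp φ = ofBp (hb * φ) := by
  rw [ofBp_eq_smul_one, hbar_smul_U, smul_smul, ← ofBp_eq_smul_one]

theorem evalAt_dx_expPow_neg_one {A : Type} [Ring A] [Algebra Scalars A] [HComplete A]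
    [Algebra ℂ A] [IsScalarTower ℂ Scalars A] (r : ℂ) (a : A) :
    evalAt a (dx (expPow r)) = r • hbar • expo r a := by
  rw [dx_expPow, map_mul, map_mul, evalAt_c, evalAt_hb, ← expo, mul_assoc, Algebra.smul_def,
    Algebra.smul_def]

/-- Right multiplication by h has the commutator v ↦ h v · 2b₊L'(b₊) with the exponent, and 2ħxL' =
(1 − 2ħx)⁻¹ − 1 brings the result to closed form. -/
theorem ordExp_mul_h : ordExp * h = h * ordExp * ofBp (bin (-1)) := by
  have h1 : expo (-1) LX * Lh = Lh * expo (-1) LX :=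
    evalAt_mul_eq (LinearMap.ext fun v => by simp [mul_assoc]) _
  have h2 := evalAt_intertwine (a := LX) (z := LinearMap.mulRight Scalars h) (c := LX)
    (w := Lh * LinearMap.mulRight Scalars (ofBp (2 * x * dx logDiv)))
    (LinearMap.ext fun v => by
      simp only [Module.End.mul_apply, LinearMap.mulLeft_apply, LinearMap.mulRight_apply,
        LinearMap.add_apply, mul_assoc, h_mul_ofBp, mul_add])
    (LinearMap.ext fun v => by
      simp only [Module.End.mul_apply, LinearMap.mulLeft_apply, LinearMap.mulRight_apply,
        mul_assoc, ofBp_commute logDiv]) (expPow (-1))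
  rw [evalAt_dx_expPow_neg_one] at h2
  have h3 := LinearMap.congr_fun h1 1
  have h4 := LinearMap.congr_fun h2 1
  simp only [Module.End.mul_apply, LinearMap.mulLeft_apply, LinearMap.mulRight_apply, one_mul,
    mul_one, LinearMap.add_apply, evalAt_expPow, LinearMap.smul_apply] at h3 h4
  rw [h3] at h4
  change h * ordExp = ordExp * h + h * (((-1 : ℂ) • hbar • ordExp) * ofBp (2 * x * dx logDiv)) at h4
  rw [neg_one_smul, neg_mul, mul_neg, smul_mul_assoc, ← mul_smul_comm hbar ordExp, hbar_smul_ofBp,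
    hb_mul_dx_logDiv, ofBp_eq, map_sub, map_one, ← ofBp_eq, mul_sub, mul_one, mul_sub,
    ← mul_assoc] at h4
  rw [← sub_eq_iff_eq_add] at h4
  rw [eq_comm, ← sub_eq_zero, ← sub_eq_zero.2 h4]
  abel

/-- Left multiplication by f shifts h by −1, and right multiplication by f contributes the
commutator [L(b₊), f] = L'(b₊)e. -/
theorem ordExp_mul_f : ordExp * f = f * ordExp * ofBp (bin (-1 / 2)) -
    hbar • (h * ordExp * ofBp (bin (-1)) * e) := by
  have h1 : expo (-1) LX * LinearMap.mulLeft Scalars f = LinearMap.mulLeft Scalars f *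
      expo (-1) (-LinearMap.mulRight Scalars (ofBp logDiv) + LX) :=
    evalAt_mul_eq (LinearMap.ext fun v => by
      simp only [Module.End.mul_apply, LinearMap.mulLeft_apply, LinearMap.mulRight_apply,
        LinearMap.add_apply, LinearMap.neg_apply, mul_assoc, f_mul_h_mul, mul_add, mul_neg]
      abel) _
  rw [expo_add_of_commute _ (by
    refine LinearMap.ext fun v => ?_
    simp [mul_assoc]), expo_neg, expo_mulRight, expo_ofBp_logDiv, neg_neg] at h1
  have h2 := evalAt_intertwine (a := LX) (z := LinearMap.mulRight Scalars f) (c := LX)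
    (w := -(Lh * LinearMap.mulRight Scalars (ofBp (bin (-1)) * e)))
    (LinearMap.ext fun v => by
      simp only [Module.End.mul_apply, LinearMap.mulLeft_apply, LinearMap.mulRight_apply,
        LinearMap.add_apply, LinearMap.neg_apply, mul_assoc, f_mul_ofBp, mul_add, mul_sub,
        dx_logDiv_eq_bin]
      abel)
    (LinearMap.ext fun v => by
      simp only [Module.End.mul_apply, LinearMap.mulLeft_apply, LinearMap.mulRight_apply,
        LinearMap.neg_apply, mul_neg, neg_mul, mul_assoc, ← ofBp_mul_e]
      rw [← mul_assoc (ofBp logDiv), ofBp_commute, mul_assoc]) (expPow (-1))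
  rw [evalAt_dx_expPow_neg_one] at h2
  have h3 := LinearMap.congr_fun h1 1
  have h4 := LinearMap.congr_fun h2 1
  simp only [Module.End.mul_apply, LinearMap.mulLeft_apply, LinearMap.mulRight_apply, one_mul,
    mul_one, LinearMap.add_apply, LinearMap.neg_apply, evalAt_expPow, LinearMap.smul_apply] at h3 h4
  rw [h3] at h4
  change f * (ordExp * ofBp (bin (-1 / 2))) = ordExp * f +
    -(h * (((-1 : ℂ) • hbar • ordExp) * (ofBp (bin (-1)) * e))) at h4
  rw [neg_one_smul, neg_mul, mul_neg, neg_neg, smul_mul_assoc, mul_smul_comm] at h4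
  simp only [mul_assoc]
  rw [h4]
  abel

/-! ### Parity -/

theorem exists_parity_U : ∃ π : U →ₐ[Scalars] U, osp.IsParity π ∧ π h = h ∧ π e = -e ∧ π f = -f := by
  obtain ⟨π, hh, he, hf⟩ := OspTriple.exists_hom (A := U) (h := h) (e := -e) (f := -f)
    ⟨by rw [mul_neg, neg_mul, sub_neg_eq_add, neg_add_eq_sub, ← neg_sub, he_sub],
      by rw [mul_neg, neg_mul, sub_neg_eq_add, neg_add_eq_sub, ← neg_sub, hf_sub],
      by rw [neg_mul_neg, neg_mul_neg, ef_add]⟩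
  refine ⟨π, fun x => ?_, hh, he, hf⟩
  cases x with
  | h => exact hh.trans (one_smul ℂ h).symm
  | e => exact he.trans (neg_one_smul ℂ e).symm
  | f => exact hf.trans (neg_one_smul ℂ f).symm
  | bp =>
    have : π bp = bp := by rw [← e_sq, map_pow, he, neg_sq]
    exact this.trans (one_smul ℂ bp).symm
  | bm =>
    have : π bm = bm := by
      have h1 : bm = -f ^ 2 := by rw [f_sq, neg_neg]
      rw [h1, map_neg, map_pow, hf, neg_sq]
    exact this.trans (one_smul ℂ bm).symm

/-- The parity automorphism of `U`. -/
def parU : U →ₐ[Scalars] U := exists_parity_U.choose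

theorem parU_isParity : osp.IsParity parU := exists_parity_U.choose_spec.1

theorem parU_h : parU h = h := exists_parity_U.choose_spec.2.1

theorem parU_e : parU e = -e := exists_parity_U.choose_spec.2.2.1

theorem parU_f : parU f = -f := exists_parity_U.choose_spec.2.2.2

theorem parU_ofBp (φ : MapFun) : parU (ofBp φ) = ofBp φ := by
  rw [ofBp_eq, map_evalAt, ← e_sq, map_pow, parU_e, neg_sq]

theorem parU_smul (φ : MapFun) (u : U) : parU (φ • u) = φ • parU u := by
  rw [fn_smul, map_mul, parU_ofBp, fn_smul]

theorem twist_untwist_apply (u : U) : twist (untwist u) = u := DFunLike.congr_fun twist_untwist u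

theorem untwist_twist_apply (u : Uh) : untwist (twist u) = u := DFunLike.congr_fun untwist_twist u

/-- The parity automorphism of `Uh`. -/
def parJ : Uh →ₐ[Scalars] Uh := untwist.comp (parU.comp twist)

theorem parJ_apply (a : Uh) : parJ a = untwist (parU (twist a)) := rfl

theorem parJ_untwist (a : U) : parJ (untwist a) = untwist (parU a) := by
  rw [parJ_apply, twist_untwist_apply]

theorem parJ_H : parJ H = H := by
  rw [parJ_apply, twist_H, twistH, parU_smul, parU_h, ← twistH, ← twist_H, untwist_twist_apply]

theorem parJ_E : parJ E = -E := by
  rw [parJ_apply, twist_E, twistE, parU_smul, parU_e, smul_neg, ← twistE, ← twist_E, map_neg,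
    untwist_twist_apply]

theorem parJ_F : parJ F = -F := by
  rw [parJ_apply, twist_F, twistF, map_add, map_sub, parU_smul, parU_smul, parU_smul, map_mul parU,
    parU_e, parU_f, parU_h, neg_mul, smul_neg, smul_neg, smul_neg, ← neg_sub', ← neg_add, ← twistF,
    ← twist_F, map_neg, untwist_twist_apply]

theorem parJ_X : parJ X = X := by
  rw [parJ_apply, twist_X, parU_ofBp, ← twist_X, untwist_twist_apply]

theorem parJ_ofT (φ : MapFun) : parJ (ofT φ) = ofT φ := by
  rw [ofT_eq, map_evalAt, parJ_X]

theorem parJ_smul (φ : MapFun) (u : Uh) : parJ (φ • u) = φ • parJ u := by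
  rw [ofT_smul, map_mul, parJ_ofT, ofT_smul]

theorem parJ_Y : parJ Y = Y := by
  rw [Y_eq, jY]
  simp only [map_add, map_neg, parJ_smul, map_mul parJ, parJ_H, parJ_E, parJ_F, neg_mul_neg, map_one parJ]

theorem parJ_isParity : jord.IsParity parJ := fun x => by
  cases x with
  | H => exact parJ_H.trans (one_smul ℂ H).symm
  | E => exact parJ_E.trans (neg_one_smul ℂ E).symm
  | F => exact parJ_F.trans (neg_one_smul ℂ F).symm
  | X => exact parJ_X.trans (one_smul ℂ X).symm
  | Y => exact parJ_Y.trans (one_smul ℂ Y).symm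

/-! ### Graded antihomomorphisms -/

section superAnti

open SuperPres

variable {P : SuperPres}

/-- The factor by which a graded antihomomorphism differs from an antihomomorphism. -/
def antiFactor (p : Bool) : ℂ := if p then -Complex.I else 1

/-- The graded antihomomorphism defined by an antihomomorphism. -/
def superAnti (π : P.Alg →ₐ[Scalars] P.Alg) (σ : P.Alg →ₐ[Scalars] P.Algᵐᵒᵖ) :
    P.Alg →ₗ[Scalars] P.Alg :=
  (MulOpposite.opLinearEquiv Scalars).symm.toLinearMap ∘ₗ σ.toLinearMap ∘ₗ
    (cst (1 / 2) • (LinearMap.id + π.toLinearMap) -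
      cst (Complex.I / 2) • (LinearMap.id - π.toLinearMap))

theorem superAnti_apply (π : P.Alg →ₐ[Scalars] P.Alg) (σ : P.Alg →ₐ[Scalars] P.Algᵐᵒᵖ) (a : P.Alg) :
    superAnti π σ a = (σ (cst (1 / 2) • (a + π a) - cst (Complex.I / 2) • (a - π a))).unop := rfl

theorem cst_smul (r : ℂ) (a : P.Alg) : cst r • a = r • a := rfl

theorem superAnti_of_parity {π : P.Alg →ₐ[Scalars] P.Alg} {σ : P.Alg →ₐ[Scalars] P.Algᵐᵒᵖ} {p : Bool}
    {a : P.Alg} (h : π a = sgn true p • a) : superAnti π σ a = antiFactor p • (σ a).unop := by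
  have : cst (1 / 2) • (a + π a) - cst (Complex.I / 2) • (a - π a) = cst (antiFactor p) • a := by
    rw [h, cst_smul, cst_smul, cst_smul]
    cases p <;> simp only [sgn, antiFactor, Bool.and_true, Bool.and_false, if_true, if_false,
      Bool.false_eq_true] <;> module
  rw [superAnti_apply, this, map_smul, MulOpposite.unop_smul]
  rfl

theorem superAnti_of_even {π : P.Alg →ₐ[Scalars] P.Alg} {σ : P.Alg →ₐ[Scalars] P.Algᵐᵒᵖ}
    {a : P.Alg} (h : π a = a) : superAnti π σ a = (σ a).unop := by
  rw [superAnti_of_parity (p := false) (by rw [h]; exact (one_smul ℂ a).symm)]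
  exact one_smul ℂ _

theorem superAnti_of_odd {π : P.Alg →ₐ[Scalars] P.Alg} {σ : P.Alg →ₐ[Scalars] P.Algᵐᵒᵖ}
    {a : P.Alg} (h : π a = -a) : superAnti π σ a = -(Complex.I • (σ a).unop) := by
  rw [superAnti_of_parity (p := true) (by rw [h]; exact (neg_one_smul ℂ a).symm)]
  exact neg_smul Complex.I _

/-- The factor is 1 on even and −i on odd elements. It contributes (−i)² = −1 exactly when both
factors are odd, and this is the required sign. -/
theorem superAnti_isSuperAntihom {π : P.Alg →ₐ[Scalars] P.Alg} (hπ : P.IsParity π)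
    (σ : P.Alg →ₐ[Scalars] P.Algᵐᵒᵖ) : IsSuperAntihom (superAnti π σ) := by
  refine ⟨?_, fun p q x y hx hy => ?_⟩
  · rw [superAnti_of_even (map_one π), map_one, MulOpposite.unop_one]
  · have h1 := hx.parity_eq hπ
    have h2 := hy.parity_eq hπ
    have h3 : π (x * y) = sgn true (xor p q) • (x * y) := by
      rw [map_mul, h1, h2, smul_mul_smul_comm]
      cases p <;> cases q <;> simp [sgn]
    rw [superAnti_of_parity h1, superAnti_of_parity h2, superAnti_of_parity h3, map_mul,
      MulOpposite.unop_mul, smul_mul_smul_comm]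
    cases p <;> cases q <;> simp [antiFactor]

end superAnti

/-- Conjugation by a unit. -/
def conjAlg {A : Type} [Ring A] [Algebra Scalars A] (g : Aˣ) : A →ₐ[Scalars] A where
  toFun a := ((g⁻¹ : Aˣ) : A) * a * g
  map_one' := by simp
  map_mul' a b := by simp [mul_assoc]
  map_zero' := by simp
  map_add' a b := by simp [mul_add, add_mul]
  commutes' c := by rw [← Algebra.commutes, mul_assoc, Units.inv_mul, mul_one]

/-- The unit `exp (r 𝐡 a)`. -/
def expoUnit {A : Type} [Ring A] [Algebra Scalars A] [HComplete A] [Algebra ℂ A]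
    [IsScalarTower ℂ Scalars A] (r : ℂ) (a : A) : Aˣ :=
  ⟨expo r a, expo (-r) a, expo_mul_neg r a, expo_neg_mul r a⟩

/-- The factors i are chosen so that the extra factor −i on odd elements gives S₀(e) = −e and S₀(f)
= −f. -/
theorem exists_classicalAnti : ∃ σ : U →ₐ[Scalars] Uᵐᵒᵖ, σ h = .op (-h) ∧
    σ e = .op (-(Complex.I • e)) ∧ σ f = .op (-(Complex.I • f)) := by
  refine OspTriple.exists_hom ⟨?_, ?_, ?_⟩ <;> refine MulOpposite.unop_injective ?_ <;>
  simp only [MulOpposite.unop_sub, MulOpposite.unop_add, MulOpposite.unop_neg,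
    MulOpposite.unop_mul, MulOpposite.unop_op, neg_mul_neg, smul_mul_assoc, mul_smul_comm,
    smul_smul, Complex.I_mul_I, ← smul_sub, neg_neg, ← smul_add]
  · rw [← neg_sub, he_sub, smul_neg]
  · rw [← neg_sub, hf_sub, neg_neg]
  · rw [add_comm, ef_add, neg_one_smul, neg_neg]

/-- The antihomomorphism that defines the antipode of `U`. -/
def antiU : U →ₐ[Scalars] Uᵐᵒᵖ := exists_classicalAnti.choose

theorem antiU_h : antiU h = .op (-h) := exists_classicalAnti.choose_spec.1

theorem antiU_e : antiU e = .op (-(Complex.I • e)) := exists_classicalAnti.choose_spec.2.1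

theorem antiU_f : antiU f = .op (-(Complex.I • f)) := exists_classicalAnti.choose_spec.2.2

/-- The antipode of `U`. -/
def antipodeU : U →ₗ[Scalars] U := superAnti parU antiU

theorem antipodeU_isClassicalAntipode : IsClassicalAntipode antipodeU := by
  have hh : antipodeU h = -h := by rw [antipodeU, superAnti_of_even parU_h, antiU_h]; rfl
  have he : antipodeU e = -e := by
    rw [antipodeU, superAnti_of_odd parU_e, antiU_e, MulOpposite.unop_op, smul_neg, smul_smul,
      Complex.I_mul_I, neg_one_smul, neg_neg]
  have hf : antipodeU f = -f := by
    rw [antipodeU, superAnti_of_odd parU_f, antiU_f, MulOpposite.unop_op, smul_neg, smul_smul,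
      Complex.I_mul_I, neg_one_smul, neg_neg]
  have hbp : antipodeU bp = -bp := by
    rw [antipodeU, superAnti_of_even (by rw [← e_sq, map_pow, parU_e, neg_sq]), ← e_sq, map_pow,
      antiU_e, MulOpposite.unop_pow, MulOpposite.unop_op, neg_sq, smul_pow, Complex.I_sq,
      neg_one_smul]
  have hbm : antipodeU bm = -bm := by
    have h1 : bm = -f ^ 2 := by rw [f_sq, neg_neg]
    rw [antipodeU, superAnti_of_even (by rw [h1, map_neg, map_pow, parU_f, neg_sq]), h1, map_neg,
      map_pow, antiU_f, MulOpposite.unop_neg, MulOpposite.unop_pow, MulOpposite.unop_op, neg_sq,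
      smul_pow, Complex.I_sq, neg_one_smul]
  refine ⟨superAnti_isSuperAntihom parU_isParity _, fun x => ?_⟩
  cases x with
  | h => exact hh
  | e => exact he
  | f => exact hf
  | bp => exact hbp
  | bm => exact hbm

/-! ### The antipode of the Jordanian superalgebra -/

/-- The element that transforms the antipodes into each other. -/
def gU : Uˣ := expoUnit (-1) (h * bp)

theorem gU_val : (gU : U) = ordExp := ordExp_eq.symm

theorem conjAlg_eq {A : Type} [Ring A] [Algebra Scalars A] {g : Aˣ} {a b : A}
    (hab : a * g = g * b) : conjAlg g a = b := by
  change ((g⁻¹ : Aˣ) : A) * a * g = b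
  rw [mul_assoc, hab, Units.inv_mul_cancel_left]

theorem bin_quarter_pow_mul (n : ℕ) : bin (1 / 4) ^ n * bin (-1 / 4) ^ n = 1 := by
  rw [← mul_pow, bin_quarter_mul, one_pow]

theorem bin_neg_one_eq : bin (-1) = bin (-1 / 4) ^ 4 := by
  rw [pow_succ, pow_succ, sq, ← bin_add, ← bin_add, ← bin_add]
  norm_num

theorem ofBp_one : ofBp 1 = 1 := by rw [ofBp_eq, map_one]

theorem conjAlg_gU_e : conjAlg gU e = bin (-1 / 4) ^ 2 • e := by
  refine conjAlg_eq ?_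
  rw [gU_val, fn_smul, ofBp_mul_e, ← mul_assoc, ordExp_mul_e, mul_assoc (e * _), ← ofBp_mul, bin_half,
    bin_quarter_pow_mul, ofBp_one, mul_one]

theorem conjAlg_gU_h : conjAlg gU h = h * (bin (1 / 4) ^ 4 • (1 : U)) := by
  refine conjAlg_eq ?_
  rw [gU_val, ← ofBp_eq_smul_one, ← mul_assoc, ordExp_mul_h, mul_assoc (h * _), ← ofBp_mul,
    bin_neg_one_eq, mul_comm (bin _ ^ _), bin_quarter_pow_mul, ofBp_one, mul_one]

theorem conjAlg_gU_f : conjAlg gU f = (f + hb • (h * e)) * (bin (1 / 4) ^ 2 • (1 : U)) := by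
  refine conjAlg_eq ?_
  have h1 : ordExp * (f + hb • (h * e)) = f * ordExp * ofBp (bin (-1 / 2)) := by
    rw [mul_add, ordExp_mul_f, ← ordExp_mul_h, ← hbar_smul_U, mul_smul_comm, mul_assoc ordExp h e,
      sub_add_cancel]
  rw [gU_val, ← ofBp_eq_smul_one, ← mul_assoc, h1, mul_assoc (f * _), ← ofBp_mul,
    bin_neg_half, mul_comm (bin _ ^ _), bin_quarter_pow_mul, ofBp_one, mul_one]

/-- The conjugated antihomomorphism of `U`. -/
def twistedAnti : U →ₐ[Scalars] Uᵐᵒᵖ := (AlgHom.op (conjAlg gU)).comp antiU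

theorem twistedAnti_apply (a : U) : twistedAnti a = .op (conjAlg gU (antiU a).unop) := rfl

theorem twistedAnti_h : twistedAnti h = .op (-(h * (bin (1 / 4) ^ 4 • (1 : U)))) := by
  rw [twistedAnti_apply, antiU_h, MulOpposite.unop_op, map_neg, conjAlg_gU_h]

theorem twistedAnti_e : twistedAnti e = .op (-(Complex.I • bin (-1 / 4) ^ 2 • e)) := by
  rw [twistedAnti_apply, antiU_e, MulOpposite.unop_op, map_neg, SuperPres.map_cSmul, conjAlg_gU_e]

theorem twistedAnti_f : twistedAnti f =
    .op (-(Complex.I • bin (1 / 4) ^ 2 • (f + hb • (e * h) + (2 * hb) • e))) := by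
  have k1 := two_mul_c_half
  have k2 := bin_quarter_mul
  have k3 := bin_quarter_pow
  have h1 : (f + hb • (h * e)) * (bin (1 / 4) ^ 2 • (1 : U)) =
      bin (1 / 4) ^ 2 • (f + hb • (e * h) + (2 * hb) • e) := by
    simp only [add_mul, smul_mul_assoc, mul_assoc, e_mul_smul, h_mul_smul, f_mul_smul, mul_one,
      h_mul_e, mul_add, smul_add, one_mul, dx_pow, dx_bin_quarter]
    match_scalars <;> grind
  rw [twistedAnti_apply, antiU_f, MulOpposite.unop_op, map_neg, SuperPres.map_cSmul, conjAlg_gU_f, h1]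

theorem MapFun.evalAt_neg_logDiv_oneSubDiv :
    evalAt (-logDiv) oneSubDiv = -(bin (-1 / 4) ^ 4 * x) := by
  have h1 := congrArg (evalAt (-logDiv)) two_hb_oneSubDiv
  rw [map_mul, map_mul, map_ofNat, evalAt_MapFun_hb, map_sub, map_one, evalAt_expPow, expo_neg,
    show (-(-2) : ℂ) = -2 * (-1) by norm_num, ← bin_eq_expo, bin_neg_one_eq] at h1
  have h2 := bin_quarter_pow_mul 4
  rw [bin_quarter_pow] at h2
  refine mul_left_cancel₀ (mul_ne_zero two_ne_zero hb_ne_zero) ?_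
  linear_combination h1 - h2

theorem twistedAnti_bp : twistedAnti bp = .op (ofBp (evalAt (-logDiv) oneSubDiv)) := by
  rw [← e_sq, map_pow, twistedAnti_e, ← MulOpposite.op_pow, neg_sq, smul_pow, Complex.I_sq,
    neg_one_smul, evalAt_neg_logDiv_oneSubDiv, sq, smul_mul_assoc, e_mul_smul, e_mul_e, smul_smul,
    smul_smul, ← neg_smul, ← ofBp_eq_smul_one]
  refine congrArg (fun φ => MulOpposite.op (ofBp φ)) ?_
  ring

/-- The substitution `X ↦ -X` in functions of `b₊`. -/
def flip : MapFun →ₐ[Scalars] MapFun := evalAt (evalAt (-logDiv) oneSubDiv)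

theorem flip_bin (r : ℂ) : flip (bin r) = bin (-r) := by
  rw [flip, ← evalAt_evalAt, evalAt_oneSubDiv_bin, evalAt_expPow, expo_neg, bin_eq_expo (-r), mul_neg]

theorem flip_quarter : flip (bin (1 / 4)) = bin (-1 / 4) := by rw [flip_bin, neg_div]

theorem flip_neg_quarter : flip (bin (-1 / 4)) = bin (1 / 4) := by rw [flip_bin, neg_div, neg_neg]

theorem flip_hb : flip hb = hb := evalAt_MapFun_hb _

theorem flip_c (r : ℂ) : flip (c r) = c r := evalAt_MapFun_c _ r

theorem flip_x : flip x = -(bin (-1 / 4) ^ 4 * x) := by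
  rw [flip, evalAt_x, evalAt_neg_logDiv_oneSubDiv]

theorem flip_logDiv : flip logDiv = -logDiv := by rw [flip, evalAt_logDiv_evalAt_oneSubDiv]

/-- Powers of one element are respected even by an antihomomorphism, so it acts on functions of b₊
by substitution: b₊ = (1 − T⁻²)/(2ħ) goes to (1 − T²)/(2ħ). -/
theorem twistedAnti_ofBp (φ : MapFun) : (twistedAnti (ofBp φ)).unop = ofBp (flip φ) := by
  let g : U →ₗ[Scalars] Uᵐᵒᵖ := (MulOpposite.opLinearEquiv Scalars : U ≃ₗ[Scalars] Uᵐᵒᵖ).toLinearMap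
  have h1 := map_evalAt_of_map_pow g (a := ofBp (evalAt (-logDiv) oneSubDiv))
    (fun n => MulOpposite.op_pow _ n) φ
  have h2 : twistedAnti bp = g (ofBp (evalAt (-logDiv) oneSubDiv)) := twistedAnti_bp
  rw [ofBp_eq, map_evalAt, h2, ← h1, ofBp_eq (evalAt _ _), ← evalAt_evalAt, ← ofBp_eq]
  rfl

theorem twistedAnti_smul (φ : MapFun) (u : U) :
    (twistedAnti (φ • u)).unop = (twistedAnti u).unop * (flip φ • (1 : U)) := by
  rw [fn_smul, map_mul, MulOpposite.unop_mul, twistedAnti_ofBp, ofBp_eq_smul_one]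

theorem unop_twistedAnti_mul (u v : U) :
    (twistedAnti (u * v)).unop = (twistedAnti v).unop * (twistedAnti u).unop := by
  rw [map_mul, MulOpposite.unop_mul]

/-- All terms that contain e cancel in normal order. The formulas for S(Y) and Δ(Y) then require
only f², h² and functions of b₊. -/
theorem twist_Y : twist Y = -(bin (1 / 4) ^ 2 • (f * f)) + (c (1 / 2) * hb * bin (1 / 4) ^ 2) • (h * h)
    + (c (1 / 2) ^ 3 * hb * (bin (-1 / 4) ^ 2 - bin (1 / 4) ^ 2)) • (1 : U) := by
  have k1 := two_mul_c_half
  have k2 := bin_quarter_mul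
  have k3 := bin_quarter_pow
  rw [Y_eq, jY]
  simp only [map_add, map_neg, twist_smul, map_mul twist, twist_H, twist_E, twist_F, map_one twist]
  simp only [twistH, twistE, twistF, evalAt_logDiv_ch, map_mul, map_add, map_pow, map_ofNat,
    evalAt_MapFun_hb, evalAt_MapFun_c, evalAt_logDiv_sinhDiv, smul_mul_assoc, mul_add, mul_sub,
    add_mul, sub_mul, mul_assoc, e_mul_smul, h_mul_smul, f_mul_smul, h_mul_e, f_mul_e, f_mul_h,
    e_mul_e, e_mul_e_mul, h_mul_e_mul, f_mul_e_mul, f_mul_h_mul, dx_bin_neg_quarter,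
    dx_bin_quarter, dx_mul, dx_pow, dx_c, dx_hb, dx_x]
  match_scalars <;> grind

/-- The antihomomorphism that defines the antipode of `Uh`. -/
def antiJ : Uh →ₐ[Scalars] Uhᵐᵒᵖ := (AlgHom.op untwist).comp (twistedAnti.comp twist)

theorem antiJ_apply (a : Uh) : (antiJ a).unop = untwist (twistedAnti (twist a)).unop := rfl

/-- The antipode of `Uh`. -/
def antipodeJ : Uh →ₗ[Scalars] Uh := superAnti parJ antiJ

theorem antipodeJ_of_even {a b : Uh} (h : parJ a = a) (hab : (twistedAnti (twist a)).unop = twist b) :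
    antipodeJ a = b := by
  rw [antipodeJ, superAnti_of_even h, antiJ_apply, hab, untwist_twist_apply]

theorem antipodeJ_of_odd {a b : Uh} (h : parJ a = -a)
    (hab : (twistedAnti (twist a)).unop = Complex.I • twist b) : antipodeJ a = b := by
  rw [antipodeJ, superAnti_of_odd h, antiJ_apply, hab, SuperPres.map_cSmul, untwist_twist_apply,
    smul_smul, Complex.I_mul_I, neg_one_smul, neg_neg]

/-- The Jordanian antipode is defined as S₀ conjugated by g⁻¹ and transported, so the relation is
built in. -/
theorem gU_mul_antipodeJ (a : U) : untwist gU * antipodeJ (untwist a) * untwist (gU⁻¹ : Uˣ) =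
    untwist (antipodeU a) := by
  rw [antipodeJ, antipodeU, superAnti_apply, superAnti_apply, parJ_untwist, ← map_add, ← map_sub,
    ← map_smul, ← map_smul, ← map_sub, antiJ_apply, twist_untwist_apply, twistedAnti_apply,
    MulOpposite.unop_op, ← map_mul, ← map_mul]
  congr 1
  change (gU : U) * (((gU⁻¹ : Uˣ) : U) * _ * gU) * ((gU⁻¹ : Uˣ) : U) = _
  simp [mul_assoc]

theorem antipodeJ_T (r : ℂ) : antipodeJ (T r) = T (-r) := by
  refine antipodeJ_of_even (parJ_ofT _) ?_
  rw [twist_T, twist_T, twistedAnti_ofBp, flip_bin]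
  congr 2
  ring

theorem antipodeJ_X_pow (n : ℕ) : antipodeJ (X ^ n) = (-X) ^ n := by
  refine antipodeJ_of_even (by rw [map_pow, parJ_X]) ?_
  rw [map_pow, map_pow, map_pow, map_neg, twist_X, MulOpposite.unop_pow, twistedAnti_ofBp,
    flip_logDiv, ofBp_eq, map_neg, ofBp_eq]

theorem antipodeJ_E : antipodeJ E = -E := by
  have k2 := bin_quarter_mul
  refine antipodeJ_of_odd parJ_E ?_
  rw [map_neg, twist_E, twistE, twistedAnti_smul, flip_neg_quarter, twistedAnti_e,
    MulOpposite.unop_op]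
  simp only [neg_mul, smul_mul_assoc, e_mul_smul, mul_one, complex_smul_U]
  match_scalars
  grind

theorem antipodeJ_H : antipodeJ H = -H + (cst 2 * hbar) • E ^ 2 := by
  have k1 := two_mul_c_half
  have k2 := bin_quarter_mul
  have k3 := bin_quarter_pow
  refine antipodeJ_of_even parJ_H ?_
  rw [map_add, map_neg, map_smul, map_pow, twist_H, twist_E, twistH, twistE, twistedAnti_smul, map_pow flip,
    flip_quarter, twistedAnti_h, MulOpposite.unop_op, mul_smul, cst_smul]
  simp only [sq, neg_mul, smul_mul_assoc, e_mul_smul, h_mul_smul, e_mul_e, mul_assoc, mul_one, one_mul, add_mul, mul_add,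
    complex_smul_U, hbar_smul_U, dx_mul, dx_pow, dx_bin_quarter, dx_bin_neg_quarter, c_two]
  match_scalars <;> grind

theorem antipodeJ_F : antipodeJ F = -F - (hbar * cst (1 / 2)) • ((T 1 + T (-1)) * E) := by
  have k1 := two_mul_c_half
  have k2 := bin_quarter_mul
  have k3 := bin_quarter_pow
  have i1 : c Complex.I * c Complex.I = -1 := by rw [← c_mul, Complex.I_mul_I, c_neg, c_one]
  refine antipodeJ_of_odd parJ_F ?_
  rw [map_sub twist, map_neg, map_smul, map_mul twist, map_add twist, twist_T, twist_T, twist_F,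
    twist_E, twistF, twistE, map_add, map_sub, MulOpposite.unop_add, MulOpposite.unop_sub]
  simp only [twistedAnti_smul, unop_twistedAnti_mul, twistedAnti_h, twistedAnti_e, twistedAnti_f,
    MulOpposite.unop_op, map_mul flip, map_pow flip, flip_quarter, flip_neg_quarter, flip_hb, flip_c, flip_x,
    neg_neg, bin_half, bin_neg_half, ofBp_eq_smul_one, mul_smul hbar, cst_smul]
  simp only [neg_mul, mul_neg, smul_mul_assoc, e_mul_smul, h_mul_smul, f_mul_smul, mul_assoc, mul_one,
    one_mul, complex_smul_U, hbar_smul_U, h_mul_e, f_mul_e, f_mul_h, h_mul_e_mul, mul_add, add_mul,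
    smul_add, smul_sub, smul_neg, mul_sub, sub_mul]
  match_scalars <;> (try simp only [dx_mul, dx_pow, dx_bin_quarter, dx_bin_neg_quarter, dx_add, dx_neg, dx_hb, dx_c, dx_x]) <;> grind

theorem twistedAnti_smul_f_mul_f : (twistedAnti (bin (1 / 4) ^ 2 • (f * f))).unop =
    -((bin (1 / 4) ^ 2 • (f + hb • (e * h) + (2 * hb) • e)) * (f + hb • (e * h) + hb • e)) := by
  have k1 := two_mul_c_half
  have k2 := bin_quarter_mul
  have k3 := bin_quarter_pow
  have h1 : (bin (1 / 4) ^ 2 • (f + hb • (e * h) + (2 * hb) • e)) * (bin (-1 / 4) ^ 2 • (1 : U)) =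
      f + hb • (e * h) + hb • e := by
    simp only [add_mul, smul_mul_assoc, mul_assoc, e_mul_smul, h_mul_smul, f_mul_smul, mul_one,
      mul_add, smul_add, one_mul, dx_pow, dx_bin_neg_quarter]
    match_scalars <;> grind
  rw [twistedAnti_smul, unop_twistedAnti_mul, twistedAnti_f, MulOpposite.unop_op, neg_mul_neg,
    smul_mul_smul_comm, Complex.I_mul_I, neg_one_smul, map_pow flip, flip_quarter, neg_mul, mul_assoc,
    h1]

theorem twistedAnti_smul_h_mul_h :
    (twistedAnti ((c (1 / 2) * hb * bin (1 / 4) ^ 2) • (h * h))).unop = (c (1 / 2) * hb) •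
      ((bin (1 / 4) ^ 4 • h - (4 * hb * x) • (1 : U)) *
        (bin (1 / 4) ^ 2 • h + (bin (1 / 4) ^ 2 - bin (-1 / 4) ^ 2) • (1 : U))) := by
  have k1 := two_mul_c_half
  have k2 := bin_quarter_mul
  have k3 := bin_quarter_pow
  have h1 : h * (bin (1 / 4) ^ 4 • (1 : U)) = bin (1 / 4) ^ 4 • h - (4 * hb * x) • (1 : U) := by
    simp only [h_mul_smul, mul_one, dx_pow, dx_bin_quarter]
    match_scalars <;> grind
  have h2 : h * (bin (1 / 4) ^ 4 • (1 : U)) * ((c (1 / 2) * hb * bin (-1 / 4) ^ 2) • (1 : U)) =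
      (c (1 / 2) * hb) •
        (bin (1 / 4) ^ 2 • h + (bin (1 / 4) ^ 2 - bin (-1 / 4) ^ 2) • (1 : U)) := by
    have e1 : bin (1 / 4) ^ 4 * (c (1 / 2) * hb * bin (-1 / 4) ^ 2) =
        c (1 / 2) * hb * bin (1 / 4) ^ 2 := by grind
    rw [mul_assoc, smul_mul_assoc, one_mul, smul_smul, e1, h_mul_smul, mul_one]
    simp only [dx_mul, dx_pow, dx_bin_quarter, dx_c, dx_hb]
    match_scalars <;> grind
  have h3 (u : U) : h * ((c (1 / 2) * hb) • u) = (c (1 / 2) * hb) • (h * u) := by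
    rw [h_mul_smul, dx_mul, dx_c, dx_hb, mul_zero, zero_mul, add_zero, mul_zero, zero_smul, add_zero]
  rw [twistedAnti_smul, unop_twistedAnti_mul, twistedAnti_h, MulOpposite.unop_op, neg_mul_neg,
    map_mul flip, map_mul flip, map_pow flip, flip_quarter, flip_c, flip_hb, mul_assoc, h2, h1,
    sub_mul, sub_mul, smul_sub, smul_mul_assoc, h3, smul_mul_assoc, smul_mul_assoc, smul_mul_assoc,
    one_mul, one_mul]
  match_scalars <;> ring

theorem antipodeJ_Y : antipodeJ Y = -Y - hbar • H + hbar ^ 2 • E ^ 2 := by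
  have k1 := two_mul_c_half
  have k2 := bin_quarter_mul
  have k3 := bin_quarter_pow
  have i1 : c Complex.I * c Complex.I = -1 := by rw [← c_mul, Complex.I_mul_I, c_neg, c_one]
  refine antipodeJ_of_even parJ_Y ?_
  rw [map_add twist, map_sub, map_neg, map_smul, map_smul, map_pow twist, twist_Y, twist_H, twist_E,
    twistH, twistE, map_add, map_add, map_neg, MulOpposite.unop_add, MulOpposite.unop_add,
    MulOpposite.unop_neg, twistedAnti_smul_f_mul_f, twistedAnti_smul_h_mul_h]
  simp only [twistedAnti_smul, unop_twistedAnti_mul, twistedAnti_h, twistedAnti_e, twistedAnti_f,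
    MulOpposite.unop_op, map_mul flip, map_pow flip, map_sub flip, flip_quarter, flip_neg_quarter, flip_hb, flip_c, flip_x,
    neg_neg, map_one twistedAnti, MulOpposite.unop_one, sq hbar, mul_smul hbar]
  simp only [neg_mul, mul_neg, smul_mul_assoc, e_mul_smul, h_mul_smul, f_mul_smul, mul_assoc, mul_one,
    one_mul, complex_smul_U, hbar_smul_U, h_mul_e, f_mul_e, f_mul_h, h_mul_e_mul, mul_add, add_mul,
    smul_add, smul_sub, smul_neg, mul_sub, sub_mul, f_mul_e_mul, f_mul_h_mul, e_mul_e, e_mul_e_mul,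
    sq]
  match_scalars <;> (try simp only [dx_mul, dx_pow, dx_bin_quarter, dx_bin_neg_quarter, dx_add, dx_neg, dx_hb, dx_c, dx_x, dx_sub, dx_two, dx_zero]) <;> grind

/-! ### Powers of `T` in `U` -/

/-- The scalar `1 / 2`. -/
abbrev half : Scalars := cst (1 / 2)

theorem two_mul_half : 2 * half = 1 := by
  rw [half, cst, ← map_ofNat PowerSeries.C, ← map_mul]
  norm_num

theorem cst_quarter : cst (1 / 4) = half ^ 2 := by
  rw [half, cst, cst, ← map_pow]
  norm_num

theorem cst_eighth : cst (1 / 8) = half ^ 3 := by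
  rw [half, cst, cst, ← map_pow]
  norm_num

/-- The image `(1 - 2 𝐡 b₊) ^ (-k / 4)` of `T ^ (k / 2)` under the minimal twist map. -/
def rootT (k : ℤ) : U := ofBp (bin (-(k : ℂ) / 4))

theorem rootT_mul (k l : ℤ) : rootT k * rootT l = rootT (k + l) := by
  rw [rootT, rootT, rootT, ← ofBp_mul, ← bin_add]
  congr 2
  push_cast
  ring

theorem rootT_mul_mul (k l : ℤ) (u : U) : rootT k * (rootT l * u) = rootT (k + l) * u := by
  rw [← mul_assoc, rootT_mul]

theorem rootT_zero : rootT 0 = 1 := by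
  rw [rootT, Int.cast_zero, neg_zero, zero_div, bin_zero, ofBp_one]

theorem rootT_neg_four : rootT (-4) = 1 - (2 * hbar) • bp := by
  have : ofBp (bin 1) = 1 - (2 * hbar) • bp := by
    rw [bin_one, ofBp_eq, map_sub, map_one, map_mul, map_mul, map_ofNat, evalAt_hb, evalAt_x,
      Algebra.smul_def, map_mul, map_ofNat]
  rw [← this, rootT]
  congr 2
  norm_num

/-- This is 2ħb₊ = 1 − T⁻². It removes b₊ from normally ordered results, so that all coefficients
become powers of T. -/
theorem hbar_smul_rootT_mul_bp (k : ℤ) :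
    hbar • (rootT k * bp) = half • (rootT k - rootT (k - 4)) := by
  have h1 := rootT_mul k (-4)
  rw [rootT_neg_four, mul_sub, mul_one, mul_smul_comm] at h1
  have h2 := two_mul_half
  have h3 : half * (2 * hbar) = hbar := by linear_combination hbar * h2
  rw [sub_eq_add_neg k, ← h1, sub_sub_cancel, smul_smul, h3]

theorem dx_bin_eq (k : ℤ) :
    dx (bin (-(k : ℂ) / 4)) = c (k * (1 / 2)) * hb * bin (-((k + 4 : ℤ) : ℂ) / 4) := by
  have h1 := dx_bin (-(k : ℂ) / 4)
  have h2 : bin (-1) * (1 - 2 * hb * x) = 1 := by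
    rw [← bin_one, ← bin_add, neg_add_cancel, bin_zero]
  have h3 : bin (-((k + 4 : ℤ) : ℂ) / 4) = bin (-1) * bin (-(k : ℂ) / 4) := by
    rw [← bin_add]
    congr 1
    push_cast
    ring
  have h4 : c (k * (1 / 2)) = -(2 * c (-(k : ℂ) / 4)) := by
    rw [← c_two, ← c_mul, ← c_neg]
    congr 1
    ring
  rw [h3, h4]
  linear_combination bin (-1) * h1 - dx (bin (-(k : ℂ) / 4)) * h2

theorem ofBp_c (r : ℂ) : ofBp (c r) = algebraMap ℂ U r := by rw [ofBp_eq, evalAt_c]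

theorem rootT_commute (k : ℤ) (φ : MapFun) : ofBp φ * rootT k = rootT k * ofBp φ :=
  ofBp_commute _ _

theorem f_mul_rootT (k : ℤ) : f * rootT k =
    rootT k * f - ((k : Scalars) * half * hbar) • (rootT (k + 4) * e) := by
  rw [rootT, f_mul_ofBp, dx_bin_eq, mul_assoc, ofBp_mul, ofBp_mul, ofBp_c, ofBp_hb, ← rootT,
    ← rootT, mul_assoc, mul_assoc, ← Algebra.smul_def, ← Algebra.smul_def]
  have : ((k : Scalars) * half * hbar) • (rootT (k + 4) * e) =
      (k * (1 / 2) : ℂ) • hbar • (rootT (k + 4) * e) := by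
    rw [mul_smul, ← cst_smul (P := osp), cst, map_mul, map_intCast]
  rw [this]

theorem h_mul_rootT (k : ℤ) : h * rootT k =
    rootT k * h + ((k : Scalars) * half) • (rootT (k + 4) - rootT k) := by
  have h2 := two_mul_half
  have h3 := hbar_smul_rootT_mul_bp (k + 4)
  have h4 : ofBp (2 * x * dx (bin (-(k : ℂ) / 4))) =
      (2 * ((k : Scalars) * half)) • hbar • (rootT (k + 4) * bp) := by
    have e1 : 2 * x * (c (k * (1 / 2)) * hb * bin (-((k + 4 : ℤ) : ℂ) / 4)) =
        c (k * (1 / 2)) * (2 * (hb * (bin (-((k + 4 : ℤ) : ℂ) / 4) * x))) := by ring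
    rw [dx_bin_eq, e1, ofBp_mul, ofBp_mul, ofBp_mul, ofBp_mul, ← rootT, ofBp_x, ofBp_hb, ofBp_c,
      ← Algebra.smul_def, ← Algebra.smul_def, ← cst_smul (P := osp), cst, map_mul, map_intCast,
      mul_comm (2 : Scalars), mul_smul _ (2 : Scalars), ← c_two, ofBp_c, map_ofNat, two_smul, two_mul]
  rw [rootT, h_mul_ofBp, ← rootT, h4, h3, smul_smul, add_sub_cancel_right]
  congr 2
  linear_combination (k : Scalars) * half * h2

theorem e_mul_rootT (k : ℤ) : e * rootT k = rootT k * e := (ofBp_mul_e _).symm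

theorem twistE_eq : twistE = rootT 1 * e := by
  rw [twistE, fn_smul, rootT]
  norm_num

theorem twistH_eq : twistH = rootT (-2) * h := by
  rw [twistH, fn_smul, rootT, ← bin_half]
  norm_num

theorem ofBp_quarter : ofBp (bin (1 / 4)) = rootT (-1) := by
  rw [rootT]
  norm_num

theorem ofBp_neg_quarter_pow (n : ℕ) : ofBp (bin (-1 / 4) ^ n) = rootT n := by
  rw [rootT, bin_eq_expo, expo_pow, bin_eq_expo]
  congr 2
  push_cast
  ring

theorem ofBp_quarter_pow (n : ℕ) : ofBp (bin (1 / 4) ^ n) = rootT (-n) := by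
  rw [rootT, bin_eq_expo, expo_pow, bin_eq_expo]
  congr 2
  push_cast
  ring

theorem ofBp_scalar_mul (r : ℂ) (φ : MapFun) : ofBp (c r * hb * φ) = (cst r * hbar) • ofBp φ := by
  rw [ofBp_mul, ofBp_mul, ofBp_c, ofBp_hb, mul_assoc, ← Algebra.smul_def, ← Algebra.smul_def,
    mul_smul, cst_smul]

theorem twistF_eq : twistF = rootT (-1) * f - (half ^ 3 * hbar) • (rootT 3 * e - rootT (-1) * e)
    + (half * hbar) • (rootT (-1) * (e * h)) := by
  have k1 := two_mul_c_half
  have k2 := bin_quarter_mul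
  have k3 := bin_quarter_pow
  have h1 : c (1 / 2) ^ 2 * hb ^ 2 * x * bin (-1 / 4) ^ 3 =
      c (1 / 8) * hb * (bin (-1 / 4) ^ 3 - bin (1 / 4)) := by
    rw [c_one_div_eight]
    grind
  have h2 : ofBp (bin (-1 / 4) ^ 3 - bin (1 / 4)) = rootT 3 - rootT (-1) := by
    rw [ofBp_eq, map_sub, ← ofBp_eq, ← ofBp_eq, ofBp_neg_quarter_pow, ofBp_quarter]
    rfl
  rw [twistF, h1, fn_smul, fn_smul, fn_smul, ofBp_scalar_mul, ofBp_scalar_mul, h2, ofBp_quarter,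
    cst_eighth, smul_mul_assoc, smul_mul_assoc, sub_mul]

theorem twist_Y_eq : twist Y = -(rootT (-2) * (f * f)) + (half * hbar) • (rootT (-2) * (h * h))
    + (half ^ 3 * hbar) • (rootT 2 - rootT (-2)) := by
  have h2 : ofBp (bin (-1 / 4) ^ 2 - bin (1 / 4) ^ 2) = rootT 2 - rootT (-2) := by
    rw [ofBp_eq, map_sub, ← ofBp_eq, ← ofBp_eq, ofBp_neg_quarter_pow, ofBp_quarter_pow]
    rfl
  rw [twist_Y, fn_smul, fn_smul, fn_smul, ← c_one_div_eight, ofBp_scalar_mul, ofBp_scalar_mul, h2,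
    ofBp_quarter_pow, cst_eighth, smul_mul_assoc, mul_one]
  rfl

section

/-! ### Tensor squares -/

namespace SuperPres

variable {P : SuperPres}

theorem tmul_add_left (a b d : P.Alg) : P.tmul (a + b) d = P.tmul a d + P.tmul b d := by
  rw [tmul, map_add, add_mul]
  rfl

theorem tmul_add_right (a b d : P.Alg) : P.tmul a (b + d) = P.tmul a b + P.tmul a d := by
  rw [tmul, map_add, mul_add]
  rfl

theorem tmul_neg_left (a d : P.Alg) : P.tmul (-a) d = -P.tmul a d := by
  rw [tmul, map_neg, neg_mul]
  rfl

theorem tmul_neg_right (a b : P.Alg) : P.tmul a (-b) = -P.tmul a b := by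
  rw [tmul, map_neg, mul_neg]
  rfl

theorem tmul_sub_left (a b d : P.Alg) : P.tmul (a - b) d = P.tmul a d - P.tmul b d := by
  rw [tmul, map_sub, sub_mul]
  rfl

theorem tmul_sub_right (a b d : P.Alg) : P.tmul a (b - d) = P.tmul a b - P.tmul a d := by
  rw [tmul, map_sub, mul_sub]
  rfl

theorem tmul_smul_left (r : Scalars) (a d : P.Alg) : P.tmul (r • a) d = r • P.tmul a d := by
  rw [tmul, map_smul, smul_mul_assoc]
  rfl

theorem tmul_smul_right (r : Scalars) (a d : P.Alg) : P.tmul a (r • d) = r • P.tmul a d := by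
  rw [tmul, map_smul, mul_smul_comm]
  rfl

variable {π : P.Alg →ₐ[Scalars] P.Alg}

theorem tmul_mul_tmul (hπ : P.IsParity π) {p q : Bool} (a : P.Alg) {b d : P.Alg} (u : P.Alg)
    (hb : π b = sgn true p • b) (hd : π d = sgn true q • d) :
    P.tmul a b * P.tmul d u = sgn p q • P.tmul (a * d) (b * u) := by
  have h1 := slot_mul_slot hπ (ι := Fin 2) (i := 1) (j := 0) (by decide) hb hd
  rw [tmul, tmul, tmul, map_mul, map_mul, mul_assoc, ← mul_assoc (P.slot 1 b), h1, smul_mul_assoc,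
    mul_smul_comm, mul_assoc, mul_assoc]

theorem tmul_mul_of_even_right (hπ : P.IsParity π) (a : P.Alg) {b : P.Alg} (d u : P.Alg)
    (hb : π b = b) : P.tmul a b * P.tmul d u = P.tmul (a * d) (b * u) := by
  have h1 : P.slot (1 : Fin 2) b * P.slot 0 d = P.slot 0 d * P.slot 1 b :=
    slot_commute hπ (by decide) hb d
  rw [tmul, tmul, tmul, map_mul, map_mul, mul_assoc, ← mul_assoc (P.slot 1 b), h1, mul_assoc,
    mul_assoc]

theorem tmul_mul_of_even_left (hπ : P.IsParity π) (a b : P.Alg) {d : P.Alg} (u : P.Alg)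
    (hd : π d = d) : P.tmul a b * P.tmul d u = P.tmul (a * d) (b * u) := by
  have h1 : P.slot (0 : Fin 2) d * P.slot 1 b = P.slot 1 b * P.slot 0 d :=
    slot_commute hπ (by decide) hd b
  rw [tmul, tmul, tmul, map_mul, map_mul, mul_assoc, ← mul_assoc (P.slot 1 b), ← h1, mul_assoc,
    mul_assoc]

theorem tmul_mul_of_odd (hπ : P.IsParity π) (a : P.Alg) {b d : P.Alg} (u : P.Alg)
    (hb : π b = -b) (hd : π d = -d) : P.tmul a b * P.tmul d u = -P.tmul (a * d) (b * u) := by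
  rw [tmul_mul_tmul hπ (p := true) (q := true) a u (by rw [hb]; exact (neg_one_smul ℂ b).symm)
    (by rw [hd]; exact (neg_one_smul ℂ d).symm)]
  exact neg_one_smul ℂ _

end SuperPres

open SuperPres

/-- The tensor square of `U`. -/
abbrev UU : Type := (osp.tensor (Fin 2)).Alg

local notation:70 a:71 " ⊠ " b:71 => osp.tmul a b

theorem tmul_mul_rootT (a d u : U) (k : ℤ) : a ⊠ rootT k * (d ⊠ u) = (a * d) ⊠ (rootT k * u) :=
  tmul_mul_of_even_right parU_isParity _ _ _ (parU_ofBp _)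

theorem tmul_mul_one (a b u : U) : a ⊠ b * (1 ⊠ u) = a ⊠ (b * u) := by
  rw [tmul_mul_of_even_left parU_isParity _ _ _ (map_one _), mul_one]

theorem tmul_mul_h (a b u : U) : a ⊠ b * (h ⊠ u) = (a * h) ⊠ (b * u) :=
  tmul_mul_of_even_left parU_isParity _ _ _ parU_h

theorem one_tmul_mul_one (a d u : U) : a ⊠ 1 * (d ⊠ u) = (a * d) ⊠ u := by
  rw [tmul_mul_of_even_right parU_isParity _ _ _ (map_one _), one_mul]

theorem tmul_h_mul (a d u : U) : a ⊠ h * (d ⊠ u) = (a * d) ⊠ (h * u) :=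
  tmul_mul_of_even_right parU_isParity _ _ _ parU_h

theorem tmul_e_mul_e (a u : U) : a ⊠ e * (e ⊠ u) = -(a * e) ⊠ (e * u) :=
  (tmul_mul_of_odd parU_isParity _ _ parU_e parU_e).trans (tmul_neg_left _ _).symm

theorem tmul_e_mul_f (a u : U) : a ⊠ e * (f ⊠ u) = -(a * f) ⊠ (e * u) :=
  (tmul_mul_of_odd parU_isParity _ _ parU_e parU_f).trans (tmul_neg_left _ _).symm

theorem tmul_f_mul_e (a u : U) : a ⊠ f * (e ⊠ u) = -(a * e) ⊠ (f * u) :=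
  (tmul_mul_of_odd parU_isParity _ _ parU_f parU_e).trans (tmul_neg_left _ _).symm

theorem tmul_f_mul_f (a u : U) : a ⊠ f * (f ⊠ u) = -(a * f) ⊠ (f * u) :=
  (tmul_mul_of_odd parU_isParity _ _ parU_f parU_f).trans (tmul_neg_left _ _).symm

theorem tmul_rootT_e_mul_f (a u : U) (k : ℤ) :
    a ⊠ (rootT k * e) * (f ⊠ u) = -(a * f) ⊠ (rootT k * e * u) :=
  (tmul_mul_of_odd parU_isParity _ _ (by rw [map_mul, parU_e, rootT, parU_ofBp, mul_neg])
    parU_f).trans (tmul_neg_left _ _).symm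

/-- The mixed terms cancel because odd elements of different factors anticommute. -/
theorem coproductU_triple : OspTriple (h ⊠ 1 + 1 ⊠ h : UU) (e ⊠ 1 + 1 ⊠ e) (f ⊠ 1 + 1 ⊠ f) := by
  refine ⟨?_, ?_, ?_⟩ <;>
  simp only [mul_add, add_mul, tmul_mul_one, one_tmul_mul_one, tmul_e_mul_f, tmul_f_mul_e,
    tmul_e_mul_e, tmul_f_mul_f, tmul_h_mul, tmul_mul_h, one_mul, mul_one, tmul_neg_left, h_mul_e, f_mul_e,
    tmul_add_left, tmul_add_right, f_mul_h, tmul_sub_left, tmul_sub_right, tmul_neg_right] <;>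
  abel

theorem exists_classicalCoproduct : ∃ Δ₀ : U →ₐ[Scalars] UU, Δ₀ h = h ⊠ 1 + 1 ⊠ h ∧
    Δ₀ e = e ⊠ 1 + 1 ⊠ e ∧ Δ₀ f = f ⊠ 1 + 1 ⊠ f := coproductU_triple.exists_hom

/-- The coproduct of `U`. -/
def coproductU : U →ₐ[Scalars] UU := exists_classicalCoproduct.choose

theorem coproductU_h : coproductU h = h ⊠ 1 + 1 ⊠ h := exists_classicalCoproduct.choose_spec.1

theorem coproductU_e : coproductU e = e ⊠ 1 + 1 ⊠ e := exists_classicalCoproduct.choose_spec.2.1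

theorem coproductU_f : coproductU f = f ⊠ 1 + 1 ⊠ f := exists_classicalCoproduct.choose_spec.2.2

theorem coproductU_isClassicalCoproduct : IsClassicalCoproduct coproductU := fun x => by
  have hbp : coproductU bp = bp ⊠ 1 + 1 ⊠ bp := by
    rw [← e_sq, map_pow, coproductU_e]
    simp only [sq, mul_add, add_mul, tmul_mul_one, one_tmul_mul_one, tmul_e_mul_e, one_mul, mul_one,
      tmul_neg_left]
    abel
  have hbm : coproductU bm = bm ⊠ 1 + 1 ⊠ bm := by
    have h1 : bm = -f ^ 2 := by rw [f_sq, neg_neg]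
    rw [h1, map_neg, map_pow, coproductU_f]
    simp only [sq, mul_add, add_mul, tmul_mul_one, one_tmul_mul_one, tmul_f_mul_f, one_mul, mul_one,
      tmul_neg_left, tmul_neg_right]
    abel
  cases x with
  | h => exact coproductU_h
  | e => exact coproductU_e
  | f => exact coproductU_f
  | bp => exact hbp
  | bm => exact hbm

/-! ### The twist -/

/-- The twisting element of the tensor square of `U`. -/
def twistUnit : UUˣ := expoUnit 1 (osp.slot (0 : Fin 2) h * osp.slot (1 : Fin 2) (ofBp logDiv))

local notation "h₁" => osp.slot (0 : Fin 2) h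
local notation "X₂" => osp.slot (1 : Fin 2) (ofBp logDiv)

theorem twistUnit_val : (twistUnit : UU) = expo 1 (h₁ * X₂) := rfl

theorem slot_one_commute (φ : MapFun) (u : U) :
    Commute (osp.slot (1 : Fin 2) (ofBp φ)) (osp.slot (0 : Fin 2) u) :=
  slot_commute parU_isParity (by decide) (parU_ofBp φ) u

theorem h₁_commute (u : U) : Commute h₁ (osp.slot (1 : Fin 2) u) :=
  slot_commute parU_isParity (by decide) parU_h u

/-- Moving the exponent h ⊗ X past an element of weight r replaces h by h + r, so the exponential
acquires the factor exp(rħX) = T^r in the second place. -/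
theorem twistUnit_mul_slot_zero {u : U} {r : ℂ} (hu : h * u = u * h + r • u) :
    (twistUnit : UU) * osp.slot (0 : Fin 2) u =
      osp.slot (0 : Fin 2) u * twistUnit * osp.slot (1 : Fin 2) (ofBp (bin (-r / 2))) := by
  have h1 : expo 1 (h₁ * X₂) * osp.slot (0 : Fin 2) u = osp.slot (0 : Fin 2) u * expo 1 (h₁ * X₂ + r • X₂) := by
    refine evalAt_mul_eq ?_ _
    rw [mul_assoc, (slot_one_commute _ _).eq, ← mul_assoc, ← map_mul, hu, map_add, map_mul,
      map_cSmul, add_mul, smul_mul_assoc, mul_add, mul_smul_comm, mul_assoc]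
  have h2 : Commute (h₁ * X₂) (r • X₂) :=
    (Commute.mul_left (h₁_commute _) (Commute.refl _)).smul_right r
  rw [twistUnit_val, h1, expo_add_of_commute 1 h2, expo_smul, one_mul, ← map_expo, expo_ofBp_logDiv,
    mul_assoc]

/-- The commutator of the exponent with 1 ⊗ u is h ⊗ w and commutes with the exponent, so only the
first-order term appears. -/
theorem twistUnit_mul_slot_one {u w : U} (hu : ofBp logDiv * u = u * ofBp logDiv + w)
    (hw : ofBp logDiv * w = w * ofBp logDiv) :
    (twistUnit : UU) * osp.slot (1 : Fin 2) u = osp.slot (1 : Fin 2) u * twistUnit +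
      twistUnit * osp.slot (1 : Fin 2) (hbar • w) * h₁ := by
  have hc : h₁ * X₂ * (h₁ * osp.slot (1 : Fin 2) w) = h₁ * osp.slot (1 : Fin 2) w * (h₁ * X₂) := by
    rw [mul_assoc, ← mul_assoc X₂, ← (h₁_commute (ofBp logDiv)).eq, mul_assoc h₁ X₂, ← map_mul, hw, map_mul,
      mul_assoc h₁ _ (h₁ * X₂), ← mul_assoc _ h₁ X₂, ← (h₁_commute w).eq, mul_assoc h₁ _ X₂]
  have h1 := evalAt_intertwine (a := h₁ * X₂) (z := osp.slot (1 : Fin 2) u) (c := h₁ * X₂)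
    (w := h₁ * osp.slot (1 : Fin 2) w) (by
      rw [mul_assoc, ← map_mul, hu, map_add, map_mul, mul_add, ← mul_assoc, (h₁_commute u).eq,
        mul_assoc]) hc (expPow 1)
  rw [evalAt_dx_expPow_neg_one, one_smul, mul_smul_comm] at h1
  have h2 : h₁ * osp.slot (1 : Fin 2) w * expo 1 (h₁ * X₂) =
      expo 1 (h₁ * X₂) * (h₁ * osp.slot (1 : Fin 2) w) := (evalAt_commute hc (expPow 1)).symm.eq
  rw [h2] at h1
  rw [twistUnit_val, map_smul, mul_smul_comm, smul_mul_assoc, mul_assoc _ _ h₁,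
    ← (h₁_commute w).eq]
  exact h1

/-- The twisted coproduct of `U`. -/
def twistedCoproduct : U →ₐ[Scalars] UU := (conjAlg twistUnit).comp coproductU

theorem twistedCoproduct_eq {a : U} {b : UU} (hab : coproductU a * twistUnit = twistUnit * b) :
    twistedCoproduct a = b := conjAlg_eq hab

theorem tmul_one (a : U) : a ⊠ 1 = osp.slot (0 : Fin 2) a := by
  rw [tmul, map_one, mul_one]

theorem one_tmul (a : U) : 1 ⊠ a = osp.slot (1 : Fin 2) a := by
  rw [tmul, map_one, one_mul]

theorem slot_rootT_mul (k l : ℤ) : osp.slot (1 : Fin 2) (rootT k) * osp.slot (1 : Fin 2) (rootT l) =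
    osp.slot (1 : Fin 2) (rootT (k + l)) := by
  rw [← map_mul, rootT_mul]

theorem slot_zero_mul_twistUnit {u : U} {k : ℤ} (hu : h * u = u * h + (k : ℂ) • u) :
    osp.slot (0 : Fin 2) u * (twistUnit : UU) = twistUnit * (u ⊠ rootT (-(2 * k))) := by
  have h1 := twistUnit_mul_slot_zero hu
  have h2 : ofBp (bin (-(k : ℂ) / 2)) = rootT (2 * k) := by
    rw [rootT]
    congr 2
    push_cast
    ring
  rw [tmul, ← mul_assoc, h1, h2, mul_assoc, slot_rootT_mul, add_neg_cancel, rootT_zero, map_one, mul_one]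

theorem dx_logDiv_eq_rootT : ofBp (dx logDiv) = rootT 4 := by
  rw [dx_logDiv_eq_bin, rootT]
  norm_num

theorem twistedCoproduct_e : twistedCoproduct e = e ⊠ rootT (-2) + 1 ⊠ e := by
  refine twistedCoproduct_eq ?_
  have h1 := slot_zero_mul_twistUnit (u := e) (k := 1) (by rw [h_mul_e, Int.cast_one, one_smul])
  have h2 := twistUnit_mul_slot_one (u := e) (w := 0) (by rw [ofBp_mul_e, add_zero]) (by simp)
  rw [smul_zero, map_zero, mul_zero, zero_mul, add_zero] at h2
  rw [coproductU_e, add_mul, tmul_one, one_tmul, h1, mul_add, h2]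
  rfl

theorem twistedCoproduct_h : twistedCoproduct h = h ⊠ rootT 4 + 1 ⊠ h := by
  refine twistedCoproduct_eq ?_
  have e1 : hbar • ofBp (2 * x * dx logDiv) = rootT 4 - 1 := by
    rw [hbar_smul_ofBp, hb_mul_dx_logDiv, ofBp_eq, map_sub, map_one, ← ofBp_eq, ← dx_logDiv_eq_bin,
      dx_logDiv_eq_rootT]
  have h1 := slot_zero_mul_twistUnit (u := h) (k := 0) (by rw [Int.cast_zero, zero_smul, add_zero])
  have h2 := twistUnit_mul_slot_one (u := h) (w := -ofBp (2 * x * dx logDiv))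
    (by rw [h_mul_ofBp]; abel) (by rw [mul_neg, ofBp_commute, neg_mul])
  rw [smul_neg, e1, neg_sub, map_sub, map_one] at h2
  rw [mul_zero, neg_zero, rootT_zero] at h1
  rw [coproductU_h, add_mul, tmul_one, one_tmul, h1, tmul_one, ← sub_eq_iff_eq_add.2 h2, tmul, (h₁_commute _).eq]
  noncomm_ring

theorem twistedCoproduct_f : twistedCoproduct f = f ⊠ rootT 2 + 1 ⊠ f - h ⊠ (hbar • (rootT 4 * e)) := by
  refine twistedCoproduct_eq ?_
  have h1 := slot_zero_mul_twistUnit (u := f) (k := -1) (by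
    rw [f_mul_h, Int.cast_neg, Int.cast_one, neg_one_smul]; abel)
  have h2 := twistUnit_mul_slot_one (u := f) (w := rootT 4 * e)
    (by rw [f_mul_ofBp, dx_logDiv_eq_rootT]; abel)
    (by rw [← mul_assoc, rootT_commute, mul_assoc, ofBp_mul_e, mul_assoc])
  rw [coproductU_f, add_mul, tmul_one, one_tmul, h1, ← sub_eq_iff_eq_add.2 h2,
    show h ⊠ (hbar • (rootT 4 * e)) = _ from (h₁_commute _).eq]
  norm_num
  noncomm_ring

instance : Algebra ℕ Scalars := Semiring.toNatAlgebra

instance : Algebra ℤ Scalars := Ring.toIntAlgebra _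

theorem expo_neg_two_logDiv : expo (-2) (ofBp logDiv) = rootT (-4) := by
  rw [expo_ofBp_logDiv, rootT]
  norm_num

theorem twistedCoproduct_bp : twistedCoproduct bp = bp ⊠ rootT (-4) + 1 ⊠ bp := by
  rw [← e_sq, map_pow, twistedCoproduct_e]
  simp only [sq, mul_add, add_mul, tmul_mul_rootT, tmul_mul_one, one_tmul_mul_one, tmul_e_mul_e,
    one_mul, mul_one, rootT_mul, tmul_neg_left, e_mul_rootT]
  norm_num

/-- The image b₊ ⊗ T⁻² + 1 ⊗ b₊ of b₊ is the addition theorem for (1 − T⁻²)/(2ħ) at X ⊗ 1 + 1 ⊗ X.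
Applying L makes X primitive, hence T group-like. -/
theorem twistedCoproduct_logDiv :
    twistedCoproduct (ofBp logDiv) = ofBp logDiv ⊠ 1 + 1 ⊠ ofBp logDiv := by
  have hc : Commute (osp.slot (0 : Fin 2) (ofBp logDiv)) X₂ := (slot_one_commute _ _).symm
  have h2 : ofBp (evalAt logDiv oneSubDiv) = bp := by
    rw [evalAt_logDiv_oneSubDiv, ofBp_x]
  have h3 : evalAt (ofBp logDiv) oneSubDiv = bp := by
    rw [← h2, ofBp_eq, ofBp_eq, evalAt_evalAt]
  have h4 := evalAt_oneSubDiv_add hc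
  rw [← map_evalAt, ← map_evalAt, h3, ← map_expo, expo_neg_two_logDiv] at h4
  have h5 : twistedCoproduct bp =
      evalAt (osp.slot (0 : Fin 2) (ofBp logDiv) + X₂) oneSubDiv := by
    rw [h4, twistedCoproduct_bp, one_tmul]
    rfl
  rw [ofBp_eq, map_evalAt, h5, evalAt_logDiv_evalAt_oneSubDiv, tmul_one, one_tmul, ofBp_eq]

theorem rootT_eq_expo (k : ℤ) : rootT k = expo ((k : ℂ) / 2) (ofBp logDiv) := by
  rw [expo_ofBp_logDiv, rootT]
  congr 2
  ring

theorem twistedCoproduct_rootT (k : ℤ) : twistedCoproduct (rootT k) = rootT k ⊠ rootT k := by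
  have hc : Commute (osp.slot (0 : Fin 2) (ofBp logDiv)) X₂ := (slot_one_commute _ _).symm
  rw [rootT_eq_expo, map_expo, twistedCoproduct_logDiv, tmul_one, one_tmul,
    expo_add_of_commute _ hc, tmul, map_expo, map_expo]

theorem twistedCoproduct_twistE :
    twistedCoproduct twistE = twistE ⊠ rootT (-1) + rootT 1 ⊠ twistE := by
  rw [twistE_eq, map_mul, twistedCoproduct_rootT, twistedCoproduct_e]
  simp only [mul_add, tmul_mul_rootT, rootT_mul, mul_one]
  norm_num

theorem twistedCoproduct_twistH :
    twistedCoproduct twistH = twistH ⊠ rootT 2 + rootT (-2) ⊠ twistH := by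
  rw [twistH_eq, map_mul, twistedCoproduct_rootT, twistedCoproduct_h]
  simp only [mul_add, tmul_mul_rootT, rootT_mul, mul_one]
  norm_num

theorem twistedCoproduct_twistF : twistedCoproduct twistF =
    twistF ⊠ rootT 1 + rootT (-1) ⊠ twistF
    + (hbar * half ^ 2) • ((rootT (-2) * twistE) ⊠ (rootT (-1) * twistH + twistH * rootT (-1)))
    - (hbar * half ^ 2) • ((rootT 1 * twistH + twistH * rootT 1) ⊠ (rootT 2 * twistE)) := by
  have k1 := two_mul_half
  rw [twistF_eq, twistE_eq, twistH_eq]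
  simp only [map_add, map_sub, map_mul, map_smul, twistedCoproduct_rootT, twistedCoproduct_e,
    twistedCoproduct_h, twistedCoproduct_f, mul_add, mul_sub, add_mul, sub_mul, tmul_mul_rootT,
    tmul_mul_one, tmul_mul_h, tmul_h_mul, one_tmul_mul_one, mul_one, one_mul,
    tmul_add_left, tmul_add_right, tmul_sub_left, tmul_sub_right, tmul_smul_left,
    tmul_smul_right, mul_smul_comm, smul_mul_assoc, smul_add, smul_sub, mul_assoc, rootT_mul,
    rootT_mul_mul, h_mul_rootT, e_mul_rootT, h_mul_e, smul_smul]
  norm_num only [Int.cast_neg, Int.cast_one]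
  match_scalars <;> grind

theorem f_mul_rootT_mul (k : ℤ) (u : U) : f * (rootT k * u) =
    rootT k * (f * u) - ((k : Scalars) * half * hbar) • (rootT (k + 4) * (e * u)) := by
  rw [← mul_assoc, f_mul_rootT, sub_mul, smul_mul_assoc, mul_assoc (rootT _), mul_assoc (rootT _)]

theorem e_mul_rootT_mul (k : ℤ) (u : U) : e * (rootT k * u) = rootT k * (e * u) := by
  rw [← mul_assoc, e_mul_rootT, mul_assoc]

theorem e_mul_e_eq_bp : e * e = bp := by rw [← sq, e_sq]

theorem hbar_smul_tmul_rootT_mul_bp (u : U) (k : ℤ) :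
    hbar • (u ⊠ (rootT k * bp)) = half • (u ⊠ rootT k - u ⊠ rootT (k - 4)) := by
  rw [← tmul_smul_right, hbar_smul_rootT_mul_bp, tmul_smul_right, tmul_sub_right]

theorem twistedCoproduct_twist_Y :
    twistedCoproduct (twist Y) = twist Y ⊠ rootT 2 + rootT (-2) ⊠ twist Y := by
  have k1 := two_mul_half
  rw [twist_Y_eq]
  simp only [map_add, map_sub, map_neg, map_mul, map_smul, twistedCoproduct_rootT,
    twistedCoproduct_h, twistedCoproduct_f, mul_add, mul_sub, add_mul, sub_mul, tmul_mul_rootT,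
    tmul_mul_one, tmul_mul_h, tmul_h_mul, one_tmul_mul_one, mul_one, one_mul, tmul_f_mul_f,
    tmul_rootT_e_mul_f, tmul_neg_left,
    tmul_add_left, tmul_add_right, tmul_sub_left, tmul_sub_right, tmul_smul_left,
    tmul_smul_right, mul_smul_comm, smul_mul_assoc, smul_add, smul_sub, mul_assoc, rootT_mul,
    rootT_mul_mul, h_mul_rootT, e_mul_rootT, e_mul_rootT_mul, h_mul_e, h_mul_e_mul,
    f_mul_rootT_mul, f_mul_rootT, f_mul_e, f_mul_h, e_mul_e_eq_bp, smul_smul, neg_mul, mul_neg, neg_neg, smul_neg, tmul_neg_right]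
  norm_num only [Int.cast_neg, Int.cast_one, Int.cast_ofNat]
  -- The square of e in the second factor leaves b₊ with a coefficient divisible by ħ. It has to be
  -- expressed by powers of T before coefficients can be compared.
  rw [show hbar * (4 * (half * hbar)) = (4 * (half * hbar)) * hbar by ring, mul_smul _ hbar,
    mul_smul hbar hbar, hbar_smul_tmul_rootT_mul_bp, hbar_smul_tmul_rootT_mul_bp]
  norm_num only
  match_scalars <;> grind

end

open SuperPres

/-! ### Tensor products of maps and the Jordanian coproduct -/

namespace SuperPres

variable {P Q : SuperPres} {ι κ : Type}

theorem exists_tensorMap {π : Q.Alg →ₐ[Scalars] Q.Alg} (hπ : Q.IsParity π)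
    (n : P.Alg →ₐ[Scalars] Q.Alg)
    (hn : ∀ x, π (n (P.gen x)) = sgn true (P.odd x) • n (P.gen x)) :
    ∃ F : (P.tensor ι).Alg →ₐ[Scalars] (Q.tensor ι).Alg,
      ∀ i a, F (P.slot i a) = Q.slot i (n a) :=
  exists_tensor_lift (fun i => (Q.slot i).comp n) fun _ _ x y hij =>
    slot_mul_slot hπ hij (hn x) (hn y)

/-- Used for Δ ⊗ id and id ⊗ Δ, whose two components supercommute because Δ preserves parity. -/
theorem reindex_mul_slot_gen {R : (P.tensor ι).Alg →ₐ[Scalars] (P.tensor ι).Alg}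
    (hR : (P.tensor ι).IsParity R) (j : ι ↪ κ) {k : κ} (hk : ∀ i, j i ≠ k) {p : Bool}
    {w : (P.tensor ι).Alg} (hw : R w = sgn true p • w) (y : P.Gen) :
    P.reindex j w * P.slot k (P.gen y) =
      sgn p (P.odd y) • (P.slot k (P.gen y) * P.reindex j w) := by
  have hg (i : ι) (x : P.Gen) : P.reindex j (P.slot i (P.gen x)) * P.slot k (P.gen y) =
      sgn (P.odd x) (P.odd y) • (P.slot k (P.gen y) * P.reindex j (P.slot i (P.gen x))) := by
    rw [reindex_slot, slot_gen_mul (hk i)]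
  cases hy : P.odd y with
  | false =>
    have h1 : ∀ z : ι × P.Gen, P.reindex j ((P.tensor ι).gen z) * P.slot k (P.gen y) =
        P.slot k (P.gen y) * P.reindex j ((P.tensor ι).gen z) := fun z => by
      have h2 := hg z.1 z.2
      rw [slot_gen, hy] at h2
      simpa [sgn] using h2
    simpa [sgn] using intertwine h1 w
  | true =>
    have h1 : ∀ z : ι × P.Gen, P.reindex j ((P.tensor ι).gen z) * P.slot k (P.gen y) =
        P.slot k (P.gen y) * ((P.reindex j).comp R) ((P.tensor ι).gen z) := fun z => by
      have h2 := hg z.1 z.2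
      have h3 : R ((P.tensor ι).gen z) = sgn true (P.odd z.2) • (P.tensor ι).gen z := hR z
      rw [slot_gen, hy] at h2
      rw [AlgHom.comp_apply, h3, map_cSmul, mul_smul_comm]
      refine h2.trans ?_
      rw [sgn, sgn, Bool.and_comm]
    have h4 := intertwine h1 w
    rw [AlgHom.comp_apply, hw, map_cSmul, mul_smul_comm] at h4
    rw [h4, sgn, sgn, Bool.and_comm]

theorem exists_isTensorId {R : (P.tensor (Fin 2)).Alg →ₐ[Scalars] (P.tensor (Fin 2)).Alg}
    (hR : (P.tensor (Fin 2)).IsParity R) {Δ : P.Alg →ₐ[Scalars] (P.tensor (Fin 2)).Alg}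
    (hΔ : ∀ x, R (Δ (P.gen x)) = sgn true (P.odd x) • Δ (P.gen x)) :
    ∃ D : (P.tensor (Fin 2)).Alg →ₐ[Scalars] (P.tensor (Fin 3)).Alg, IsTensorId Δ D := by
  obtain ⟨D, h1, h2⟩ := exists_tensor_lift_two ((P.reindex (Fin.castSuccEmb (n := 2))).comp Δ)
    (P.slot (2 : Fin 3)) fun x y => reindex_mul_slot_gen hR _ (by decide) (hΔ x) y
  exact ⟨D, fun a b => by rw [tmul, map_mul, h1, h2]; rfl⟩

theorem exists_isIdTensor {R : (P.tensor (Fin 2)).Alg →ₐ[Scalars] (P.tensor (Fin 2)).Alg}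
    (hR : (P.tensor (Fin 2)).IsParity R) {Δ : P.Alg →ₐ[Scalars] (P.tensor (Fin 2)).Alg}
    (hΔ : ∀ x, R (Δ (P.gen x)) = sgn true (P.odd x) • Δ (P.gen x)) :
    ∃ D : (P.tensor (Fin 2)).Alg →ₐ[Scalars] (P.tensor (Fin 3)).Alg, IsIdTensor Δ D := by
  obtain ⟨D, h1, h2⟩ := exists_tensor_lift_two (P.slot (0 : Fin 3))
    ((P.reindex (Fin.succEmb 2)).comp Δ) fun x y => by
      have h := reindex_mul_slot_gen hR (Fin.succEmb 2) (k := 0) (by decide) (hΔ y) x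
      rw [AlgHom.comp_apply, h, smul_smul]
      cases P.odd x <;> cases P.odd y <;> simp [sgn]
  exact ⟨D, fun a b => by rw [tmul, map_mul, h1, h2]; rfl⟩

end SuperPres

/-- The tensor square of `Uh`. -/
abbrev UhUh : Type := (jord.tensor (Fin 2)).Alg

theorem exists_untwistSquare : ∃ F : UU →ₐ[Scalars] UhUh,
    ∀ i a, F (osp.slot i a) = jord.slot i (untwist a) :=
  exists_tensorMap parJ_isParity untwist fun x => by
    rw [parJ_untwist, parU_isParity x, map_cSmul]

/-- The tensor square of `untwist`. -/
def untwistSquare : UU →ₐ[Scalars] UhUh := exists_untwistSquare.choose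

theorem untwistSquare_slot (i : Fin 2) (a : U) :
    untwistSquare (osp.slot i a) = jord.slot i (untwist a) :=
  exists_untwistSquare.choose_spec i a

theorem untwistSquare_tmul (a b : U) :
    untwistSquare (osp.tmul a b) = jord.tmul (untwist a) (untwist b) := by
  rw [tmul, map_mul, untwistSquare_slot, untwistSquare_slot]
  rfl

/-- The coproduct of `Uh`. -/
def coproductJ : Uh →ₐ[Scalars] UhUh := untwistSquare.comp (twistedCoproduct.comp twist)

theorem coproductJ_apply (a : Uh) : coproductJ a = untwistSquare (twistedCoproduct (twist a)) := rfl

theorem untwist_rootT (k : ℤ) : untwist (rootT k) = T ((k : ℂ) / 2) := by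
  have : twist (T ((k : ℂ) / 2)) = rootT k := by
    rw [twist_T, rootT]
    congr 2
    ring
  rw [← this, untwist_twist_apply]

theorem untwist_twistE : untwist twistE = E := by rw [← twist_E, untwist_twist_apply]

theorem untwist_twistH : untwist twistH = H := by rw [← twist_H, untwist_twist_apply]

theorem untwist_twistF : untwist twistF = F := by rw [← twist_F, untwist_twist_apply]

theorem untwist_logDiv : untwist (ofBp logDiv) = X := by rw [← twist_X, untwist_twist_apply]

theorem twist_T_eq_rootT (k : ℤ) : twist (T ((k : ℂ) / 2)) = rootT k := by
  rw [← untwist_rootT, twist_untwist_apply]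

theorem coproductJ_T (k : ℤ) :
    coproductJ (T ((k : ℂ) / 2)) = jord.tmul (T ((k : ℂ) / 2)) (T ((k : ℂ) / 2)) := by
  rw [coproductJ_apply, twist_T_eq_rootT, twistedCoproduct_rootT, untwistSquare_tmul, untwist_rootT]

theorem coproductJ_isCoproduct : IsCoproduct coproductJ where
  on_H := by
    rw [coproductJ_apply, twist_H, twistedCoproduct_twistH, map_add, untwistSquare_tmul,
      untwistSquare_tmul, untwist_twistH, untwist_rootT, untwist_rootT]
    norm_num
  on_E := by
    rw [coproductJ_apply, twist_E, twistedCoproduct_twistE, map_add, untwistSquare_tmul,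
      untwistSquare_tmul, untwist_twistE, untwist_rootT, untwist_rootT]
    norm_num
  on_F := by
    rw [coproductJ_apply, twist_F, twistedCoproduct_twistF]
    simp only [map_add, map_sub, map_smul, map_mul, untwistSquare_tmul, untwist_twistE,
      untwist_twistF, untwist_twistH, untwist_rootT, cst_quarter]
    norm_num
  on_T := by simpa using coproductJ_T 2
  on_T_inv := by
    have := coproductJ_T (-2)
    norm_num at this
    exact this
  on_X := by
    rw [coproductJ_apply, twist_X, twistedCoproduct_logDiv, map_add, untwistSquare_tmul,
      untwistSquare_tmul, untwist_logDiv, map_one]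
  on_Y := by
    rw [coproductJ_apply, twistedCoproduct_twist_Y, map_add, untwistSquare_tmul,
      untwistSquare_tmul, untwist_twist_apply, untwist_rootT, untwist_rootT]
    norm_num

/-- The twisting element of the tensor square of `Uh`. -/
def twistUnitJ : UhUhˣ := Units.map untwistSquare.toRingHom.toMonoidHom twistUnit

theorem twistUnitJ_val : (twistUnitJ : UhUh) = untwistSquare twistUnit := rfl

theorem untwist_h_eq : untwist h = T 1 * H := untwist_isInverse.on_h

theorem twistUnitJ_eq_expo : (twistUnitJ : UhUh) = expo 1 (jord.tmul (T 1 * H) X) := by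
  rw [twistUnitJ_val, twistUnit_val, map_expo, map_mul, untwistSquare_slot, untwistSquare_slot,
    untwist_h_eq, untwist_logDiv]
  rfl

theorem twistUnitJ_isExp : IsExp (hbar • jord.tmul (T 1 * H) X) (twistUnitJ : UhUh) := by
  rw [twistUnitJ_eq_expo]
  exact isExp_expo _

/-- The coproduct is by definition the transport of Δ₀ conjugated by the inverse twist, so
conjugation by G recovers Δ₀. -/
theorem twistUnitJ_mul_coproductJ (a : U) : (twistUnitJ : UhUh) * coproductJ (untwist a) *
    ((twistUnitJ⁻¹ : UhUhˣ) : UhUh) = untwistSquare (coproductU a) := by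
  have h1 : (twistUnit : UU) * twistedCoproduct a * ((twistUnit⁻¹ : UUˣ) : UU) = coproductU a := by
    change (twistUnit : UU) * (((twistUnit⁻¹ : UUˣ) : UU) * coproductU a * twistUnit) *
      ((twistUnit⁻¹ : UUˣ) : UU) = coproductU a
    simp only [mul_assoc, Units.mul_inv, Units.mul_inv_cancel_left, mul_one]
  rw [coproductJ_apply, twist_untwist_apply, ← h1, map_mul, map_mul]
  rfl

theorem exists_parity_jord_square : ∃ R : UhUh →ₐ[Scalars] UhUh, (jord.tensor (Fin 2)).IsParity R ∧
    ∀ a, R (coproductJ a) = coproductJ (parJ a) := by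
  obtain ⟨R, hR, hs⟩ := exists_parity_tensor (ι := Fin 2) parJ_isParity
  have ht (a b : Uh) : R (jord.tmul a b) = jord.tmul (parJ a) (parJ b) := by
    rw [tmul, map_mul, hs, hs]
    rfl
  have hT (r : ℂ) : parJ (T r) = T r := parJ_ofT _
  have hΔ := coproductJ_isCoproduct
  have h1 : R.comp coproductJ = coproductJ.comp parJ := by
    refine jord_hom_ext ?_ ?_ ?_
    · simp only [AlgHom.comp_apply, hΔ.on_H, map_add, ht, parJ_H, hT]
    · simp only [AlgHom.comp_apply, hΔ.on_E, map_add, map_neg, ht, parJ_E, hT, tmul_neg_left,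
        tmul_neg_right]
      abel
    · simp only [AlgHom.comp_apply, hΔ.on_F, map_add, map_sub, map_mul, map_neg, map_smul, ht,
        parJ_E, parJ_F, parJ_H, hT, tmul_neg_left, tmul_neg_right, mul_neg, smul_neg]
      abel
  exact ⟨R, hR, DFunLike.congr_fun h1⟩

theorem exists_isTensorId_coproductJ : ∃ D, IsTensorId coproductJ D := by
  obtain ⟨R, hR, h⟩ := exists_parity_jord_square
  exact exists_isTensorId hR fun x => by rw [h, parJ_isParity x, map_cSmul]

theorem exists_isIdTensor_coproductJ : ∃ D, IsIdTensor coproductJ D := by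
  obtain ⟨R, hR, h⟩ := exists_parity_jord_square
  exact exists_isIdTensor hR fun x => by rw [h, parJ_isParity x, map_cSmul]

/-! ### The cocycle identity -/

/-- Write h for TH. As G conjugates Δ(h) to h₁ + h₂, one has G₁₂(Δ ⊗ id)(G) = exp(ħ(h₁ + h₂)X₃)G₁₂.
As X is primitive, (id ⊗ Δ)(G) = exp(ħh₁X₃)exp(ħh₁X₂). Both sides of the identity equal
exp(ħh₂X₃)exp(ħh₁X₃)exp(ħh₁X₂). -/
theorem cocycle_twistUnitJ {D₁ D₂ : UhUh →ₐ[Scalars] (jord.tensor (Fin 3)).Alg}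
    (h₁ : IsTensorId coproductJ D₁) (h₂ : IsIdTensor coproductJ D₂) :
    jord.reindex (Fin.castSuccEmb (n := 2)) (twistUnitJ : UhUh) * D₁ (twistUnitJ : UhUh) =
      jord.reindex (Fin.succEmb 2) (twistUnitJ : UhUh) * D₂ (twistUnitJ : UhUh) := by
  have hp : parJ (T 1 * H) = T 1 * H := by rw [map_mul, parJ_H, T, parJ_ofT]
  have hc {i j : Fin 3} (hij : i ≠ j) (b : Uh) :
      Commute (jord.slot i (T 1 * H)) (jord.slot j b) := slot_commute parJ_isParity hij hp b
  have hX {i j : Fin 3} (hij : i ≠ j) (b : Uh) :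
      Commute (jord.slot i X) (jord.slot j b) := slot_commute parJ_isParity hij parJ_X b
  have e₁ : jord.reindex (Fin.castSuccEmb (n := 2)) (twistUnitJ : UhUh) =
      expo 1 (jord.slot (0 : Fin 3) (T 1 * H) * jord.slot (1 : Fin 3) X) := by
    rw [twistUnitJ_eq_expo, map_expo, tmul, map_mul, reindex_slot, reindex_slot]
    rfl
  have e₂ : jord.reindex (Fin.succEmb 2) (twistUnitJ : UhUh) =
      expo 1 (jord.slot (1 : Fin 3) (T 1 * H) * jord.slot (2 : Fin 3) X) := by
    rw [twistUnitJ_eq_expo, map_expo, tmul, map_mul, reindex_slot, reindex_slot]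
    rfl
  have e₃ : D₂ (twistUnitJ : UhUh) =
      expo 1 (jord.slot (0 : Fin 3) (T 1 * H) * jord.slot (2 : Fin 3) X) *
      expo 1 (jord.slot (0 : Fin 3) (T 1 * H) * jord.slot (1 : Fin 3) X) := by
    have hcomm : Commute (jord.slot (0 : Fin 3) (T 1 * H) * jord.slot (2 : Fin 3) X)
        (jord.slot (0 : Fin 3) (T 1 * H) * jord.slot (1 : Fin 3) X) :=
      ((Commute.refl _).mul_right (hc (by decide) X)).mul_left
        ((hX (by decide) _).mul_right (hX (by decide) _))
    rw [← expo_add_of_commute 1 hcomm, twistUnitJ_eq_expo, map_expo, h₂,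
      coproductJ_isCoproduct.on_X, tmul, tmul, map_one, map_one, mul_one, one_mul, map_add,
      reindex_slot, reindex_slot, mul_add, add_comm]
    rfl
  have e₄ : D₁ (twistUnitJ : UhUh) = expo 1 (jord.reindex (Fin.castSuccEmb (n := 2))
      (coproductJ (T 1 * H)) * jord.slot (2 : Fin 3) X) := by
    rw [twistUnitJ_eq_expo, map_expo, h₁]
  have e₅ : jord.reindex (Fin.castSuccEmb (n := 2)) (twistUnitJ : UhUh) *
      jord.reindex (Fin.castSuccEmb (n := 2)) (coproductJ (T 1 * H)) =
      (jord.slot (1 : Fin 3) (T 1 * H) + jord.slot (0 : Fin 3) (T 1 * H)) *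
        jord.reindex (Fin.castSuccEmb (n := 2)) (twistUnitJ : UhUh) := by
    have h3 := twistUnitJ_mul_coproductJ h
    rw [Units.mul_inv_eq_iff_eq_mul, coproductU_h, map_add, untwistSquare_tmul,
      untwistSquare_tmul, map_one, untwist_h_eq] at h3
    rw [← map_mul, h3, map_mul, map_add, tmul, tmul, map_one, map_one, mul_one, one_mul,
      reindex_slot, reindex_slot]
    exact congrArg (· * _) (add_comm _ _)
  have e₆ : Commute (jord.slot (2 : Fin 3) X)
      (jord.reindex (Fin.castSuccEmb (n := 2)) (twistUnitJ : UhUh)) := by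
    rw [e₁]
    exact (evalAt_commute ((hX (by decide) _).mul_right (hX (by decide) _)).symm _).symm
  have e₇ : expo 1 ((jord.slot (1 : Fin 3) (T 1 * H) + jord.slot (0 : Fin 3) (T 1 * H)) *
      jord.slot (2 : Fin 3) X) * jord.reindex (Fin.castSuccEmb (n := 2)) (twistUnitJ : UhUh) =
      jord.reindex (Fin.castSuccEmb (n := 2)) (twistUnitJ : UhUh) * D₁ (twistUnitJ : UhUh) := by
    rw [e₄]
    exact evalAt_mul_eq (by rw [mul_assoc, e₆.eq, ← mul_assoc, ← e₅, mul_assoc]) _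
  have e₈ : Commute (jord.slot (1 : Fin 3) (T 1 * H) * jord.slot (2 : Fin 3) X)
      (jord.slot (0 : Fin 3) (T 1 * H) * jord.slot (2 : Fin 3) X) :=
    ((hc (by decide) _).mul_right (hc (by decide) _)).mul_left
      ((hX (by decide) _).mul_right (Commute.refl _))
  rw [← e₇, add_mul, expo_add_of_commute 1 e₈, e₂, e₃, e₁, mul_assoc]

/-! ### Normally ordered exponentials -/

/-- For even a, the elements a ⊗ 1 and 1 ⊗ b commute, so (a ⊗ b)^n = a^n ⊗ b^n; linear maps may be
applied termwise to ħ-adic sums. -/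
theorem SuperPres.IsMulIdTensor.map_expo {P : SuperPres} {g : P.Alg →ₗ[Scalars] P.Alg}
    {ν : (P.tensor (Fin 2)).Alg →ₗ[Scalars] P.Alg} (hν : IsMulIdTensor g ν)
    {π : P.Alg →ₐ[Scalars] P.Alg} (hπ : P.IsParity π) {a : P.Alg} (ha : π a = a) (b : P.Alg)
    (r : ℂ) : ν (expo r (P.tmul a b)) =
      hsum fun n => (r ^ n / (n.factorial : ℂ)) • (a ^ n * g (b ^ n)) := by
  have hc : Commute (P.slot (0 : Fin 2) a) (P.slot 1 b) := slot_commute hπ (by decide) ha b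
  rw [expo_eq_ev, ev_apply, map_hsum]
  congr 1
  funext n
  rw [PowerSeries.coeff_mk, tmul, hc.mul_pow, ← map_pow, ← map_pow, ← algebraMap_smul Scalars,
    map_smul, algebraMap_smul]
  exact congrArg _ (hν _ _)

theorem ordExp_eq_hsum : ordExp =
    hsum fun n => ((-1) ^ n / (n.factorial : ℂ)) • (h ^ n * ofBp logDiv ^ n) := by
  have hc : Commute (LinearMap.mulLeft Scalars h) (LinearMap.mulRight Scalars (ofBp logDiv)) :=
    LinearMap.commute_mulLeft_right h (ofBp logDiv)
  have h1 := map_hsum (LinearMap.applyₗ (R := Scalars) (M := U) (M₂ := U) 1) fun n =>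
    ((-1) ^ n / (n.factorial : ℂ)) •
      (LinearMap.mulLeft Scalars h * LinearMap.mulRight Scalars (ofBp logDiv)) ^ n
  rw [ordExp, expo_eq_ev, ev_apply]
  simp only [PowerSeries.coeff_mk]
  refine h1.trans ?_
  congr 1
  funext n
  rw [hc.mul_pow, LinearMap.pow_mulLeft, LinearMap.pow_mulRight]
  simp only [LinearMap.applyₗ_apply_apply, LinearMap.smul_apply, Module.End.mul_apply,
    LinearMap.mulLeft_apply, LinearMap.mulRight_apply, one_mul]

theorem mulIdTensor_disentangle {ν : UU →ₗ[Scalars] U} (hν : IsMulIdTensor LinearMap.id ν) :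
    ν (expo (-1) (osp.tmul h (ofBp logDiv))) = expo (-1) (h * bp) := by
  rw [hν.map_expo parU_isParity parU_h, ← ordExp_eq, ordExp_eq_hsum]
  rfl

/-- Since S(X) = −X, the terms of G become (−ħ)^n (TH)^n X^n / n!. Their sum is the image of the
normally ordered exponential, which is exp(−ħ h b₊). -/
theorem mulIdTensor_twistUnitJ {ν : UhUh →ₗ[Scalars] Uh} (hν : IsMulIdTensor antipodeJ ν) :
    ν (twistUnitJ : UhUh) = untwist gU := by
  have hp : parJ (T 1 * H) = T 1 * H := by rw [map_mul, parJ_H, T, parJ_ofT]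
  rw [twistUnitJ_eq_expo, hν.map_expo parJ_isParity hp, gU_val, ordExp_eq_hsum]
  refine Eq.trans ?_ (map_hsum untwist.toLinearMap _).symm
  congr 1
  funext n
  change _ = untwist _
  rw [map_cSmul, map_mul untwist, map_pow untwist, map_pow untwist, untwist_h_eq, untwist_logDiv,
    antipodeJ_X_pow]
  rcases n.even_or_odd with hn | hn
  · rw [hn.neg_pow, hn.neg_one_pow, one_pow]
  · rw [hn.neg_pow, hn.neg_one_pow, one_pow, neg_div, mul_neg, neg_smul, smul_neg]

theorem antipodeJ_isAntipode : IsAntipode antipodeJ where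
  anti := superAnti_isSuperAntihom parJ_isParity antiJ
  on_H := antipodeJ_H
  on_E := antipodeJ_E
  on_F := antipodeJ_F
  on_T := antipodeJ_T 1
  on_T_inv := by rw [antipodeJ_T, neg_neg]
  on_Y := antipodeJ_Y

/-- The image of `gU` under `untwist`. -/
def gJ : Uhˣ := Units.map untwist.toRingHom.toMonoidHom gU

theorem gJ_val : (gJ : Uh) = untwist gU := rfl

theorem gJ_mul_antipodeJ (a : U) :
    (gJ : Uh) * antipodeJ (untwist a) * ((gJ⁻¹ : Uhˣ) : Uh) = untwist (antipodeU a) :=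
  gU_mul_antipodeJ a

theorem isExp_expo_neg {A : Type} [Ring A] [Algebra Scalars A] [HComplete A] [Algebra ℂ A]
    [IsScalarTower ℂ Scalars A] (a : A) : IsExp (-(hbar • a)) (expo (-1) a) := by
  have h1 := isExp_expo (-a)
  rwa [smul_neg, ← neg_one_smul ℂ a, expo_smul, one_mul] at h1

/-- Under `untwist` the product h b₊ becomes TH(1 − T⁻²)/(2ħ), so −ħ h b₊ becomes the exponent of g.
-/
theorem gJ_isExp : IsExp (-(cst (1 / 2) • (T 1 * H * (1 - T (-1) ^ 2)))) (gJ : Uh) := by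
  have h1 : (gJ : Uh) = expo (-1) (T 1 * H * ofT oneSubDiv) := by
    rw [gJ_val, gU, expoUnit]
    change untwist (expo (-1) (h * bp)) = _
    rw [map_expo, map_mul, untwist_h_eq, untwist_bp]
  have h2 : T (-1) ^ 2 = ofT (expPow (-2)) := by
    rw [T, ofT_eq, ofT_eq, ← map_pow, sq, ← expPow_add]
    norm_num
  have h3 : hbar • ofT oneSubDiv = half • (1 - T (-1) ^ 2) := by
    have h4 := two_mul_half
    have h5 := congrArg (evalAt X) two_hb_oneSubDiv
    rw [map_mul, map_mul, map_ofNat, evalAt_hb, map_sub, map_one, ← ofT_eq, ← ofT_eq, ← h2,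
      ← map_ofNat (algebraMap Scalars Uh), ← map_mul, ← Algebra.smul_def] at h5
    rw [← h5, smul_smul]
    congr 1
    linear_combination -hbar * h4
  rw [h1, ← mul_smul_comm, ← h3, mul_smul_comm]
  exact isExp_expo_neg _

/-! ### Disentanglement -/

theorem cst_smul_tmul_logOnePlus :
    cst (1 / 2) • osp.tmul h (ofBp (logOnePlus (-(c 2 * hb * x)))) =
      -(hbar • osp.tmul h (ofBp logDiv)) := by
  have h1 : cst (1 / 2) • ofBp (logOnePlus (-(c 2 * hb * x))) = -(hbar • ofBp logDiv) := by
    have h2 := two_mul_half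
    have h3 : ofBp (logOnePlus (-(c 2 * hb * x))) = -((2 * hbar) • ofBp logDiv) := by
      rw [logOnePlus_eq, ofBp_eq, map_neg, map_mul, map_mul, map_ofNat, evalAt_hb, ← ofBp_eq,
        Algebra.smul_def, map_mul, map_ofNat]
    rw [h3, smul_neg, smul_smul]
    congr 2
    linear_combination hbar * h2
  rw [← tmul_smul_right, h1, tmul_neg_right, tmul_smul_right]

end Jordanian

end

/-! ### The main theorem -/

open Jordanian in
theorem mainTheorem7 :
    -- the direct maps
    (∀ φ₁ : MapFun, φ₁.Admissible →
      (∃ φ₂ φ₃ u₁ u₂ : MapFun, DirectSolution φ₁ φ₂ φ₃ u₁ u₂ ∧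
        φ₂.limit = 1 ∧ φ₃.limit = 1 ∧ u₁.limit = 0 ∧ u₂.limit = 0) ∧
      ∀ φ₂ φ₃ u₁ u₂ : MapFun,
        ((∃ m : Uh →ₐ[Scalars] U, IsDirect φ₁ φ₂ φ₃ u₁ u₂ m) ↔
          DirectSolution φ₁ φ₂ φ₃ u₁ u₂) ∧
        ∀ m : Uh →ₐ[Scalars] U, IsDirect φ₁ φ₂ φ₃ u₁ u₂ m →
          m (T 1) = ofBp (MapFun.hb * MapFun.x * φ₁ ^ 2 + MapFun.root φ₁) ∧
          m (T (-1)) = ofBp (-(MapFun.hb * MapFun.x * φ₁ ^ 2) + MapFun.root φ₁)) ∧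
    -- the inverse maps
    (∀ ψ₁ : MapFun, ψ₁.Admissible →
      (∃ ψ₂ ψ₃ w₁ w₂ : MapFun, InverseSolution ψ₁ ψ₂ ψ₃ w₁ w₂ ∧
        ψ₂.limit = 1 ∧ ψ₃.limit = 1 ∧ w₁.limit = 0 ∧ w₂.limit = 0) ∧
      ∀ ψ₂ ψ₃ w₁ w₂ : MapFun,
        (∃ n : U →ₐ[Scalars] Uh, IsInverse ψ₁ ψ₂ ψ₃ w₁ w₂ n) ↔
          InverseSolution ψ₁ ψ₂ ψ₃ w₁ w₂) ∧
    -- every direct map is inverted by an inverse map, and conversely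
    (∀ (φ₁ φ₂ φ₃ u₁ u₂ : MapFun) (m : Uh →ₐ[Scalars] U), φ₁.Admissible →
      IsDirect φ₁ φ₂ φ₃ u₁ u₂ m →
      ∃ (ψ₁ ψ₂ ψ₃ w₁ w₂ : MapFun) (n : U →ₐ[Scalars] Uh), ψ₁.Admissible ∧
        IsInverse ψ₁ ψ₂ ψ₃ w₁ w₂ n ∧ AreInverse m n) ∧
    (∀ (ψ₁ ψ₂ ψ₃ w₁ w₂ : MapFun) (n : U →ₐ[Scalars] Uh), ψ₁.Admissible →
      IsInverse ψ₁ ψ₂ ψ₃ w₁ w₂ n →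
      ∃ (φ₁ φ₂ φ₃ u₁ u₂ : MapFun) (m : Uh →ₐ[Scalars] U), φ₁.Admissible ∧
        IsDirect φ₁ φ₂ φ₃ u₁ u₂ m ∧ AreInverse m n) ∧
    (∀ (φ₁ φ₂ φ₃ u₁ u₂ ψ₁ ψ₂ ψ₃ w₁ w₂ : MapFun)
      (m : Uh →ₐ[Scalars] U) (n : U →ₐ[Scalars] Uh), φ₁.Admissible → ψ₁.Admissible →
      IsDirect φ₁ φ₂ φ₃ u₁ u₂ m → IsInverse ψ₁ ψ₂ ψ₃ w₁ w₂ n →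
      (AreInverse m n ↔ m (ofT ψ₁) * ofBp φ₁ = 1)) ∧
    -- the minimal twist map, its twist and its antipode-transforming element
    (∃ (m : Uh →ₐ[Scalars] U) (n : U →ₐ[Scalars] Uh),
      IsDirect (MapFun.mtm (-1 / 4)) (MapFun.mtm (1 / 2)) (MapFun.mtm (1 / 4))
        (-(MapFun.c (1 / 4) * MapFun.hb ^ 2 * MapFun.x * MapFun.mtm (-3 / 4)))
        (MapFun.c (1 / 2) * MapFun.hb * MapFun.mtm (1 / 4)) m ∧
      m (T 1) = ofBp (MapFun.mtm (-1 / 2)) ∧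
      m (T (-1)) = ofBp (MapFun.mtm (1 / 2)) ∧
      IsInverse (MapFun.expPow (-1 / 2)) (MapFun.expPow 1) (MapFun.expPow (1 / 2))
        (MapFun.c (1 / 8) * MapFun.hb * MapFun.expPow (1 / 2) *
          (MapFun.expPow 1 - MapFun.expPow (-1)))
        (-(MapFun.c (1 / 2) * MapFun.hb * MapFun.expPow (1 / 2))) n ∧
      AreInverse m n ∧
      ∃ (Δ : Uh →ₐ[Scalars] (jord.tensor (Fin 2)).Alg) (S : Uh →ₗ[Scalars] Uh)
        (Δ₀ : U →ₐ[Scalars] (osp.tensor (Fin 2)).Alg) (S₀ : U →ₗ[Scalars] U)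
        (n₂ : (osp.tensor (Fin 2)).Alg →ₐ[Scalars] (jord.tensor (Fin 2)).Alg)
        (Δ_id id_Δ : (jord.tensor (Fin 2)).Alg →ₐ[Scalars] (jord.tensor (Fin 3)).Alg)
        (μ_id_S : (jord.tensor (Fin 2)).Alg →ₗ[Scalars] Uh)
        (G : ((jord.tensor (Fin 2)).Alg)ˣ) (g : Uhˣ),
        IsCoproduct Δ ∧ IsAntipode S ∧ IsClassicalCoproduct Δ₀ ∧ IsClassicalAntipode S₀ ∧
        SuperPres.IsTensorSquare n n₂ ∧
        SuperPres.IsTensorId Δ Δ_id ∧ SuperPres.IsIdTensor Δ id_Δ ∧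
        SuperPres.IsMulIdTensor S μ_id_S ∧
        IsExp (hbar • jord.tmul (T 1 * H) X) (G : (jord.tensor (Fin 2)).Alg) ∧
        (∀ a : U, (G : (jord.tensor (Fin 2)).Alg) * Δ (n a) *
          ((G⁻¹ : ((jord.tensor (Fin 2)).Alg)ˣ) : (jord.tensor (Fin 2)).Alg) = n₂ (Δ₀ a)) ∧
        jord.reindex (Fin.castSuccEmb (n := 2)) (G : (jord.tensor (Fin 2)).Alg) *
            Δ_id (G : (jord.tensor (Fin 2)).Alg) =
          jord.reindex (Fin.succEmb 2) (G : (jord.tensor (Fin 2)).Alg) *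
            id_Δ (G : (jord.tensor (Fin 2)).Alg) ∧
        IsExp (-(cst (1 / 2) • (T 1 * H * (1 - T (-1) ^ 2)))) (g : Uh) ∧
        (∀ a : U, (g : Uh) * S (n a) * ((g⁻¹ : Uhˣ) : Uh) = n (S₀ a)) ∧
        μ_id_S (G : (jord.tensor (Fin 2)).Alg) = (g : Uh)) ∧
    -- the disentanglement identity
    (∃ (μ : (osp.tensor (Fin 2)).Alg →ₗ[Scalars] U) (K : (osp.tensor (Fin 2)).Alg),
      SuperPres.IsMulIdTensor LinearMap.id μ ∧
      IsExp (cst (1 / 2) • osp.tmul h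
        (ofBp (MapFun.logOnePlus (-(MapFun.c 2 * MapFun.hb * MapFun.x))))) K ∧
      IsExp (-(hbar • (h * bp))) (μ K)) := by
  refine ⟨fun φ₁ h₁ => ⟨exists_directSolution h₁, fun φ₂ φ₃ u₁ u₂ =>
      ⟨exists_isDirect_iff h₁, fun m hm => ⟨?_, ?_⟩⟩⟩,
    fun ψ₁ h₁ => ⟨exists_inverseSolution h₁, fun ψ₂ ψ₃ w₁ w₂ => exists_isInverse_iff h₁⟩,
    fun φ₁ φ₂ φ₃ u₁ u₂ m h₁ hm => hm.exists_inverse h₁,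
    fun ψ₁ ψ₂ ψ₃ w₁ w₂ n h₁ hn => hn.exists_inverse h₁,
    fun φ₁ φ₂ φ₃ u₁ u₂ ψ₁ ψ₂ ψ₃ w₁ w₂ m n h₁ _ hm hn => hm.areInverse_iff h₁ hn, ?_, ?_⟩
  · rw [T, hm.on_ofT, evalAt_logT_expPow_one]
  · rw [T, hm.on_ofT, evalAt_logT_expPow_neg_one]
  · obtain ⟨D₁, hD₁⟩ := exists_isTensorId_coproductJ
    obtain ⟨D₂, hD₂⟩ := exists_isIdTensor_coproductJ
    obtain ⟨ν, hν⟩ := SuperPres.exists_isMulIdTensor parJ_isParity antipodeJ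
    refine ⟨twist, untwist, twist_isDirect, ?_, ?_, untwist_isInverse,
      .of_comp twist_untwist untwist_twist, coproductJ, antipodeJ, coproductU, antipodeU,
      untwistSquare, D₁, D₂, ν, twistUnitJ, gJ, coproductJ_isCoproduct, antipodeJ_isAntipode,
      coproductU_isClassicalCoproduct, antipodeU_isClassicalAntipode, untwistSquare_tmul,
      hD₁, hD₂, hν, twistUnitJ_isExp, twistUnitJ_mul_coproductJ, cocycle_twistUnitJ hD₁ hD₂,
      gJ_isExp, gJ_mul_antipodeJ, mulIdTensor_twistUnitJ hν⟩
    · rw [twist_T, MapFun.mtm_eq_bin]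
    · rw [twist_T, MapFun.mtm_eq_bin, neg_neg]
  · obtain ⟨ν, hν⟩ := SuperPres.exists_isMulIdTensor parU_isParity (LinearMap.id : U →ₗ[Scalars] U)
    refine ⟨ν, expo (-1) (osp.tmul h (ofBp MapFun.logDiv)), hν, ?_, ?_⟩
    · rw [cst_smul_tmul_logOnePlus]
      exact isExp_expo_neg _
    · rw [mulIdTensor_disentangle hν]
      exact isExp_expo_neg _
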